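/- **Definitions.** A *non-commutative probability space* $(\mathcal M,\varphi)$ is a unital complex $*$-algebra $\mathcal M$ with a linear form $\varphi$ such that $\varphi(1)=1$, $\varphi(xy)=\varphi(yx)$, $\varphi(x^*)=\overline{\varphi(x)}$ and $\varphi(xx^*)\ge 0$ for all $x,y\in\mathcal M$. Subalgebras are unital and stable under $*$; $x$ is *centered* if $\varphi(x)=0$. A family of subalgebras is *independent* if distinct members commute and every product of centered elements taken from pairwise distinct members is centered; it is *free* if every product of centered elements, any two consecutive ones being taken from distinct members, is centered. For $t\in[0,+\infty)$ let $\nu_t$ be the law of the free unitary Brownian motion at time $t$, i.e. the probability measure on the unit circle, invariant under complex conjugation, whose moment of order $k\ge1$ is $e^{-kt/2}\sum_{j=0}^{k-1}\frac{(-t)^j}{j!}\binom{k}{j+1}k^{j-1}$, and let $\nu_{+\infty}$ be the uniform law on the circle. Let $t\in[0,+\infty]$. Two subalgebras $\mathcal A,\mathcal B$ of $(\mathcal M,\varphi)$ are *$t$-free* if, for all $r\ge 0$, $a_1,\dots,a_r\in\mathcal A$ and $b_1,\dots,b_r\in\mathcal B$, the number $\varphi(a_1b_1\cdots a_rb_r)$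 is equal to the expectation of $a_1(u_tb_1u_t^*)\cdots a_r(u_tb_ru_t^*)$ in the free product $[(\mathcal A,\varphi_{|\mathcal A})\otimes(\mathcal B,\varphi_{|\mathcal B})]*(\mathcal U^{(t)},\varphi_{\mathcal U^{(t)}})$, in which (the copies of) $\mathcal A$ and $\mathcal B$ are independent, and the algebra that they generate is free with a unitary $u_t$ of law $\nu_t$. For $\sigma\in\mathfrak S_n$ put $\varphi_\sigma(m_1,\dots,m_n)=\prod_{(i_1\dots i_r)}\varphi(m_{i_1}\cdots m_{i_r})$, the product being over all cycles $(i_1\dots i_r)$ of $\sigma$, fixed points included. For $n\ge2$, a *$t$-free cumulant of order $n$* is a family $(c(\sigma))_{\sigma\in\mathfrak S_n}$ of complex numbers such that $\sum_{\sigma\ n\text{-cycle}}c(\sigma)\ne0$ and such that, for every non-commutative probability space $(\mathcal M,\varphi)$, every pair $(\mathcal A,\mathcal B)$ of $t$-free subalgebras of $\mathcal M$ and all $m_1,\dots,m_n\in\mathcal A\cup\mathcal B$ which do not all belong to $\mathcal A$ and do not all belong to $\mathcal B$, $$\sum_{\sigma\in\mathfrak S_n}c(\sigma)\,\varphi_\sigma(m_1,\dots,m_n)=0.$$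 It is *conjugation-invariant* if $c(\rho\sigma\rho^{-1})=c(\sigma)$ for all $\sigma,\rho\in\mathfrak S_n$; then $c_\lambda$ denotes the value of $c$ on the permutations whose cycle lengths form the partition $\lambda$ of $n$. **Theorem.** For every $t\in[0,+\infty]$ and every $n\in\{2,3,4,5,6\}$ there exists, up to scaling, a unique conjugation-invariant $t$-free cumulant of order $n$: there is one, and the conjugation-invariant $t$-free cumulants of order $n$ are exactly its multiples by non-zero complex numbers. Normalized by $c_n=1$, its coefficients are given as follows, with $x=e^{-t}$ (and $x=0$ if $t=+\infty$). * $n=2$: $c_2=1$, $c_{11}=-1$. * $n=3$: $c_3=1$, $c_{21}=-2$, $c_{111}=4$. * $n=4$: $c_4=1$, $c_{31}=-3$, $c_{22}=-2(2+x^2)$, $c_{211}=2(5+x^2)$, $c_{1111}=-6(5+x^2)$. * $n=5$: $c_5=1$, $c_{41}=-4$, $c_{32}=-6(1+x^2)$, $c_{311}=6(3+x^2)$, $c_{221}=24(1+x^2)$, $c_{2111}=-12(7+5x^2)$, $c_{11111}=48(7+5x^2)$. * $n=6$: $c_6=1$, $c_{51}=-5$, $c_{42}=-4(2+3x^2)$,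 $c_{411}=4(7+3x^2)$, $c_{33}=-3(3+6x^2+x^3)$, $c_{321}=6(7+12x^2+x^3)$, $c_{3111}=-12(14+15x^2+x^3)$, $c_{222}=8(7+17x^2+6x^4)$, $c_{2211}=-8(28+53x^2+3x^3+6x^4)$, $c_{21111}=48(21+34x^2+2x^3+3x^4)$, $c_{111111}=-240(21+34x^2+2x^3+3x^4)$. -/

import Mathlib

/-!
Polarizing the form `∑ σ, c(σ) φ_σ`, a class function `c` gives a cumulant if and only if the form
`y ↦ ∑ σ, c(σ) φ_σ(y, …, y)` is additive on `A` and `B` for all `t`-free `A` and `B`. This only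
involves the moments of `a + b`. For centered `a` and `b` and up to order `6`, the mixed moments
involved have at most three letters in each subalgebra up to cyclic rotation, and they depend on
the unitary `u_t` only through `|φ(u_t)|² = e^{-t}`: splitting `u_t` into its mean and its centered
part, freeness kills every term in which a centered part survives. Additivity for the given
coefficients is then a polynomial identity.

For uniqueness, subtracting a multiple of the given cumulant leaves a class function which vanishes
on `n`-cycles. Testing additivity on sums of scalars and of `t`-free unitary elements of prescribed
finite or infinite order gives triangular equations, which force its other values to vanish too.

Such pairs exist in the group algebra of the free product of `H × K` with `ℤ`. The linear form
there is a free product of tracial positive definite functions, so it is positive. On `ℤ` this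
function is the sequence of the moments of `ν_t`, which is positive definite for the following
reason. By Lagrange inversion, the generating series `ψ` of the moments satisfies
`ψ = X (1 + ψ) exp (-t (1 / 2 + ψ))`, and multiplication by `1 + 2 ψ` is accretive, by induction on
the order of truncation of the series, since it generates a contraction semigroup.
-/

open scoped ENNReal ComplexOrder

universe u

/-- A non-commutative probability space: a unital complex `*`-algebra with a unital, tracial,
hermitian, positive linear form `φ` (the expectation). -/
structure NCProbSpace where
  carrier : Type u
  [ring : Ring carrier]
  [starRing : StarRing carrier]
  [algebra : Algebra ℂ carrier]
  [starModule : StarModule ℂ carrier]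
  φ : carrier →ₗ[ℂ] ℂ
  φ_one : φ 1 = 1
  φ_mul_comm : ∀ x y, φ (x * y) = φ (y * x)
  φ_star : ∀ x, φ (star x) = star (φ x)
  φ_nonneg : ∀ x, 0 ≤ φ (x * star x)

namespace NCProbSpace

instance : CoeSort NCProbSpace.{u} (Type u) := ⟨carrier⟩

attribute [instance] ring starRing algebra starModule

/-- Independence of a family of unital `*`-subalgebras. -/
def Independent (M : NCProbSpace.{u}) {ι : Type*} (A : ι → StarSubalgebra ℂ M) : Prop :=
  (∀ i j, i ≠ j → ∀ x ∈ A i, ∀ y ∈ A j, x * y = y * x) ∧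
  ∀ (n : ℕ), 1 ≤ n → ∀ i : Fin n → ι, Function.Injective i →
    ∀ a : Fin n → M, (∀ k, a k ∈ A (i k)) → (∀ k, M.φ (a k) = 0) →
      M.φ (List.ofFn a).prod = 0

/-- Freeness of a family of unital `*`-subalgebras. -/
def Free (M : NCProbSpace.{u}) {ι : Type*} (A : ι → StarSubalgebra ℂ M) : Prop :=
  ∀ (n : ℕ), 1 ≤ n → ∀ i : Fin n → ι,
    (∀ k l : Fin n, (l : ℕ) = k + 1 → i k ≠ i l) →
    ∀ a : Fin n → M, (∀ k, a k ∈ A (i k)) → (∀ k, M.φ (a k) = 0) →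
      M.φ (List.ofFn a).prod = 0

end NCProbSpace

noncomputable section

/-- The `k`-th moment of the law of a free unitary Brownian motion at time `t ∈ [0, +∞]`:
for `k ≥ 1` it is `e^{-kt/2} ∑_{j<k} (-t)^j / j! * binom(k, j+1) * k^{j-1}` if `t < +∞`, and the
law at `t = +∞` is the uniform law on the unit circle. -/
def fubmMoment (t : ℝ≥0∞) (k : ℕ) : ℝ :=
  if k = 0 then 1
  else if t = ⊤ then 0
  else Real.exp (-(k * t.toReal / 2)) *
    ∑ j ∈ Finset.range k,
      (-t.toReal) ^ j / (Nat.factorial j : ℝ) * (Nat.choose k (j + 1) : ℝ) *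
        (k : ℝ) ^ ((j : ℤ) - 1)

namespace NCProbSpace

/-- `v` is a unitary element distributed as a free unitary Brownian motion at time `t`
(the moments of negative order are the conjugates of those of positive order). -/
def IsFreeUnitaryBM (X : NCProbSpace.{u}) (t : ℝ≥0∞) (v : X) : Prop :=
  v ∈ unitary (X : Type u) ∧ ∀ k : ℕ, X.φ (v ^ k) = (fubmMoment t k : ℂ)

/-- `X`, together with `i`, `j` and `v`, realizes `((A, φ) ⊗ (B, φ)) * (𝒰⁽ᵗ⁾, φ)`: the copies of
`A` and `B` in `X` have the right expectation and are independent, and the algebra that they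
generate is free with the unitary `v`, a free unitary Brownian motion at time `t`. -/
structure IsTFreeRealization (M : NCProbSpace.{u}) (t : ℝ≥0∞) (A B : StarSubalgebra ℂ M)
    (X : NCProbSpace.{u}) (i : A →⋆ₐ[ℂ] X) (j : B →⋆ₐ[ℂ] X) (v : X) : Prop where
  φ_left : ∀ a : A, X.φ (i a) = M.φ (a : M)
  φ_right : ∀ b : B, X.φ (j b) = M.φ (b : M)
  indep : X.Independent ![i.range, j.range]
  bm : X.IsFreeUnitaryBM t v
  free : X.Free ![i.range ⊔ j.range, StarAlgebra.adjoin ℂ {v}]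

/-- `A` and `B` are `t`-free: the morphism sending `A` to `A` and `v B v*` to `B`, from the
`t`-free product of `A` and `B` to `M`, preserves the expectation. The words below span the
algebra generated by `A` and `v B v*`. -/
def TFree (M : NCProbSpace.{u}) (t : ℝ≥0∞) (A B : StarSubalgebra ℂ M) : Prop :=
  ∃ (X : NCProbSpace.{u}) (i : A →⋆ₐ[ℂ] X) (j : B →⋆ₐ[ℂ] X) (v : X),
    M.IsTFreeRealization t A B X i j v ∧
    ∀ (n : ℕ) (a : Fin n → A) (b : Fin n → B),
      M.φ (List.ofFn fun k => (a k : M) * (b k : M)).prod =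
        X.φ (List.ofFn fun k => i (a k) * (v * j (b k) * star v)).prod

end NCProbSpace

end

/-- The cycle `[i, σ i, σ² i, …]` of `σ` through `i`, equal to `[i]` if `i` is a fixed point. -/
def cycleList {n : ℕ} (σ : Equiv.Perm (Fin n)) (i : Fin n) : List (Fin n) :=
  if σ i = i then [i] else σ.toList i

/-- `φ_σ(m₁, …, mₙ)`, the product over the cycles `(i₁ … i_r)` of `σ`, fixed points included, of
`φ(m_{i₁} ⋯ m_{i_r})`. Each cycle is read from its least element, which is immaterial since `φ`
is tracial. -/
def NCProbSpace.permForm (M : NCProbSpace.{u}) {n : ℕ} (σ : Equiv.Perm (Fin n))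
    (m : Fin n → M) : ℂ :=
  ∏ i with ∀ j, σ.SameCycle i j → i ≤ j, M.φ ((cycleList σ i).map m).prod

/-- A collection `(c(σ))_{σ ∈ 𝔖ₙ}` is a `t`-free cumulant of order `n ≥ 2`; the first sum is over
the `n`-cycles. -/
def IsTFreeCumulant (t : ℝ≥0∞) (n : ℕ) (c : Equiv.Perm (Fin n) → ℂ) : Prop :=
  (∑ σ with σ.cycleType = {n}, c σ) ≠ 0 ∧
  ∀ (M : NCProbSpace.{u}) (A B : StarSubalgebra ℂ M), M.TFree t A B →
    ∀ m : Fin n → M, (∀ i, m i ∈ A ∨ m i ∈ B) → (¬ ∀ i, m i ∈ A) → (¬ ∀ i, m i ∈ B) →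
      ∑ σ, c σ * M.permForm σ m = 0

def IsConjInvariant {n : ℕ} (c : Equiv.Perm (Fin n) → ℂ) : Prop :=
  ∀ σ ρ, c (ρ * σ * ρ⁻¹) = c σ

noncomputable section

/-- `e^{-t}` for `t ∈ [0, +∞]`. -/
def expNeg (t : ℝ≥0∞) : ℝ := if t = ⊤ then 0 else Real.exp (-t.toReal)

/-- The coefficient `c_λ`, as a polynomial in `x = e^{-t}`, for a partition `λ` of an integer
between `2` and `6`, given by the list of its parts in non-increasing order. -/
def tFreeCoeff (x : ℝ) : List ℕ → ℝ
  | [2] => 1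
  | [1, 1] => -1
  | [3] => 1
  | [2, 1] => -2
  | [1, 1, 1] => 4
  | [4] => 1
  | [3, 1] => -3
  | [2, 2] => -2 * (2 + x ^ 2)
  | [2, 1, 1] => 2 * (5 + x ^ 2)
  | [1, 1, 1, 1] => -6 * (5 + x ^ 2)
  | [5] => 1
  | [4, 1] => -4
  | [3, 2] => -6 * (1 + x ^ 2)
  | [3, 1, 1] => 6 * (3 + x ^ 2)
  | [2, 2, 1] => 24 * (1 + x ^ 2)
  | [2, 1, 1, 1] => -12 * (7 + 5 * x ^ 2)
  | [1, 1, 1, 1, 1] => 48 * (7 + 5 * x ^ 2)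
  | [6] => 1
  | [5, 1] => -5
  | [4, 2] => -4 * (2 + 3 * x ^ 2)
  | [4, 1, 1] => 4 * (7 + 3 * x ^ 2)
  | [3, 3] => -3 * (3 + 6 * x ^ 2 + x ^ 3)
  | [3, 2, 1] => 6 * (7 + 12 * x ^ 2 + x ^ 3)
  | [3, 1, 1, 1] => -12 * (14 + 15 * x ^ 2 + x ^ 3)
  | [2, 2, 2] => 8 * (7 + 17 * x ^ 2 + 6 * x ^ 4)
  | [2, 2, 1, 1] => -8 * (28 + 53 * x ^ 2 + 3 * x ^ 3 + 6 * x ^ 4)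
  | [2, 1, 1, 1, 1] => 48 * (21 + 34 * x ^ 2 + 2 * x ^ 3 + 3 * x ^ 4)
  | [1, 1, 1, 1, 1, 1] => -240 * (21 + 34 * x ^ 2 + 2 * x ^ 3 + 3 * x ^ 4)
  | _ => 0

/-- The cycle lengths of `σ`, fixed points included, in non-increasing order. -/
def cycleShape {n : ℕ} (σ : Equiv.Perm (Fin n)) : List ℕ :=
  σ.partition.parts.sort (· ≥ ·)

end

section CycleList

variable {n : ℕ}

lemma mem_cycleList {σ : Equiv.Perm (Fin n)} {i j : Fin n} :
    j ∈ cycleList σ i ↔ σ.SameCycle i j := by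
  by_cases h : σ i = i
  · rw [cycleList, if_pos h, List.mem_singleton]
    exact ⟨fun hj => hj ▸ .refl _ _, fun hs => (hs.eq_of_left h).symm⟩
  · simp [cycleList, h, Equiv.Perm.mem_toList_iff]

lemma nodup_cycleList (σ : Equiv.Perm (Fin n)) (i : Fin n) : (cycleList σ i).Nodup := by
  by_cases h : σ i = i <;> simp [cycleList, h, Equiv.Perm.nodup_toList]

lemma getElem_cycleList (σ : Equiv.Perm (Fin n)) (i : Fin n) (k : ℕ)
    (hk : k < (cycleList σ i).length) : (cycleList σ i)[k] = (σ ^ k) i := by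
  by_cases h : σ i = i
  · have hk0 : k = 0 := by simpa [cycleList, h] using hk
    simp [cycleList, h, hk0]
  · simp only [cycleList, h, if_false, Equiv.Perm.getElem_toList]

lemma length_cycleList (σ : Equiv.Perm (Fin n)) (i : Fin n) :
    (cycleList σ i).length = (Finset.univ.filter (σ.SameCycle i)).card := by
  rw [← List.toFinset_card_of_nodup (nodup_cycleList σ i)]
  congr 1
  ext j
  simp [mem_cycleList]

lemma cycleList_isRotated {σ : Equiv.Perm (Fin n)} {i j : Fin n} (h : σ.SameCycle i j) :
    cycleList σ i ~r cycleList σ j := by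
  by_cases hi : σ i = i
  · rw [h.eq_of_left hi]
  · have hj : σ j ≠ j := mt h.apply_eq_self_iff.2 hi
    rw [cycleList, cycleList, if_neg hi, if_neg hj]
    exact h.toList_isRotated

lemma cycleList_conj (σ ρ : Equiv.Perm (Fin n)) (i : Fin n) :
    cycleList (ρ * σ * ρ⁻¹) (ρ i) = (cycleList σ i).map ρ := by
  have hlength : (cycleList (ρ * σ * ρ⁻¹) (ρ i)).length = (cycleList σ i).length := by
    rw [length_cycleList, length_cycleList]
    refine (Finset.card_equiv ρ fun j => ?_).symm
    simp [Equiv.Perm.sameCycle_conj]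
  refine List.ext_getElem (by rw [hlength, List.length_map]) fun k _ _ => ?_
  rw [getElem_cycleList, List.getElem_map, getElem_cycleList, conj_pow]
  simp

/-- A set of indices which meets each cycle of `σ`, fixed points included, exactly once. The
choice of representatives in `NCProbSpace.permForm` is replaced by an arbitrary one. -/
def IsCycleTransversal (σ : Equiv.Perm (Fin n)) (T : Finset (Fin n)) : Prop :=
  ∀ j, ∃! i, i ∈ T ∧ σ.SameCycle i j

namespace IsCycleTransversal

variable {σ : Equiv.Perm (Fin n)} {T : Finset (Fin n)}

lemma eq_of_sameCycle (hT : IsCycleTransversal σ T) {i j : Fin n} (hi : i ∈ T) (hj : j ∈ T)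
    (hij : σ.SameCycle i j) : i = j :=
  (hT j).unique ⟨hi, hij⟩ ⟨hj, .refl _ _⟩

lemma map_conj (hT : IsCycleTransversal σ T) (ρ : Equiv.Perm (Fin n)) :
    IsCycleTransversal (ρ * σ * ρ⁻¹) (T.map ρ.toEmbedding) := by
  intro j
  obtain ⟨i, ⟨hi, hij⟩, hunique⟩ := hT (ρ⁻¹ j)
  refine ⟨ρ i, ⟨by simpa using hi, by simpa [Equiv.Perm.sameCycle_conj] using hij⟩, ?_⟩
  rintro k ⟨hk, hkj⟩
  obtain ⟨k, hkT, rfl⟩ := Finset.mem_map.1 hk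
  simp only [Equiv.coe_toEmbedding, Equiv.Perm.sameCycle_conj, Equiv.Perm.coe_inv,
    Equiv.symm_apply_apply] at hkj ⊢
  rw [hunique k ⟨hkT, hkj⟩]

lemma mem_of_apply_eq_self (hT : IsCycleTransversal σ T) {i : Fin n} (hi : σ i = i) : i ∈ T := by
  obtain ⟨j, ⟨hj, hji⟩, -⟩ := hT i
  rwa [← hji.symm.eq_of_left hi] at hj

lemma prod_moved {R : Type*} [CommMonoid R] (hT : IsCycleTransversal σ T) (f : ℕ → R) :
    ∏ i ∈ T with σ i ≠ i, f (cycleList σ i).length = (σ.cycleType.map f).prod := by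
  rw [Equiv.Perm.cycleType_def, Multiset.map_map]
  refine Finset.prod_bij (fun i _ => σ.cycleOf i) ?_ ?_ ?_ ?_
  · intro i hi
    rw [Equiv.Perm.cycleOf_mem_cycleFactorsFinset_iff, Equiv.Perm.mem_support]
    exact (Finset.mem_filter.1 hi).2
  · intro i hi j hj hij
    rw [Finset.mem_filter] at hi hj
    refine hT.eq_of_sameCycle hi.1 hj.1 (Equiv.Perm.mem_support_cycleOf_iff.1 ?_).1
    rw [hij, Equiv.Perm.mem_support, Equiv.Perm.cycleOf_apply_self]
    exact hj.2
  · intro τ hτ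
    obtain ⟨hcycle, hτσ⟩ := Equiv.Perm.mem_cycleFactorsFinset_iff.1 hτ
    obtain ⟨j, hj⟩ := hcycle.nonempty_support
    obtain ⟨i, ⟨hi, hij⟩, -⟩ := hT j
    have hσj : σ j ≠ j := hτσ j hj ▸ Equiv.Perm.mem_support.1 hj
    refine ⟨i, Finset.mem_filter.2 ⟨hi, mt hij.apply_eq_self_iff.1 hσj⟩, ?_⟩
    rw [hij.cycleOf_eq]
    exact (Equiv.Perm.cycle_is_cycleOf hj hτ).symm
  · intro i hi
    rw [cycleList, if_neg (Finset.mem_filter.1 hi).2, Equiv.Perm.length_toList]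
    rfl

lemma prod_fixed {R : Type*} [CommMonoid R] (hT : IsCycleTransversal σ T) (f : ℕ → R) :
    ∏ i ∈ T with ¬ σ i ≠ i, f (cycleList σ i).length = f 1 ^ (n - σ.support.card) := by
  have hfixed : T.filter (fun i => ¬ σ i ≠ i) = σ.supportᶜ := by
    ext i
    simpa using hT.mem_of_apply_eq_self
  have hlength : ∀ i ∈ σ.supportᶜ, f (cycleList σ i).length = f 1 := fun i hi => by
    rw [cycleList, if_pos (by simpa using hi), List.length_singleton]
  rw [hfixed, Finset.prod_congr rfl hlength, Finset.prod_const, Finset.card_compl,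
    Fintype.card_fin]

lemma prod_length {R : Type*} [CommMonoid R] (hT : IsCycleTransversal σ T) (f : ℕ → R) :
    ∏ i ∈ T, f (cycleList σ i).length = (σ.partition.parts.map f).prod := by
  rw [← Finset.prod_filter_mul_prod_filter_not T (fun i => σ i ≠ i), hT.prod_moved, hT.prod_fixed,
    Equiv.Perm.parts_partition, Multiset.map_add, Multiset.prod_add, Multiset.map_replicate,
    Multiset.prod_replicate, Fintype.card_fin]

end IsCycleTransversal

lemma isCycleTransversal_minima (σ : Equiv.Perm (Fin n)) :
    IsCycleTransversal σ {i | ∀ j, σ.SameCycle i j → i ≤ j} := by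
  intro j
  obtain ⟨i, hi, hmin⟩ :=
    (Finset.univ.filter (σ.SameCycle j)).exists_minimal ⟨j, by simp [Equiv.Perm.SameCycle.refl]⟩
  simp only [Finset.mem_filter, Finset.mem_univ, true_and] at hi hmin ⊢
  have hle : ∀ k, σ.SameCycle j k → i ≤ k := fun k hk => (le_total i k).elim id (hmin hk)
  refine ⟨i, ⟨fun k hk => hle k (hi.trans hk), hi.symm⟩, fun k hk => ?_⟩
  exact le_antisymm (hk.1 i (hk.2.trans hi)) (hle k hk.2.symm)

end CycleList

namespace NCProbSpace

variable {n : ℕ} (M : NCProbSpace.{u})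

lemma φ_prod_eq_of_isRotated {l l' : List M} (h : l ~r l') : M.φ l.prod = M.φ l'.prod := by
  obtain ⟨k, rfl⟩ := h
  rw [List.rotate_eq_drop_append_take_mod, List.prod_append, M.φ_mul_comm, ← List.prod_append,
    List.take_append_drop]

lemma permForm_eq_prod {σ : Equiv.Perm (Fin n)} {T : Finset (Fin n)}
    (hT : IsCycleTransversal σ T) (m : Fin n → M) :
    M.permForm σ m = ∏ i ∈ T, M.φ ((cycleList σ i).map m).prod := by
  have hmin := isCycleTransversal_minima σ
  choose r hr hr_unique using fun j => hT j
  refine Finset.prod_bij (fun i _ => r i) (fun i _ => (hr i).1) ?_ ?_ fun i _ =>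
    M.φ_prod_eq_of_isRotated ((cycleList_isRotated (hr i).2.symm).map m)
  · intro i hi j hj hij
    refine hmin.eq_of_sameCycle hi hj ((hr i).2.symm.trans ?_)
    rw [hij]
    exact (hr j).2
  · intro k hk
    obtain ⟨i, ⟨hi, hik⟩, -⟩ := hmin k
    exact ⟨i, hi, (hr_unique i k ⟨hk, hik.symm⟩).symm⟩

lemma permForm_conj (σ ρ : Equiv.Perm (Fin n)) (m : Fin n → M) :
    M.permForm (ρ * σ * ρ⁻¹) m = M.permForm σ (m ∘ ρ) := by
  have hmin := isCycleTransversal_minima σ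
  rw [M.permForm_eq_prod (hmin.map_conj ρ), M.permForm_eq_prod hmin, Finset.prod_map]
  refine Finset.prod_congr rfl fun i _ => ?_
  rw [Equiv.coe_toEmbedding, cycleList_conj, List.map_map]

lemma permForm_const (σ : Equiv.Perm (Fin n)) (y : M) :
    M.permForm σ (fun _ => y) = (σ.partition.parts.map fun k => M.φ (y ^ k)).prod := by
  have hmin := isCycleTransversal_minima σ
  simp only [M.permForm_eq_prod hmin, List.map_const', List.prod_replicate, ← hmin.prod_length]

end NCProbSpace

lemma exists_prod_map_update_eq {R ι : Type*} [Monoid R] [DecidableEq ι] {l : List ι}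
    (hl : l.Nodup) {k : ι} (hk : k ∈ l) (m : ι → R) :
    ∃ p q : R, ∀ z, (l.map (Function.update m k z)).prod = p * z * q := by
  obtain ⟨l₁, l₂, rfl⟩ := List.append_of_mem hk
  obtain ⟨hk₁, hk₂⟩ : k ∉ l₁ ∧ k ∉ l₂ := by
    simpa using (List.nodup_cons.1 (List.perm_middle.nodup_iff.1 hl)).1
  have hmap : ∀ l : List ι, k ∉ l → ∀ z, l.map (Function.update m k z) = l.map m := fun l h z =>
    List.map_congr_left fun i hi => Function.update_of_ne (ne_of_mem_of_not_mem hi h) _ _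
  refine ⟨(l₁.map m).prod, (l₂.map m).prod, fun z => ?_⟩
  simp only [List.map_append, List.map_cons, hmap _ hk₁, hmap _ hk₂, List.prod_append,
    List.prod_cons, Function.update_self, mul_assoc]

namespace NCProbSpace

variable {n : ℕ} (M : NCProbSpace.{u})

lemma exists_permForm_update_eq (σ : Equiv.Perm (Fin n)) (m : Fin n → M) (k : Fin n) :
    ∃ (p q : M) (C : ℂ), ∀ z, M.permForm σ (Function.update m k z) = M.φ (p * z * q) * C := by
  obtain ⟨T, hT⟩ : ∃ T, IsCycleTransversal σ T := ⟨_, isCycleTransversal_minima σ⟩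
  obtain ⟨i, ⟨hi, hik⟩, hunique⟩ := hT k
  obtain ⟨p, q, hpq⟩ := exists_prod_map_update_eq (nodup_cycleList σ i) (mem_cycleList.2 hik) m
  refine ⟨p, q, ∏ j ∈ T.erase i, M.φ ((cycleList σ j).map m).prod, fun z => ?_⟩
  rw [M.permForm_eq_prod hT, ← Finset.mul_prod_erase _ _ hi, hpq]
  congr 1
  refine Finset.prod_congr rfl fun j hj => congrArg (fun l => M.φ (List.prod l)) ?_
  refine List.map_congr_left fun l hl => Function.update_of_ne ?_ _ _
  rintro rfl
  exact (Finset.mem_erase.1 hj).1 (hunique j ⟨(Finset.mem_erase.1 hj).2, mem_cycleList.1 hl⟩)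

/-- The form `φ_σ` as a multilinear map. -/
def permFormMultilinear (σ : Equiv.Perm (Fin n)) :
    MultilinearMap ℂ (fun _ : Fin n => (M : Type u)) ℂ where
  toFun := M.permForm σ
  map_update_add' := by
    intro inst m k x y
    obtain rfl := Subsingleton.elim inst (instDecidableEqFin n)
    obtain ⟨p, q, C, h⟩ := M.exists_permForm_update_eq σ m k
    simp only [h, mul_add, add_mul, map_add]
  map_update_smul' := by
    intro inst m k c x
    obtain rfl := Subsingleton.elim inst (instDecidableEqFin n)
    obtain ⟨p, q, C, h⟩ := M.exists_permForm_update_eq σ m k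
    simp only [h, mul_smul_comm, smul_mul_assoc, map_smul]

/-- The form `∑ σ, c(σ) φ_σ`, whose vanishing on mixed arguments defines the cumulants. -/
def cumulantForm (c : Equiv.Perm (Fin n) → ℂ) :
    MultilinearMap ℂ (fun _ : Fin n => (M : Type u)) ℂ :=
  ∑ σ, c σ • M.permFormMultilinear σ

lemma cumulantForm_apply (c : Equiv.Perm (Fin n) → ℂ) (m : Fin n → M) :
    M.cumulantForm c m = ∑ σ, c σ * M.permForm σ m := by
  simp [cumulantForm, permFormMultilinear]

lemma cumulantForm_comp_perm {c : Equiv.Perm (Fin n) → ℂ} (hc : IsConjInvariant c)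
    (ρ : Equiv.Perm (Fin n)) (m : Fin n → M) :
    M.cumulantForm c (m ∘ ρ) = M.cumulantForm c m := by
  rw [M.cumulantForm_apply, M.cumulantForm_apply,
    ← Equiv.sum_comp (MulAut.conj ρ).toEquiv fun σ => c σ * M.permForm σ m]
  refine Finset.sum_congr rfl fun σ _ => ?_
  change _ = c (ρ * σ * ρ⁻¹) * M.permForm (ρ * σ * ρ⁻¹) m
  rw [hc, M.permForm_conj]

end NCProbSpace

section Polarization

lemma sum_neg_one_pow_card_smul_eq_zero {ι G : Type*} [Fintype ι] [DecidableEq ι] [AddCommGroup G]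
    {f : Finset ι → G} {k : ι} (hf : ∀ S, k ∉ S → f (insert k S) = f S) :
    ∑ S : Finset ι, (-1 : ℤ) ^ S.card • f S = 0 := by
  rw [← Finset.powerset_univ, ← Finset.insert_erase (Finset.mem_univ k),
    Finset.sum_powerset_insert (Finset.notMem_erase _ _), ← Finset.sum_add_distrib]
  refine Finset.sum_eq_zero fun S hS => ?_
  have hk : k ∉ S := fun hk => Finset.notMem_erase _ _ (Finset.mem_powerset.1 hS hk)
  rw [hf S hk, Finset.card_insert_of_notMem hk, pow_succ, mul_neg_one, neg_smul, add_neg_cancel]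

variable {ι R E G : Type*} [CommSemiring R] [AddCommMonoid E] [Module R E]
  [AddCommGroup G] [Module R G]

lemma sum_neg_one_pow_card_smul_map_const_sum [Fintype ι] [DecidableEq ι]
    (K : MultilinearMap R (fun _ : ι => E) G) (m : ι → E) :
    ∑ S : Finset ι, (-1 : ℤ) ^ S.card • K (fun _ => ∑ i ∈ S, m i) =
      (-1 : ℤ) ^ Fintype.card ι • ∑ ρ : Equiv.Perm ι, K (m ∘ ρ) := by
  have hexpand : ∀ S : Finset ι, K (fun _ => ∑ i ∈ S, m i) =
      ∑ f : ι → ι, if ∀ i, f i ∈ S then K (m ∘ f) else 0 := fun S => by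
    rw [K.map_sum_finset (fun _ i => m i) (fun _ => S), ← Finset.sum_filter]
    exact Finset.sum_congr (by ext f; simp) fun _ _ => rfl
  simp_rw [hexpand, Finset.smul_sum]
  rw [Finset.sum_comm]
  refine (Fintype.sum_of_injective (fun ρ : Equiv.Perm ι => ⇑ρ) DFunLike.coe_injective _ _
    (fun f hf => ?_) fun ρ => ?_).symm
  · have hf : ¬ Function.Surjective f := fun hsurj =>
      hf ⟨Equiv.ofBijective f ⟨Finite.injective_iff_surjective.2 hsurj, hsurj⟩, rfl⟩
    obtain ⟨k, hk⟩ := not_forall.1 hf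
    refine sum_neg_one_pow_card_smul_eq_zero (k := k) fun S _ => ?_
    simp only [Finset.mem_insert, fun i => not_exists.1 hk i, false_or]
  · rw [Finset.sum_eq_single Finset.univ, Finset.card_univ]
    · simp only [Finset.mem_univ, implies_true, if_true]
    · intro S _ hS
      rw [if_neg, smul_zero]
      exact fun hρ => hS (Finset.eq_univ_of_forall fun i => by simpa using hρ (ρ.symm i))
    · simp

lemma eq_zero_of_map_const_add [Finite ι] [IsAddTorsionFree G]
    {K : MultilinearMap R (fun _ : ι => E) G}
    (hK : ∀ (ρ : Equiv.Perm ι) (m : ι → E), K (m ∘ ρ) = K m) {A B : AddSubmonoid E}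
    (hAB : ∀ a ∈ A, ∀ b ∈ B, K (fun _ => a + b) = K (fun _ => a) + K (fun _ => b))
    {m : ι → E} (hm : ∀ i, m i ∈ A ∨ m i ∈ B) (hA : ¬ ∀ i, m i ∈ A) (hB : ¬ ∀ i, m i ∈ B) :
    K m = 0 := by
  classical
  cases nonempty_fintype ι
  obtain ⟨q, hq⟩ := not_forall.1 hA
  obtain ⟨p, hp⟩ := not_forall.1 hB
  have hpA : m p ∈ A := (hm p).resolve_right hp
  have hsplit : ∀ S : Finset ι, K (fun _ => ∑ i ∈ S, m i) =
      K (fun _ => ∑ i ∈ S with m i ∈ A, m i) + K (fun _ => ∑ i ∈ S with m i ∉ A, m i) := by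
    intro S
    rw [← hAB _ (A.sum_mem fun i hi => (Finset.mem_filter.1 hi).2) _
      (B.sum_mem fun i hi => (hm i).resolve_left (Finset.mem_filter.1 hi).2),
      Finset.sum_filter_add_sum_filter_not]
  have hpolar := sum_neg_one_pow_card_smul_map_const_sum K m
  rw [Finset.sum_congr rfl fun S _ => by rw [hsplit S, smul_add], Finset.sum_add_distrib,
    Finset.sum_congr rfl fun ρ _ => hK ρ m, Finset.sum_const, Finset.card_univ,
    Fintype.card_perm] at hpolar
  -- The part of the sum in `A` does not see `m q`, and the part in `B` does not see `m p`.
  rw [sum_neg_one_pow_card_smul_eq_zero (k := q) fun S _ => by rw [Finset.filter_insert, if_neg hq],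
    sum_neg_one_pow_card_smul_eq_zero (k := p) fun S _ => by
      rw [Finset.filter_insert, if_neg (not_not.2 hpA)], add_zero] at hpolar
  rcases neg_one_pow_eq_or ℤ (Fintype.card ι) with h | h <;>
    simpa [h, Nat.factorial_ne_zero] using hpolar.symm

end Polarization

section CycleShape

variable {n : ℕ}

lemma coe_cycleShape (σ : Equiv.Perm (Fin n)) :
    (cycleShape σ : Multiset ℕ) = σ.partition.parts :=
  Multiset.sort_eq _ _

lemma cycleShape_eq_iff {σ : Equiv.Perm (Fin n)} {l : List ℕ} (hl : l.Pairwise (· ≥ ·)) :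
    cycleShape σ = l ↔ σ.partition.parts = l := by
  rw [← coe_cycleShape, Multiset.coe_eq_coe]
  exact ⟨fun h => h ▸ .refl _, fun h => h.eq_of_pairwise (fun _ _ _ _ h₁ h₂ => le_antisymm h₂ h₁)
    (Multiset.pairwise_sort _ _) hl⟩

lemma cycleShape_eq_of_cycleType {σ : Equiv.Perm (Fin n)} {l : List ℕ}
    (hl : l.Pairwise (· ≥ ·))
    (hσ : σ.cycleType + Multiset.replicate (n - σ.cycleType.sum) 1 = (l : Multiset ℕ)) :
    cycleShape σ = l := by
  rw [cycleShape_eq_iff hl, ← hσ, Equiv.Perm.parts_partition, Equiv.Perm.sum_cycleType,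
    Fintype.card_fin]

/-- The multisets of integers in `[2, n]` with sum at most `n`: these are the cycle types of the
permutations of `Fin n`. They are obtained by filtering submultisets of a large enough multiset,
so that they can be enumerated by the kernel. -/
def cycleTypes (n : ℕ) : Finset (Multiset ℕ) :=
  ((∑ k ∈ Finset.Icc 2 n, Multiset.replicate (n / k) k).powerset.filter (·.sum ≤ n)).toFinset

/-- The number of permutations of `Fin n` with cycle type `m`. -/
def cycleTypeCount (n : ℕ) (m : Multiset ℕ) : ℕ :=
  n.factorial / ((n - m.sum).factorial * m.prod * ∏ k ∈ m.toFinset, (m.count k).factorial)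

lemma cycleType_mem_cycleTypes (σ : Equiv.Perm (Fin n)) : σ.cycleType ∈ cycleTypes n := by
  have hsum : σ.cycleType.sum ≤ n := by
    simpa [Equiv.Perm.sum_cycleType] using Finset.card_le_univ σ.support
  rw [cycleTypes, Multiset.mem_toFinset, Multiset.mem_filter, Multiset.mem_powerset]
  refine ⟨Multiset.le_iff_count.2 fun k => ?_, hsum⟩
  by_cases hk : k ∈ σ.cycleType
  · have hk₂ := Equiv.Perm.two_le_of_mem_cycleType hk
    have hkn := (Multiset.le_sum_of_mem hk).trans hsum
    have hmul : σ.cycleType.count k * k ≤ n := by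
      obtain ⟨s, hs⟩ := Multiset.le_iff_exists_add.1
        (Multiset.le_count_iff_replicate_le.1 (le_refl (σ.cycleType.count k)))
      have hs_sum := congrArg Multiset.sum hs
      rw [Multiset.sum_add, Multiset.sum_replicate, smul_eq_mul] at hs_sum
      lia
    rw [Multiset.count_sum', Finset.sum_eq_single_of_mem k (Finset.mem_Icc.2 ⟨hk₂, hkn⟩)
      fun j _ hj => Multiset.count_eq_zero.2 fun h => hj (Multiset.eq_of_mem_replicate h).symm,
      Multiset.count_replicate_self]
    exact (Nat.le_div_iff_mul_le (by lia)).2 hmul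
  · simp [Multiset.count_eq_zero.2 hk]

lemma card_filter_cycleType_eq {m : Multiset ℕ} (hm : m ∈ cycleTypes n) :
    (Finset.univ.filter fun σ : Equiv.Perm (Fin n) => σ.cycleType = m).card =
      cycleTypeCount n m := by
  rw [cycleTypes, Multiset.mem_toFinset, Multiset.mem_filter, Multiset.mem_powerset] at hm
  have hparts : ∀ k ∈ m, 2 ≤ k := by
    intro k hk
    obtain ⟨j, hj, hkj⟩ := Multiset.mem_sum.1 (Multiset.mem_of_le hm.1 hk)
    exact Multiset.eq_of_mem_replicate hkj ▸ (Finset.mem_Icc.1 hj).1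
  rw [Equiv.Perm.card_of_cycleType, Fintype.card_fin, if_pos ⟨hm.2, hparts⟩, cycleTypeCount]

/-- The last hypothesis can be checked by the kernel for a given `n`. -/
lemma sum_comp_cycleShape_eq {R : Type*} [CommSemiring R] {L : List (ℕ × List ℕ)}
    (hsorted : ∀ p ∈ L, p.2.Pairwise (· ≥ ·))
    (hL : (cycleTypes n).val.map
        (fun m => (cycleTypeCount n m, m + Multiset.replicate (n - m.sum) 1)) =
      L.map fun p => (p.1, (p.2 : Multiset ℕ))) (F : List ℕ → R) :
    ∑ σ : Equiv.Perm (Fin n), F (cycleShape σ) = (L.map fun p => p.1 * F p.2).sum := by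
  have hterm : ∀ m ∈ cycleTypes n,
      ∑ σ : Equiv.Perm (Fin n) with σ.cycleType = m, F (cycleShape σ) =
        cycleTypeCount n m * F ((m + Multiset.replicate (n - m.sum) 1).sort (· ≥ ·)) := by
    intro m hm
    rw [← card_filter_cycleType_eq hm, ← nsmul_eq_mul, ← Finset.sum_const]
    refine Finset.sum_congr rfl fun σ hσ => congrArg F ?_
    rw [← (Finset.mem_filter.1 hσ).2]
    exact cycleShape_eq_of_cycleType (Multiset.pairwise_sort _ _) (Multiset.sort_eq _ _).symm
  rw [← Finset.sum_fiberwise_of_maps_to (fun σ _ => cycleType_mem_cycleTypes σ),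
    Finset.sum_congr rfl hterm]
  have hsum := congrArg (fun s : Multiset (ℕ × Multiset ℕ) =>
    (s.map fun p => (p.1 : R) * F (p.2.sort (· ≥ ·))).sum) hL
  simp only [Multiset.map_map, Multiset.map_coe, List.map_map, Multiset.sum_coe] at hsum
  refine hsum.trans (congrArg List.sum (List.map_congr_left fun p hp => ?_))
  simp only [Function.comp_apply, Multiset.coe_sort, List.mergeSort_eq_self _ (hsorted p hp)]

variable {R : Type*} [CommSemiring R] (F : List ℕ → R)

lemma sum_comp_cycleShape_two :
    ∑ σ : Equiv.Perm (Fin 2), F (cycleShape σ) = F [2] + F [1, 1] := by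
  rw [sum_comp_cycleShape_eq (L := [(1, [2]), (1, [1, 1])]) (by decide) (by decide +kernel)]
  simp

lemma sum_comp_cycleShape_three :
    ∑ σ : Equiv.Perm (Fin 3), F (cycleShape σ) = 2 * F [3] + 3 * F [2, 1] + F [1, 1, 1] := by
  rw [sum_comp_cycleShape_eq (L := [(2, [3]), (3, [2, 1]), (1, [1, 1, 1])]) (by decide)
    (by decide +kernel)]
  simp [add_assoc]

lemma sum_comp_cycleShape_four :
    ∑ σ : Equiv.Perm (Fin 4), F (cycleShape σ) =
      6 * F [4] + 8 * F [3, 1] + 3 * F [2, 2] + 6 * F [2, 1, 1] + F [1, 1, 1, 1] := by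
  rw [sum_comp_cycleShape_eq (L := [(6, [4]), (8, [3, 1]), (3, [2, 2]), (6, [2, 1, 1]),
    (1, [1, 1, 1, 1])]) (by decide) (by decide +kernel)]
  simp [add_assoc]

lemma sum_comp_cycleShape_five :
    ∑ σ : Equiv.Perm (Fin 5), F (cycleShape σ) =
      24 * F [5] + 30 * F [4, 1] + 20 * F [3, 2] + 20 * F [3, 1, 1] + 15 * F [2, 2, 1] +
        10 * F [2, 1, 1, 1] + F [1, 1, 1, 1, 1] := by
  rw [sum_comp_cycleShape_eq (L := [(24, [5]), (30, [4, 1]), (20, [3, 2]), (20, [3, 1, 1]),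
    (15, [2, 2, 1]), (10, [2, 1, 1, 1]), (1, [1, 1, 1, 1, 1])]) (by decide) (by decide +kernel)]
  simp [add_assoc]

lemma sum_comp_cycleShape_six :
    ∑ σ : Equiv.Perm (Fin 6), F (cycleShape σ) =
      120 * F [6] + 144 * F [5, 1] + 90 * F [4, 2] + 90 * F [4, 1, 1] + 40 * F [3, 3] +
        120 * F [3, 2, 1] + 40 * F [3, 1, 1, 1] + 15 * F [2, 2, 2] + 45 * F [2, 2, 1, 1] +
        15 * F [2, 1, 1, 1, 1] + F [1, 1, 1, 1, 1, 1] := by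
  rw [sum_comp_cycleShape_eq (L := [(120, [6]), (144, [5, 1]), (90, [4, 2]), (90, [4, 1, 1]),
    (40, [3, 3]), (120, [3, 2, 1]), (40, [3, 1, 1, 1]), (15, [2, 2, 2]), (45, [2, 2, 1, 1]),
    (15, [2, 1, 1, 1, 1]), (1, [1, 1, 1, 1, 1, 1])]) (by decide) (by decide +kernel)]
  simp [add_assoc]

lemma isConjInvariant_comp_cycleShape (F : List ℕ → ℂ) :
    IsConjInvariant fun σ : Equiv.Perm (Fin n) => F (cycleShape σ) := fun σ ρ => by
  have hconj : IsConj σ (ρ * σ * ρ⁻¹) := isConj_iff.2 ⟨ρ, rfl⟩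
  simp only [cycleShape, Equiv.Perm.partition_eq_of_isConj.1 hconj]

lemma exists_eq_comp_cycleShape {c : Equiv.Perm (Fin n) → ℂ} (hc : IsConjInvariant c) :
    ∃ F : List ℕ → ℂ, c = F ∘ cycleShape := by
  refine (Function.factorsThrough_iff c).1 fun σ τ h => ?_
  have hparts : σ.partition.parts = τ.partition.parts := by
    rw [← coe_cycleShape, h, coe_cycleShape]
  obtain ⟨ρ, rfl⟩ := isConj_iff.1 (Equiv.Perm.partition_eq_of_isConj.2 (Nat.Partition.ext hparts))
  exact (hc σ ρ).symm

end CycleShape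

lemma sub_smul_one_mem {R P : Type*} [CommRing R] [StarRing R] [Ring P] [StarRing P]
    [Algebra R P] [StarModule R P] {A : StarSubalgebra R P} {a : P} (ha : a ∈ A) (c : R) :
    a - c • (1 : P) ∈ A :=
  sub_mem ha (A.smul_mem (one_mem A) c)

namespace NCProbSpace

section Freeness

variable {X : NCProbSpace.{u}}

lemma φ_smul_one (c : ℂ) : X.φ (c • (1 : X)) = c := by
  rw [map_smul, X.φ_one, smul_eq_mul, mul_one]

lemma φ_sub_smul_one (x : X) : X.φ (x - X.φ x • (1 : X)) = 0 := by
  rw [map_sub, φ_smul_one, sub_self]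

lemma Free.φ_prod_eq_zero {ι : Type*} {A : ι → StarSubalgebra ℂ X} (hF : X.Free A)
    {l : List (ι × X)} (hl : l ≠ []) (hchain : l.IsChain fun p q => p.1 ≠ q.1)
    (hmem : ∀ p ∈ l, p.2 ∈ A p.1) (hφ : ∀ p ∈ l, X.φ p.2 = 0) :
    X.φ (l.map Prod.snd).prod = 0 := by
  have hofFn : l.map Prod.snd = List.ofFn fun k : Fin l.length => l[k].2 := by
    refine List.ext_getElem (by simp) fun k _ _ => by simp
  rw [hofFn]
  refine hF l.length (List.length_pos_iff.2 hl) (fun k => l[k].1) (fun k k' hk => ?_) _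
    (fun k => hmem _ (l.get_mem k)) fun k => hφ _ (l.get_mem k)
  simpa [hk] using List.isChain_iff_getElem.1 hchain k (hk ▸ k'.2)

variable {D U : StarSubalgebra ℂ X}

lemma Free.φ_mul_mul_prod_pairs (hF : X.Free ![D, U]) {d w : X} (hd : d ∈ D) (hw : w ∈ U)
    (hφw : X.φ w = 0) {l : List (X × X)} (hl : ∀ p ∈ l, p.1 ∈ D ∧ p.2 ∈ U)
    (hφl : ∀ p ∈ l, X.φ p.1 = 0 ∧ X.φ p.2 = 0) :
    X.φ (d * w * (l.map fun p => p.1 * p.2).prod) = 0 := by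
  let alternating : List (Fin 2 × X) := (1, w) :: l.flatMap fun p => [(0, p.1), (1, p.2)]
  have hprod : (alternating.map Prod.snd).prod = w * (l.map fun p => p.1 * p.2).prod := by
    simp only [alternating, List.map_cons, List.prod_cons]
    congr 1
    clear hl hφl
    induction l with
    | nil => rfl
    | cons p l ih => simp [ih, mul_assoc]
  have hchain : alternating.IsChain fun p q => p.1 ≠ q.1 := by
    simp only [alternating]
    clear hl hφl hprod alternating hw hφw
    induction l generalizing w with
    | nil => simp
    | cons p l ih => simpa using ih (w := p.2)
  have hmem : ∀ q ∈ alternating, q.2 ∈ ![D, U] q.1 := by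
    simp only [alternating, List.mem_cons, List.mem_flatMap, List.not_mem_nil, or_false]
    rintro q (rfl | ⟨p, hp, rfl | rfl⟩)
    exacts [hw, (hl p hp).1, (hl p hp).2]
  have hφ : ∀ q ∈ alternating, X.φ q.2 = 0 := by
    simp only [alternating, List.mem_cons, List.mem_flatMap, List.not_mem_nil, or_false]
    rintro q (rfl | ⟨p, hp, rfl | rfl⟩)
    exacts [hφw, (hφl p hp).1, (hφl p hp).2]
  have htail := hF.φ_prod_eq_zero (List.cons_ne_nil _ _) hchain hmem hφ
  have hcentered := hF.φ_prod_eq_zero (l := (0, d - X.φ d • (1 : X)) :: alternating)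
    (List.cons_ne_nil _ _) (hchain.cons_cons zero_ne_one)
    (List.forall_mem_cons.2 ⟨sub_smul_one_mem hd _, hmem⟩)
    (List.forall_mem_cons.2 ⟨φ_sub_smul_one d, hφ⟩)
  rwa [List.map_cons, List.prod_cons, hprod, sub_mul, map_sub, smul_one_mul, map_smul, ← hprod,
    htail, smul_zero, sub_zero, hprod, ← mul_assoc] at hcentered

variable {κ : Type*} {x : κ → X} {l : List κ} {L : List (List κ × X)}

/-- The product `(x_{g₁}) w₁ (x_{g₂}) w₂ ⋯`, where `x_g` is the product of the letters of the
group `g`. -/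
def groupedProd (x : κ → X) (L : List (List κ × X)) : X :=
  (L.map fun p => (p.1.map x).prod * p.2).prod

lemma groupedProd_append (L₁ L₂ : List (List κ × X)) :
    groupedProd x (L₁ ++ L₂) = groupedProd x L₁ * groupedProd x L₂ := by
  simp [groupedProd]

lemma groupedProd_cons (g : List κ) (w : X) (L : List (List κ × X)) :
    groupedProd x ((g, w) :: L) = (g.map x).prod * w * groupedProd x L := by
  simp [groupedProd]

lemma groupedProd_append_cons (g : List κ) (w : X) (L : List (List κ × X)) (g' : List κ) :
    groupedProd x ((g' ++ g, w) :: L) = (g'.map x).prod * groupedProd x ((g, w) :: L) := by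
  simp [groupedProd, mul_assoc]

/-- The first components of `L` cut the cyclic word `l` into non-empty groups of consecutive
letters. -/
structure IsCyclicGrouping (l : List κ) (L : List (List κ × X)) : Prop where
  isRotated : (L.map Prod.fst).flatten ~r l
  ne_nil : ∀ p ∈ L, p.1 ≠ []

namespace IsCyclicGrouping

lemma rotate {L₁ L₂ : List (List κ × X)} (h : IsCyclicGrouping l (L₁ ++ L₂)) :
    IsCyclicGrouping l (L₂ ++ L₁) := by
  refine ⟨.trans ?_ h.isRotated, fun p hp => h.ne_nil p (by simpa [or_comm] using hp)⟩
  simpa only [List.map_append, List.flatten_append] using List.isRotated_append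

lemma merge {L₁ L₂ : List (List κ × X)} {g g' : List κ} {w w' : X}
    (h : IsCyclicGrouping l (L₁ ++ (g, w) :: (g', w') :: L₂)) :
    IsCyclicGrouping l (L₁ ++ (g ++ g', w') :: L₂) := by
  refine ⟨by simpa using h.isRotated, fun p hp => ?_⟩
  simp only [List.mem_append, List.mem_cons] at hp
  rcases hp with hp | rfl | hp
  · exact h.ne_nil p (by simp [hp])
  · simpa using fun hg => absurd hg (h.ne_nil (g, w) (by simp))
  · exact h.ne_nil p (by simp [hp])

lemma replace {L₁ L₂ : List (List κ × X)} {g : List κ} {w : X}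
    (h : IsCyclicGrouping l (L₁ ++ (g, w) :: L₂)) (w' : X) :
    IsCyclicGrouping l (L₁ ++ (g, w') :: L₂) := by
  refine ⟨by simpa using h.isRotated, fun p hp => ?_⟩
  simp only [List.mem_append, List.mem_cons] at hp
  rcases hp with hp | rfl | hp
  · exact h.ne_nil p (by simp [hp])
  · exact h.ne_nil (g, w) (by simp)
  · exact h.ne_nil p (by simp [hp])

lemma mem_of_mem (h : IsCyclicGrouping l L) {p : List κ × X} (hp : p ∈ L) {c : κ} (hc : c ∈ p.1) :
    c ∈ l :=
  h.isRotated.mem_iff.1 (List.mem_flatten.2 ⟨p.1, List.mem_map_of_mem hp, hc⟩)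

end IsCyclicGrouping

/-- Every product of consecutive letters of the cyclic word `l` which covers at most half of it is
centered. -/
def ShortSubwordsCentered (x : κ → X) (l : List κ) : Prop :=
  ∀ s s' : List κ, s ++ s' ~r l → s ≠ [] → s.length ≤ s'.length → X.φ (s.map x).prod = 0

lemma Free.φ_groupedProd_eq_zero_of_centered (hF : X.Free ![D, U]) (hx : ∀ c ∈ l, x c ∈ D)
    (hshort : ShortSubwordsCentered x l) (hL : IsCyclicGrouping l L) (hL₀ : L ≠ [])
    (hU : ∀ p ∈ L, p.2 ∈ U) (hφ : ∀ p ∈ L, X.φ p.2 = 0) : X.φ (groupedProd x L) = 0 := by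
  -- Only the longest group can cover more than half of the word.
  obtain ⟨p, hp⟩ : ∃ p, p ∈ L.argmax fun p => p.1.length :=
    Option.ne_none_iff_exists'.1 (by simpa [List.argmax_eq_none] using hL₀)
  obtain ⟨L₁, L₂, rfl⟩ := List.append_of_mem (List.argmax_mem hp)
  have hL' : IsCyclicGrouping l (p :: (L₂ ++ L₁)) := hL.rotate
  have hperm : ∀ q ∈ p :: (L₂ ++ L₁), q ∈ L₁ ++ p :: L₂ := fun q hq =>
    (List.perm_append_comm (l₁ := p :: L₂)).mem_iff.1 (by simpa using hq)
  have hD : ∀ q ∈ p :: (L₂ ++ L₁), (q.1.map x).prod ∈ D := fun q hq =>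
    list_prod_mem fun y hy => by
      obtain ⟨c, hc, rfl⟩ := List.mem_map.1 hy
      exact hx c (hL'.mem_of_mem hq hc)
  have hcentered : ∀ q ∈ L₂ ++ L₁, X.φ (q.1.map x).prod = 0 := by
    intro q hq
    obtain ⟨L₃, L₄, hsplit⟩ := List.append_of_mem hq
    have hrot : IsCyclicGrouping l (q :: (L₄ ++ p :: L₃)) := by
      refine IsCyclicGrouping.rotate (L₁ := p :: L₃) (L₂ := q :: L₄) ?_
      rwa [List.cons_append, ← hsplit]
    refine hshort q.1 (L₄ ++ p :: L₃ |>.map Prod.fst).flatten (by simpa using hrot.isRotated)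
      (hrot.ne_nil q (by simp)) ?_
    have hle := List.le_of_mem_argmax (hperm q (List.mem_cons_of_mem _ hq)) hp
    simp only [List.map_append, List.map_cons, List.flatten_append, List.flatten_cons,
      List.length_append]
    lia
  rw [groupedProd_append, X.φ_mul_comm, ← groupedProd_append, List.cons_append, groupedProd_cons]
  have hfree := hF.φ_mul_mul_prod_pairs (l := (L₂ ++ L₁).map fun q => ((q.1.map x).prod, q.2))
    (hD p (by simp)) (hU p (by simp)) (hφ p (by simp))
  simp only [List.forall_mem_map, List.map_map] at hfree
  exact hfree (fun q hq => ⟨hD q (by simp [hq]), hU q (hperm q (by simp [hq]))⟩)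
    fun q hq => ⟨hcentered q hq, hφ q (hperm q (by simp [hq]))⟩

lemma Free.φ_groupedProd_append_eq_zero (hF : X.Free ![D, U]) (hx : ∀ c ∈ l, x c ∈ D)
    (hshort : ShortSubwordsCentered x l) {L₁ L₂ : List (List κ × X)}
    (hL : IsCyclicGrouping l (L₁ ++ L₂)) (hL₂ : L₂ ≠ []) (hU : ∀ p ∈ L₁ ++ L₂, p.2 ∈ U)
    (hφ : ∀ p ∈ L₂, X.φ p.2 = 0) : X.φ (groupedProd x (L₁ ++ L₂)) = 0 := by
  induction L₁ using List.reverseRecOn generalizing L₂ with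
  | nil => exact hF.φ_groupedProd_eq_zero_of_centered hx hshort hL hL₂ hU hφ
  | append_singleton L₁ p ih =>
    obtain ⟨g, w⟩ := p
    obtain ⟨⟨g', w'⟩, L₂, rfl⟩ := List.exists_cons_of_ne_nil hL₂
    simp only [List.append_assoc, List.cons_append, List.nil_append, List.forall_mem_append,
      List.forall_mem_cons] at hL hU hφ ⊢
    have hcentered := ih (L₂ := (g, w - X.φ w • (1 : X)) :: (g', w') :: L₂) (hL.replace _)
      (by simp) (List.forall_mem_append.2 ⟨hU.1, List.forall_mem_cons.2
        ⟨sub_smul_one_mem hU.2.1 _, List.forall_mem_cons.2 hU.2.2⟩⟩)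
      (List.forall_mem_cons.2 ⟨φ_sub_smul_one w, List.forall_mem_cons.2 hφ⟩)
    have hmerged := ih (L₂ := (g ++ g', w') :: L₂) hL.merge (by simp)
      (List.forall_mem_append.2 ⟨hU.1, List.forall_mem_cons.2 hU.2.2⟩)
      (List.forall_mem_cons.2 hφ)
    rw [groupedProd_append, groupedProd_append_cons] at hmerged
    rw [groupedProd_append, groupedProd_cons] at hcentered ⊢
    simpa only [mul_sub, sub_mul, map_sub, mul_smul_comm, smul_mul_assoc, map_smul, mul_one,
      hmerged, smul_zero, sub_zero] using hcentered

lemma Free.φ_groupedProd_cons (hF : X.Free ![D, U]) (hx : ∀ c ∈ l, x c ∈ D)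
    (hshort : ShortSubwordsCentered x l) {g : List κ} {w : X}
    (hL : IsCyclicGrouping l ((g, w) :: L)) (hU : ∀ p ∈ (g, w) :: L, p.2 ∈ U) :
    X.φ (groupedProd x ((g, w) :: L)) = X.φ w * X.φ ((g.map x).prod * groupedProd x L) := by
  have hL' : IsCyclicGrouping l ((g, w - X.φ w • (1 : X)) :: L) := hL.replace (L₁ := []) _
  rw [List.forall_mem_cons] at hU
  have hcentered := hF.φ_groupedProd_append_eq_zero hx hshort (hL'.rotate (L₁ := [_]))
    (by simp)
    (List.forall_mem_append.2 ⟨hU.2, List.forall_mem_singleton.2 (sub_smul_one_mem hU.1 _)⟩)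
    (List.forall_mem_singleton.2 (φ_sub_smul_one w))
  rw [groupedProd_append, X.φ_mul_comm, ← groupedProd_append, List.singleton_append,
    groupedProd_cons, mul_sub, sub_mul, map_sub, sub_eq_zero] at hcentered
  rw [groupedProd_cons, hcentered, mul_smul_comm, smul_mul_assoc, map_smul, mul_one, smul_eq_mul]

lemma Free.φ_groupedProd (hF : X.Free ![D, U]) (hx : ∀ c ∈ l, x c ∈ D)
    (hshort : ShortSubwordsCentered x l) (hL : IsCyclicGrouping l L) (hL₀ : L ≠ [])
    (hU : ∀ p ∈ L, p.2 ∈ U) :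
    X.φ (groupedProd x L) = (L.map fun p => X.φ p.2).prod * X.φ (l.map x).prod := by
  obtain ⟨⟨g, w⟩, L, rfl⟩ := List.exists_cons_of_ne_nil hL₀
  rw [hF.φ_groupedProd_cons hx hshort hL hU, List.map_cons, List.prod_cons, mul_assoc]
  congr 1
  induction L generalizing g w with
  | nil =>
    have hrot : (g.map x) ~r (l.map x) := by simpa using hL.isRotated.map x
    simpa [groupedProd] using X.φ_prod_eq_of_isRotated hrot
  | cons p L ih =>
    have hmerged : IsCyclicGrouping l ((g ++ p.1, p.2) :: L) := hL.merge (L₁ := [])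
    rw [List.forall_mem_cons, List.forall_mem_cons] at hU
    have hU' : ∀ q ∈ (g ++ p.1, p.2) :: L, q.2 ∈ U := List.forall_mem_cons.2 hU.2
    rw [← groupedProd_append_cons, hF.φ_groupedProd_cons hx hshort hmerged hU',
      ih (g ++ p.1) p.2 hmerged (List.cons_ne_nil _ _) hU', List.map_cons, List.prod_cons,
      mul_assoc]

end Freeness

end NCProbSpace

section TFree

lemma fubmMoment_one_mul_self (t : ℝ≥0∞) : fubmMoment t 1 * fubmMoment t 1 = expNeg t := by
  unfold fubmMoment expNeg
  by_cases h : t = ⊤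
  · simp [h]
  · rw [if_neg one_ne_zero, if_neg h, if_neg h, Finset.sum_range_one, mul_mul_mul_comm,
      ← Real.exp_add]
    norm_num
    ring_nf

namespace NCProbSpace

variable {M : NCProbSpace.{u}} {t : ℝ≥0∞} {A B : StarSubalgebra ℂ M}

namespace IsTFreeRealization

variable {X : NCProbSpace.{u}} {i : A →⋆ₐ[ℂ] X} {j : B →⋆ₐ[ℂ] X} {v : X}

lemma φ_mul (h : M.IsTFreeRealization t A B X i j v) (a : A) (b : B) :
    X.φ (i a * j b) = M.φ (a : M) * M.φ (b : M) := by
  have hcentered := h.indep.2 2 (by norm_num) ![0, 1] (by decide)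
    ![i (a - M.φ (a : M) • (1 : A)), j (b - M.φ (b : M) • (1 : B))]
    (Fin.forall_fin_two.2 ⟨⟨_, rfl⟩, ⟨_, rfl⟩⟩)
    (Fin.forall_fin_two.2 ⟨by simp [h.φ_left, X.φ_one], by simp [h.φ_right, X.φ_one]⟩)
  simp only [List.ofFn_succ, List.ofFn_zero, Matrix.cons_val_zero, List.prod_cons, List.prod_nil,
    Matrix.cons_val_succ, mul_one, map_sub, map_smul, map_one, sub_mul, mul_sub, smul_mul_assoc,
    mul_smul_comm, one_mul, h.φ_left, h.φ_right, X.φ_one, smul_eq_mul] at hcentered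
  linear_combination hcentered

lemma commute (h : M.IsTFreeRealization t A B X i j v) (a : A) (b : B) : Commute (i a) (j b) :=
  h.indep.1 0 1 (by decide) _ ⟨a, rfl⟩ _ ⟨b, rfl⟩

lemma prod_map_mul (h : M.IsTFreeRealization t A B X i j v) (ab : List (A × B)) :
    (ab.map fun p => i p.1 * j p.2).prod =
      i (ab.map Prod.fst).prod * j (ab.map Prod.snd).prod := by
  induction ab with
  | nil => simp
  | cons p ab ih =>
    simp only [List.map_cons, List.prod_cons, map_mul, ih]
    exact ((h.commute _ _).symm).mul_mul_mul_comm _ _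

lemma φ_unitary (h : M.IsTFreeRealization t A B X i j v) : X.φ v = (fubmMoment t 1 : ℂ) := by
  simpa using h.bm.2 1

lemma φ_star_unitary (h : M.IsTFreeRealization t A B X i j v) :
    X.φ (star v) = (fubmMoment t 1 : ℂ) := by
  rw [X.φ_star, h.φ_unitary]
  exact Complex.conj_ofReal _

/-- The letters `a₁, b₁, a₂, b₂, …` of the word `a₁ (v b₁ v*) a₂ (v b₂ v*) ⋯`. -/
def alternatingWord {α β : Type*} (ab : List (α × β)) : List (α ⊕ β) :=
  ab.flatMap fun p => [.inl p.1, .inr p.2]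

lemma length_alternatingWord {α β : Type*} (ab : List (α × β)) :
    (alternatingWord ab).length = 2 * ab.length := by
  simp [alternatingWord, mul_comm]

lemma chain_alternatingWord {α β : Type*} (ab : List (α × β)) :
    (alternatingWord ab : Cycle (α ⊕ β)).Chain fun x y => x.isLeft ≠ y.isLeft := by
  cases ab with
  | nil => simp [alternatingWord]
  | cons p ab =>
    simp only [alternatingWord, List.flatMap_cons, List.cons_append, List.nil_append,
      Cycle.chain_coe_cons]
    generalize p.1 = a
    induction ab generalizing p with
    | nil => simp
    | cons q ab ih => simpa using ih q

lemma isChain_of_append_isRotated {α : Type*} {r : α → α → Prop} {l s s' : List α}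
    (hl : (l : Cycle α).Chain r) (hs : s ++ s' ~r l) : s.IsChain r := by
  rw [← Cycle.coe_eq_coe.2 hs] at hl
  cases s with
  | nil => exact .nil
  | cons a s =>
    rw [List.cons_append, Cycle.chain_coe_cons, List.append_assoc, ← List.cons_append] at hl
    exact hl.left_of_append

lemma φ_prod_eq_zero_of_isChain (h : M.IsTFreeRealization t A B X i j v) {s : List (A ⊕ B)}
    (hs : s.IsChain fun x y => x.isLeft ≠ y.isLeft) (hs₀ : s ≠ []) (hlen : s.length ≤ 3)
    (ha : ∀ a : A, .inl a ∈ s → M.φ (a : M) = 0) (hb : ∀ b : B, .inr b ∈ s → M.φ (b : M) = 0) :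
    X.φ (s.map (Sum.elim i j)).prod = 0 := by
  -- One of the two subalgebras contributes a single letter to such a short alternating word.
  rcases s with _ | ⟨a | b, _ | ⟨a' | b', _ | ⟨a'' | b'', _ | ⟨c, s⟩⟩⟩⟩
  any_goals solve | simp at hs₀ | simp at hs | (simp at hlen; lia)
  · simpa [h.φ_left] using ha
  · simp [h.φ_mul, ha a (by simp)]
  · have hmerge : i a * (j b' * i a'') = i (a * a'') * j b' := by
      rw [map_mul, mul_assoc, (h.commute a'' b').eq]
    simp only [List.map_cons, List.map_nil, Sum.elim_inl, Sum.elim_inr, List.prod_cons,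
      List.prod_nil, mul_one, hmerge, h.φ_mul, hb b' (by simp), mul_zero]
  · simpa [h.φ_right] using hb
  · simp [← (h.commute a' b).eq, h.φ_mul, ha a' (by simp)]
  · have hmerge : j b * (i a' * j b'') = i a' * j (b * b'') := by
      rw [map_mul, ← mul_assoc, ← mul_assoc, (h.commute a' b).eq]
    simp only [List.map_cons, List.map_nil, Sum.elim_inl, Sum.elim_inr, List.prod_cons,
      List.prod_nil, mul_one, hmerge, h.φ_mul, ha a' (by simp), zero_mul]

lemma shortSubwordsCentered (h : M.IsTFreeRealization t A B X i j v) {ab : List (A × B)}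
    (hlen : ab.length ≤ 3) (ha : ∀ p ∈ ab, M.φ (p.1 : M) = 0) (hb : ∀ p ∈ ab, M.φ (p.2 : M) = 0) :
    ShortSubwordsCentered (Sum.elim i j) (alternatingWord ab) := by
  intro s s' hs hs₀ hle
  have hs_len : s.length ≤ 3 := by
    have := hs.perm.length_eq
    rw [List.length_append, length_alternatingWord] at this
    lia
  have hmem : ∀ c ∈ s, c ∈ alternatingWord ab := fun c hc =>
    hs.mem_iff.1 (List.mem_append_left _ hc)
  refine h.φ_prod_eq_zero_of_isChain
    (isChain_of_append_isRotated (chain_alternatingWord ab) hs) hs₀ hs_len (fun a hc => ?_)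
    fun b hc => ?_
  · obtain ⟨p, hp, rfl⟩ : ∃ p ∈ ab, a = p.1 := by
      simpa only [alternatingWord, List.mem_flatMap, List.mem_cons, List.not_mem_nil,
        Sum.inl.injEq, reduceCtorEq, or_false] using hmem _ hc
    exact ha p hp
  · obtain ⟨p, hp, rfl⟩ : ∃ p ∈ ab, b = p.2 := by
      simpa only [alternatingWord, List.mem_flatMap, List.mem_cons, List.not_mem_nil,
        Sum.inr.injEq, reduceCtorEq, or_false, false_or] using hmem _ hc
    exact hb p hp

lemma φ_prod_of_centered (h : M.IsTFreeRealization t A B X i j v) {ab : List (A × B)}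
    (hlen : ab.length ≤ 3) (ha : ∀ p ∈ ab, M.φ (p.1 : M) = 0)
    (hb : ∀ p ∈ ab, M.φ (p.2 : M) = 0) :
    X.φ (ab.map fun p => i p.1 * (v * j p.2 * star v)).prod =
      (expNeg t : ℂ) ^ ab.length *
        (M.φ ((ab.map Prod.fst).prod : A) * M.φ ((ab.map Prod.snd).prod : B)) := by
  rcases ab.eq_nil_or_concat' with rfl | ⟨ab', p', hab⟩
  · simp [M.φ_one, X.φ_one]
  let L : List (List (A ⊕ B) × X) :=
    ab.flatMap fun p => [([.inl p.1], v), ([.inr p.2], star v)]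
  have hv : v ∈ StarAlgebra.adjoin ℂ {v} := StarAlgebra.self_mem_adjoin_singleton ℂ v
  have hmem_L : ∀ q ∈ L, ∃ p : A × B,
      q = ([.inl p.1], v) ∨ q = ([.inr p.2], star v) := fun q hq => by
    obtain ⟨p, -, hp⟩ := List.mem_flatMap.1 hq
    exact ⟨p, by simpa using hp⟩
  have hL : IsCyclicGrouping (alternatingWord ab) L := by
    refine ⟨?_, fun q hq => by obtain ⟨p, rfl | rfl⟩ := hmem_L q hq <;> simp⟩
    rw [show (L.map Prod.fst).flatten = alternatingWord ab by
      simp [L, alternatingWord, List.map_flatMap, List.flatten_eq_flatMap, List.flatMap_assoc]]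
  have hfree := h.free.φ_groupedProd (x := Sum.elim i j)
    (Sum.forall.2
      ⟨fun a _ => (le_sup_left : i.range ≤ i.range ⊔ j.range) ⟨a, rfl⟩,
        fun b _ => (le_sup_right : j.range ≤ i.range ⊔ j.range) ⟨b, rfl⟩⟩)
    (h.shortSubwordsCentered hlen ha hb) hL (by simp [L, hab])
    fun q hq => by obtain ⟨p, rfl | rfl⟩ := hmem_L q hq; exacts [hv, star_mem hv]
  have hword : groupedProd (Sum.elim i j) L =
      (ab.map fun p => i p.1 * (v * j p.2 * star v)).prod := by
    simp [groupedProd, L, List.flatMap, List.prod_flatten, Function.comp_def, mul_assoc]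
  have hunitary : (L.map fun p => X.φ p.2).prod = (expNeg t : ℂ) ^ ab.length := by
    simp [L, List.flatMap, List.prod_flatten, Function.comp_def, h.φ_unitary, h.φ_star_unitary,
      ← fubmMoment_one_mul_self]
  have hletters : ((alternatingWord ab).map (Sum.elim i j)).prod =
      (ab.map fun p => i p.1 * j p.2).prod := by
    simp [alternatingWord, List.flatMap, List.prod_flatten, Function.comp_def]
  rw [← hword, hfree, hunitary, hletters, h.prod_map_mul, h.φ_mul]

end IsTFreeRealization

namespace TFree

lemma φ_prod_of_centered (h : M.TFree t A B) {r : ℕ} (hr : r ≤ 3) {a b : Fin r → M}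
    (ha : ∀ k, a k ∈ A) (hb : ∀ k, b k ∈ B) (hφa : ∀ k, M.φ (a k) = 0)
    (hφb : ∀ k, M.φ (b k) = 0) :
    M.φ (List.ofFn fun k => a k * b k).prod =
      (expNeg t : ℂ) ^ r * (M.φ (List.ofFn a).prod * M.φ (List.ofFn b).prod) := by
  obtain ⟨X, i, j, v, hX, hword⟩ := h
  let ab : List (A × B) := List.ofFn fun k => (⟨a k, ha k⟩, ⟨b k, hb k⟩)
  have hab := hX.φ_prod_of_centered (ab := ab) (by simpa [ab] using hr)
    (by simpa [ab, List.mem_ofFn'] using hφa) (by simpa [ab, List.mem_ofFn'] using hφb)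
  rw [hword r (fun k => ⟨a k, ha k⟩) fun k => ⟨b k, hb k⟩]
  simpa [ab, List.map_ofFn, Function.comp_def] using hab

lemma φ_mul (h : M.TFree t A B) {a b : M} (ha : a ∈ A) (hb : b ∈ B) :
    M.φ (a * b) = M.φ a * M.φ b := by
  have hcentered := h.φ_prod_of_centered (r := 1) (by norm_num)
    (fun _ => sub_smul_one_mem ha (M.φ a)) (fun _ => sub_smul_one_mem hb (M.φ b))
    (fun _ => φ_sub_smul_one a) fun _ => φ_sub_smul_one b
  simp only [List.ofFn_succ, List.ofFn_zero, List.prod_cons, List.prod_nil, mul_one,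
    sub_mul, mul_sub, map_sub, smul_mul_assoc, mul_smul_comm, one_mul,
    map_smul, smul_eq_mul, M.φ_one] at hcentered
  linear_combination hcentered

lemma φ_mul_four (h : M.TFree t A B) {a₁ a₂ b₁ b₂ : M} (ha₁ : a₁ ∈ A) (ha₂ : a₂ ∈ A)
    (hb₁ : b₁ ∈ B) (hb₂ : b₂ ∈ B) :
    M.φ (a₁ * (b₁ * (a₂ * b₂))) =
      (expNeg t : ℂ) ^ 2 *
        ((M.φ (a₁ * a₂) - M.φ a₁ * M.φ a₂) * (M.φ (b₁ * b₂) - M.φ b₁ * M.φ b₂)) +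
      M.φ a₁ * M.φ a₂ * M.φ (b₁ * b₂) + M.φ b₁ * M.φ b₂ * M.φ (a₁ * a₂) -
      M.φ a₁ * M.φ a₂ * M.φ b₁ * M.φ b₂ := by
  have hcentered := h.φ_prod_of_centered (r := 2) (by norm_num)
    (a := ![a₁ - M.φ a₁ • (1 : M), a₂ - M.φ a₂ • (1 : M)])
    (b := ![b₁ - M.φ b₁ • (1 : M), b₂ - M.φ b₂ • (1 : M)])
    (Fin.forall_fin_two.2 ⟨sub_smul_one_mem ha₁ _, sub_smul_one_mem ha₂ _⟩)
    (Fin.forall_fin_two.2 ⟨sub_smul_one_mem hb₁ _, sub_smul_one_mem hb₂ _⟩)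
    (Fin.forall_fin_two.2 ⟨φ_sub_smul_one a₁, φ_sub_smul_one a₂⟩)
    (Fin.forall_fin_two.2 ⟨φ_sub_smul_one b₁, φ_sub_smul_one b₂⟩)
  have habb : M.φ (a₁ * (b₁ * b₂)) = M.φ a₁ * M.φ (b₁ * b₂) := h.φ_mul ha₁ (mul_mem hb₁ hb₂)
  have haab : M.φ (a₁ * (a₂ * b₂)) = M.φ (a₁ * a₂) * M.φ b₂ := by
    rw [← mul_assoc, h.φ_mul (mul_mem ha₁ ha₂) hb₂]
  have hbab : M.φ (b₁ * (a₂ * b₂)) = M.φ a₂ * M.φ (b₁ * b₂) := by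
    rw [M.φ_mul_comm, mul_assoc, h.φ_mul ha₂ (mul_mem hb₂ hb₁), M.φ_mul_comm b₂]
  have haba : M.φ (a₁ * (b₁ * a₂)) = M.φ (a₁ * a₂) * M.φ b₁ := by
    rw [← mul_assoc, M.φ_mul_comm, ← mul_assoc, h.φ_mul (mul_mem ha₂ ha₁) hb₁, M.φ_mul_comm a₂]
  have hba : M.φ (b₁ * a₂) = M.φ a₂ * M.φ b₁ := by rw [M.φ_mul_comm, h.φ_mul ha₂ hb₁]
  simp only [List.ofFn_succ, List.ofFn_zero, List.prod_cons, List.prod_nil, mul_one,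
    Matrix.cons_val_zero, Matrix.cons_val_succ, sub_mul, mul_sub, smul_mul_assoc, mul_smul_comm,
    one_mul, map_sub, map_smul, smul_eq_mul, M.φ_one, mul_assoc, habb, haab, hbab, haba, hba,
    h.φ_mul ha₁ hb₁, h.φ_mul ha₁ hb₂, h.φ_mul ha₂ hb₂] at hcentered
  linear_combination hcentered

end TFree

end NCProbSpace

end TFree

section CyclicWords

/-- The cyclic binary word consisting of `i₁` times `false`, `j₁` times `true`, `i₂` times `false`,
and so on, where `(i₁, j₁), (i₂, j₂), …` are the elements of `L`. -/
def cyclicBlocks (L : List (ℕ × ℕ)) : Cycle Bool :=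
  ↑(L.flatMap fun p => List.replicate p.1 false ++ List.replicate p.2 true)

/-- The binary words of length `n`, each of them considered up to rotation. -/
def cyclicWords (n : ℕ) : Multiset (Cycle Bool) :=
  (Finset.univ : Finset (Fin n → Bool)).val.map fun w => ↑(List.ofFn w)

lemma cyclicWords_two :
    cyclicWords 2 =
      {cyclicBlocks [(2, 0)], cyclicBlocks [(0, 2)]} + 2 • {cyclicBlocks [(1, 1)]} := by
  decide +kernel

lemma cyclicWords_three :
    cyclicWords 3 = {cyclicBlocks [(3, 0)], cyclicBlocks [(0, 3)]} +
      3 • {cyclicBlocks [(2, 1)], cyclicBlocks [(1, 2)]} := by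
  decide +kernel

lemma cyclicWords_four :
    cyclicWords 4 = {cyclicBlocks [(4, 0)], cyclicBlocks [(0, 4)]} +
      4 • {cyclicBlocks [(3, 1)], cyclicBlocks [(2, 2)], cyclicBlocks [(1, 3)]} +
      2 • {cyclicBlocks [(1, 1), (1, 1)]} := by
  decide +kernel

lemma cyclicWords_five :
    cyclicWords 5 = {cyclicBlocks [(5, 0)], cyclicBlocks [(0, 5)]} +
      5 • {cyclicBlocks [(4, 1)], cyclicBlocks [(3, 2)], cyclicBlocks [(2, 3)],
        cyclicBlocks [(1, 4)], cyclicBlocks [(2, 1), (1, 1)], cyclicBlocks [(1, 2), (1, 1)]} := by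
  decide +kernel

lemma cyclicWords_six :
    cyclicWords 6 = {cyclicBlocks [(6, 0)], cyclicBlocks [(0, 6)]} +
      6 • {cyclicBlocks [(5, 1)], cyclicBlocks [(4, 2)], cyclicBlocks [(3, 3)],
        cyclicBlocks [(2, 4)], cyclicBlocks [(1, 5)], cyclicBlocks [(3, 1), (1, 1)],
        cyclicBlocks [(2, 2), (1, 1)], cyclicBlocks [(2, 1), (1, 2)],
        cyclicBlocks [(1, 3), (1, 1)]} +
      3 • {cyclicBlocks [(2, 1), (2, 1)], cyclicBlocks [(1, 2), (1, 2)]} +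
      2 • {cyclicBlocks [(1, 1), (1, 1), (1, 1)]} := by
  decide +kernel

namespace NCProbSpace

variable {M : NCProbSpace.{u}} {a b : M}

/-- The expectation of the product of a cyclic word in the letters `a` (coded by `false`) and `b`
(coded by `true`). -/
def cyclicMoment (a b : M) (w : Cycle Bool) : ℂ :=
  Quotient.liftOn w (fun l => M.φ (l.map fun c => if c then b else a).prod) fun _ _ h =>
    M.φ_prod_eq_of_isRotated (h.map _)

lemma cyclicMoment_cyclicBlocks (L : List (ℕ × ℕ)) :
    cyclicMoment a b (cyclicBlocks L) = M.φ (L.map fun p => a ^ p.1 * b ^ p.2).prod := by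
  change M.φ (List.map _ _).prod = _
  simp [List.flatMap, List.prod_flatten, Function.comp_def]

lemma φ_add_pow_eq_sum_cyclicMoment (n : ℕ) :
    M.φ ((a + b) ^ n) = ((cyclicWords n).map (cyclicMoment a b)).sum := by
  have hexpand := (MultilinearMap.mkPiAlgebraFin ℂ n M).map_sum
    (fun _ (c : Bool) => if c then b else a)
  simp only [Fintype.sum_bool, if_true, Bool.false_eq_true, if_false,
    MultilinearMap.mkPiAlgebraFin_apply, List.ofFn_const, List.prod_replicate] at hexpand
  rw [add_comm, hexpand, map_sum, cyclicWords, Multiset.map_map]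
  refine Finset.sum_congr rfl fun w _ => ?_
  change _ = M.φ (List.map _ _).prod
  rw [List.map_ofFn]
  rfl

namespace TFree

variable {t : ℝ≥0∞} {A B : StarSubalgebra ℂ M}

lemma cyclicMoment_two_blocks (h : M.TFree t A B) (ha : a ∈ A) (hb : b ∈ B) (i j : ℕ) :
    cyclicMoment a b (cyclicBlocks [(i, j)]) = M.φ (a ^ i) * M.φ (b ^ j) := by
  rw [← h.φ_mul (pow_mem ha i) (pow_mem hb j), cyclicMoment_cyclicBlocks, List.map_singleton,
    List.prod_singleton]

lemma cyclicMoment_four_blocks (h : M.TFree t A B) (ha : a ∈ A) (hb : b ∈ B) (i j k l : ℕ) :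
    cyclicMoment a b (cyclicBlocks [(i, j), (k, l)]) =
      (expNeg t : ℂ) ^ 2 * ((M.φ (a ^ (i + k)) - M.φ (a ^ i) * M.φ (a ^ k)) *
        (M.φ (b ^ (j + l)) - M.φ (b ^ j) * M.φ (b ^ l))) +
      M.φ (a ^ i) * M.φ (a ^ k) * M.φ (b ^ (j + l)) +
      M.φ (b ^ j) * M.φ (b ^ l) * M.φ (a ^ (i + k)) -
      M.φ (a ^ i) * M.φ (a ^ k) * M.φ (b ^ j) * M.φ (b ^ l) := by
  rw [pow_add, pow_add, ← h.φ_mul_four (pow_mem ha i) (pow_mem ha k) (pow_mem hb j) (pow_mem hb l),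
    cyclicMoment_cyclicBlocks]
  simp only [List.map_cons, List.map_nil, List.prod_cons, List.prod_nil, mul_one, mul_assoc]

lemma cyclicMoment_six_letters (h : M.TFree t A B) (ha : a ∈ A) (hb : b ∈ B) (hφa : M.φ a = 0)
    (hφb : M.φ b = 0) :
    cyclicMoment a b (cyclicBlocks [(1, 1), (1, 1), (1, 1)]) =
      (expNeg t : ℂ) ^ 3 * (M.φ (a ^ 3) * M.φ (b ^ 3)) := by
  have hcentered := h.φ_prod_of_centered (r := 3) le_rfl (fun _ => ha) (fun _ => hb)
    (fun _ => hφa) fun _ => hφb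
  simp only [List.ofFn_const, List.prod_replicate] at hcentered
  rw [cyclicMoment_cyclicBlocks, ← hcentered]
  simp only [List.map_cons, List.map_nil, List.prod_cons, List.prod_nil, pow_one, pow_three,
    mul_one]

end TFree

/-- The moments up to order `6` of the sum of two centered elements of `t`-free subalgebras, in
terms of the moments `f` and `g` of these elements and of `x = e^{-t}`. -/
def mixMoment (x : ℂ) (f g : ℕ → ℂ) : ℕ → ℂ
  | 0 => 1
  | 2 => f 2 + g 2
  | 3 => f 3 + g 3
  | 4 => f 4 + g 4 + (4 + 2 * x ^ 2) * (f 2 * g 2)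
  | 5 => f 5 + g 5 + (5 + 5 * x ^ 2) * (f 3 * g 2 + f 2 * g 3)
  | 6 => f 6 + g 6 + (6 + 9 * x ^ 2) * (f 4 * g 2 + f 2 * g 4) +
      3 * (1 - x ^ 2) * (f 2 ^ 2 * g 2 + f 2 * g 2 ^ 2) +
      (6 + 12 * x ^ 2 + 2 * x ^ 3) * (f 3 * g 3)
  | _ => 0

lemma TFree.φ_add_pow {t : ℝ≥0∞} {A B : StarSubalgebra ℂ M} (h : M.TFree t A B) (ha : a ∈ A)
    (hb : b ∈ B) (hφa : M.φ a = 0) (hφb : M.φ b = 0) {k : ℕ} (hk : k ≤ 6) :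
    M.φ ((a + b) ^ k) =
      mixMoment (expNeg t) (fun j => M.φ (a ^ j)) (fun j => M.φ (b ^ j)) k := by
  interval_cases k
  · simp [mixMoment, M.φ_one]
  · simp [mixMoment, hφa, hφb]
  all_goals
    rw [φ_add_pow_eq_sum_cyclicMoment]
    simp only [cyclicWords_two, cyclicWords_three, cyclicWords_four, cyclicWords_five,
      cyclicWords_six, Multiset.map_add, Multiset.map_nsmul, Multiset.insert_eq_cons,
      Multiset.map_cons, Multiset.map_singleton, Multiset.sum_add, Multiset.sum_nsmul,
      Multiset.sum_cons, Multiset.sum_singleton, nsmul_eq_mul, h.cyclicMoment_two_blocks ha hb,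
      h.cyclicMoment_four_blocks ha hb, h.cyclicMoment_six_letters ha hb hφa hφb, pow_zero, pow_one,
      M.φ_one, hφa, hφb, mixMoment]
    push_cast
    ring

end NCProbSpace

end CyclicWords

section Existence

noncomputable section

/-- The moments of `y + s • 1` in terms of the moments `g` of `y`. -/
def shiftMoment (s : ℂ) (g : ℕ → ℂ) (k : ℕ) : ℂ :=
  ∑ j ∈ Finset.range (k + 1), g j * s ^ (k - j) * k.choose j

/-- The sum over the permutations `σ` of `Fin n` of `F(λ)` times the product of the `g(λᵢ)`, where
`λ` is the list of the cycle lengths of `σ`. -/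
def momentSum (n : ℕ) (F : List ℕ → ℂ) (g : ℕ → ℂ) : ℂ :=
  ∑ σ : Equiv.Perm (Fin n), F (cycleShape σ) * ((cycleShape σ).map g).prod

variable {n : ℕ}

lemma shiftMoment_congr {s : ℂ} {f g : ℕ → ℂ} {k : ℕ} (h : ∀ j ≤ k, f j = g j) :
    shiftMoment s f k = shiftMoment s g k :=
  Finset.sum_congr rfl fun j hj => by rw [h j (Nat.lt_succ_iff.1 (Finset.mem_range.1 hj))]

lemma momentSum_congr (F : List ℕ → ℂ) {f g : ℕ → ℂ} (h : ∀ k ≤ n, f k = g k) :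
    momentSum n F f = momentSum n F g := by
  refine Finset.sum_congr rfl fun σ _ => ?_
  have hle : ∀ k ∈ cycleShape σ, k ≤ n := fun k hk => by
    have hmem : k ∈ σ.partition.parts := by rwa [← coe_cycleShape, Multiset.mem_coe]
    simpa only [σ.partition.parts_sum, Fintype.card_fin] using Multiset.le_sum_of_mem hmem
  rw [List.map_congr_left fun k hk => h k (hle k hk)]

section Expansions

variable (F : List ℕ → ℂ) (g : ℕ → ℂ)

lemma momentSum_two : momentSum 2 F g = F [2] * g 2 + F [1, 1] * g 1 ^ 2 := by
  rw [momentSum, sum_comp_cycleShape_two fun l => F l * (l.map g).prod]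
  simp only [List.map_cons, List.map_nil, List.prod_cons, List.prod_nil]
  ring

lemma momentSum_three :
    momentSum 3 F g = 2 * F [3] * g 3 + 3 * F [2, 1] * g 2 * g 1 + F [1, 1, 1] * g 1 ^ 3 := by
  rw [momentSum, sum_comp_cycleShape_three fun l => F l * (l.map g).prod]
  simp only [List.map_cons, List.map_nil, List.prod_cons, List.prod_nil]
  ring

lemma momentSum_four :
    momentSum 4 F g = 6 * F [4] * g 4 + 8 * F [3, 1] * g 3 * g 1 + 3 * F [2, 2] * g 2 ^ 2 +
      6 * F [2, 1, 1] * g 2 * g 1 ^ 2 + F [1, 1, 1, 1] * g 1 ^ 4 := by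
  rw [momentSum, sum_comp_cycleShape_four fun l => F l * (l.map g).prod]
  simp only [List.map_cons, List.map_nil, List.prod_cons, List.prod_nil]
  ring

lemma momentSum_five :
    momentSum 5 F g = 24 * F [5] * g 5 + 30 * F [4, 1] * g 4 * g 1 +
      20 * F [3, 2] * g 3 * g 2 + 20 * F [3, 1, 1] * g 3 * g 1 ^ 2 +
      15 * F [2, 2, 1] * g 2 ^ 2 * g 1 + 10 * F [2, 1, 1, 1] * g 2 * g 1 ^ 3 +
      F [1, 1, 1, 1, 1] * g 1 ^ 5 := by
  rw [momentSum, sum_comp_cycleShape_five fun l => F l * (l.map g).prod]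
  simp only [List.map_cons, List.map_nil, List.prod_cons, List.prod_nil]
  ring

lemma momentSum_six :
    momentSum 6 F g = 120 * F [6] * g 6 + 144 * F [5, 1] * g 5 * g 1 + 90 * F [4, 2] * g 4 * g 2 +
      90 * F [4, 1, 1] * g 4 * g 1 ^ 2 + 40 * F [3, 3] * g 3 ^ 2 +
      120 * F [3, 2, 1] * g 3 * g 2 * g 1 + 40 * F [3, 1, 1, 1] * g 3 * g 1 ^ 3 +
      15 * F [2, 2, 2] * g 2 ^ 3 + 45 * F [2, 2, 1, 1] * g 2 ^ 2 * g 1 ^ 2 +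
      15 * F [2, 1, 1, 1, 1] * g 2 * g 1 ^ 4 + F [1, 1, 1, 1, 1, 1] * g 1 ^ 6 := by
  rw [momentSum, sum_comp_cycleShape_six fun l => F l * (l.map g).prod]
  simp only [List.map_cons, List.map_nil, List.prod_cons, List.prod_nil]
  ring

end Expansions

lemma momentSum_tFreeCoeff_shiftMoment (x : ℝ) (hn : n ∈ Finset.Icc 2 6) {g : ℕ → ℂ}
    (hg : g 0 = 1) (s : ℂ) :
    momentSum n (fun l => tFreeCoeff x l) (shiftMoment s g) =
      momentSum n (fun l => tFreeCoeff x l) g := by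
  obtain ⟨hn₂, hn₆⟩ := Finset.mem_Icc.1 hn
  interval_cases n
  all_goals
    simp only [momentSum_two, momentSum_three, momentSum_four, momentSum_five, momentSum_six,
      tFreeCoeff, shiftMoment, Finset.sum_range_succ, Finset.sum_range_zero, hg]
    norm_num [Nat.choose]
    ring

lemma momentSum_tFreeCoeff_mixMoment (x : ℝ) (hn : n ∈ Finset.Icc 2 6) {f g : ℕ → ℂ}
    (hf : f 1 = 0) (hg : g 1 = 0) :
    momentSum n (fun l => tFreeCoeff x l) (NCProbSpace.mixMoment x f g) =
      momentSum n (fun l => tFreeCoeff x l) f + momentSum n (fun l => tFreeCoeff x l) g := by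
  obtain ⟨hn₂, hn₆⟩ := Finset.mem_Icc.1 hn
  interval_cases n
  all_goals
    simp only [momentSum_two, momentSum_three, momentSum_four, momentSum_five, momentSum_six,
      tFreeCoeff, NCProbSpace.mixMoment, hf, hg]
    push_cast
    ring

namespace NCProbSpace

variable {M : NCProbSpace.{u}}

lemma cumulantForm_const (F : List ℕ → ℂ) (y : M) :
    M.cumulantForm (fun σ : Equiv.Perm (Fin n) => F (cycleShape σ)) (fun _ => y) =
      momentSum n F fun k => M.φ (y ^ k) := by
  rw [M.cumulantForm_apply]
  refine Finset.sum_congr rfl fun σ _ => ?_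
  rw [M.permForm_const, ← coe_cycleShape, Multiset.map_coe, Multiset.prod_coe]

lemma φ_add_smul_one_pow (y : M) (s : ℂ) (k : ℕ) :
    M.φ ((y + s • (1 : M)) ^ k) = shiftMoment s (fun j => M.φ (y ^ j)) k := by
  rw [((Commute.one_right y).smul_right s).add_pow, map_sum, shiftMoment]
  refine Finset.sum_congr rfl fun j _ => ?_
  rw [← nsmul_eq_mul', smul_pow, one_pow, mul_smul_comm, mul_one, map_nsmul, map_smul,
    nsmul_eq_mul, smul_eq_mul]
  ring

lemma exists_centered_add_smul_one {A : StarSubalgebra ℂ M} {a : M} (ha : a ∈ A) :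
    ∃ (b : M) (s : ℂ), b + s • (1 : M) = a ∧ b ∈ A ∧ M.φ b = 0 :=
  ⟨a - M.φ a • (1 : M), M.φ a, sub_add_cancel _ _, sub_smul_one_mem ha _, φ_sub_smul_one a⟩

lemma TFree.φ_add_add_smul_one_pow {t : ℝ≥0∞} {A B : StarSubalgebra ℂ M} (h : M.TFree t A B)
    {a b : M} (ha : a ∈ A) (hb : b ∈ B) (hφa : M.φ a = 0) (hφb : M.φ b = 0) (s s' : ℂ) {k : ℕ}
    (hk : k ≤ 6) :
    M.φ ((a + s • (1 : M) + (b + s' • (1 : M))) ^ k) =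
      shiftMoment (s + s')
        (mixMoment (expNeg t) (fun j => M.φ (a ^ j)) (fun j => M.φ (b ^ j))) k := by
  rw [add_add_add_comm, ← add_smul, φ_add_smul_one_pow]
  exact shiftMoment_congr fun j hj => h.φ_add_pow ha hb hφa hφb (hj.trans hk)

lemma TFree.momentSum_add {t : ℝ≥0∞} {A B : StarSubalgebra ℂ M} (h : M.TFree t A B)
    (hn : n ∈ Finset.Icc 2 6) {a b : M} (ha : a ∈ A) (hb : b ∈ B) :
    momentSum n (fun l => tFreeCoeff (expNeg t) l) (fun k => M.φ ((a + b) ^ k)) =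
      momentSum n (fun l => tFreeCoeff (expNeg t) l) (fun k => M.φ (a ^ k)) +
        momentSum n (fun l => tFreeCoeff (expNeg t) l) (fun k => M.φ (b ^ k)) := by
  obtain ⟨a, s, rfl, ha, hφa⟩ := exists_centered_add_smul_one ha
  obtain ⟨b, s', rfl, hb, hφb⟩ := exists_centered_add_smul_one hb
  have hzero (y : M) : M.φ (y ^ 0) = 1 := by rw [pow_zero, M.φ_one]
  rw [momentSum_congr _ fun k hk => h.φ_add_add_smul_one_pow ha hb hφa hφb s s'
    (hk.trans (Finset.mem_Icc.1 hn).2)]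
  simp_rw [φ_add_smul_one_pow]
  rw [momentSum_tFreeCoeff_shiftMoment _ hn rfl, momentSum_tFreeCoeff_shiftMoment _ hn (hzero a),
    momentSum_tFreeCoeff_shiftMoment _ hn (hzero b),
    momentSum_tFreeCoeff_mixMoment _ hn ((congr_arg _ (pow_one a)).trans hφa)
      ((congr_arg _ (pow_one b)).trans hφb)]

end NCProbSpace

lemma sum_cycleType_eq_singleton (hn : 2 ≤ n) (F : List ℕ → ℂ) :
    ∑ σ : Equiv.Perm (Fin n) with σ.cycleType = {n}, F (cycleShape σ) =
      (n - 1).factorial * F [n] := by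
  have hshape : ∀ σ ∈ Finset.univ.filter fun σ : Equiv.Perm (Fin n) => σ.cycleType = {n},
      F (cycleShape σ) = F [n] := fun σ hσ => by
    rw [(cycleShape_eq_iff (List.pairwise_singleton _ _)).2]
    rw [Equiv.Perm.parts_partition, ← Equiv.Perm.sum_cycleType, (Finset.mem_filter.1 hσ).2]
    simp
  rw [Finset.sum_congr rfl hshape, Finset.sum_const,
    Equiv.Perm.card_of_cycleType_singleton hn (Fintype.card_fin n).ge, Fintype.card_fin,
    Nat.choose_self, mul_one, nsmul_eq_mul]

lemma tFreeCoeff_singleton (x : ℝ) (hn : n ∈ Finset.Icc 2 6) : tFreeCoeff x [n] = 1 := by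
  obtain ⟨hn₂, hn₆⟩ := Finset.mem_Icc.1 hn
  interval_cases n <;> rfl

lemma isTFreeCumulant_tFreeCoeff (t : ℝ≥0∞) (hn : n ∈ Finset.Icc 2 6) :
    IsTFreeCumulant.{u} t n fun σ => tFreeCoeff (expNeg t) (cycleShape σ) := by
  set F : List ℕ → ℂ := fun l => tFreeCoeff (expNeg t) l
  refine ⟨?_, fun M A B h m hm hA hB => ?_⟩
  · rw [sum_cycleType_eq_singleton (Finset.mem_Icc.1 hn).1 F]
    simp [F, tFreeCoeff_singleton _ hn, Nat.factorial_ne_zero]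
  · have hperm (ρ : Equiv.Perm (Fin n)) (m : Fin n → M) :=
      M.cumulantForm_comp_perm (isConjInvariant_comp_cycleShape F) ρ m
    have hadd : ∀ a ∈ A.toSubalgebra.toSubmodule.toAddSubmonoid,
        ∀ b ∈ B.toSubalgebra.toSubmodule.toAddSubmonoid,
        M.cumulantForm (fun σ : Equiv.Perm (Fin n) => F (cycleShape σ)) (fun _ => a + b) =
          M.cumulantForm (fun σ => F (cycleShape σ)) (fun _ => a) +
            M.cumulantForm (fun σ => F (cycleShape σ)) (fun _ => b) := fun a ha b hb => by
      simp only [NCProbSpace.cumulantForm_const]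
      exact h.momentSum_add hn ha hb
    exact (M.cumulantForm_apply _ _).symm.trans (eq_zero_of_map_const_add hperm hadd hm hA hB)

end

end Existence

section FreeState

variable {P ι : Type*} [Ring P] [StarRing P] [Algebra ℂ P] [StarModule ℂ P]
  {φ : P →ₗ[ℂ] ℂ} {A : ι → StarSubalgebra ℂ P}

/-- Words of centered elements, each labelled by a subalgebra which contains it, any two
consecutive ones having distinct labels. -/
def IsAlternating (φ : P →ₗ[ℂ] ℂ) (A : ι → StarSubalgebra ℂ P) (l : List (ι × P)) : Prop :=
  (l.IsChain fun p q => p.1 ≠ q.1) ∧ ∀ p ∈ l, p.2 ∈ A p.1 ∧ φ p.2 = 0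

/-- A unital linear form for which a generating family of `*`-subalgebras is free, and whose
restriction to each of them is tracial, hermitian and positive. -/
structure IsFreeState (φ : P →ₗ[ℂ] ℂ) (A : ι → StarSubalgebra ℂ P) : Prop where
  map_one : φ 1 = 1
  map_prod : ∀ l, IsAlternating φ A l → l ≠ [] → φ (l.map Prod.snd).prod = 0
  generates : Algebra.adjoin ℂ (⋃ i, (A i : Set P)) = ⊤
  mul_comm : ∀ i, ∀ x ∈ A i, ∀ y ∈ A i, φ (x * y) = φ (y * x)
  map_star : ∀ i, ∀ x ∈ A i, φ (star x) = star (φ x)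
  nonneg : ∀ i, ∀ x ∈ A i, 0 ≤ φ (star x * x)

namespace IsAlternating

lemma nil : IsAlternating φ A [] :=
  ⟨List.isChain_nil, by simp only [List.not_mem_nil, false_imp_iff, implies_true]⟩

lemma cons {i : ι} {a : P} {l : List (ι × P)} (ha : a ∈ A i) (ha0 : φ a = 0)
    (hi : ∀ q ∈ l.head?, i ≠ q.1) (hl : IsAlternating φ A l) :
    IsAlternating φ A ((i, a) :: l) := by
  refine ⟨List.isChain_cons.2 ⟨hi, hl.1⟩, fun q hq => ?_⟩
  rcases List.mem_cons.1 hq with rfl | hq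
  exacts [⟨ha, ha0⟩, hl.2 q hq]

lemma ne_of_mem_head? {p : ι × P} {l : List (ι × P)} (h : IsAlternating φ A (p :: l)) :
    ∀ q ∈ l.head?, p.1 ≠ q.1 :=
  (List.isChain_cons.1 h.1).1

lemma tail {l : List (ι × P)} (h : IsAlternating φ A l) : IsAlternating φ A l.tail :=
  ⟨h.1.tail, fun q hq => h.2 q (List.mem_of_mem_tail hq)⟩

lemma of_cons {p : ι × P} {l : List (ι × P)} (h : IsAlternating φ A (p :: l)) :
    IsAlternating φ A l :=
  h.tail

lemma mem_head {p : ι × P} {l : List (ι × P)} (h : IsAlternating φ A (p :: l)) : p.2 ∈ A p.1 :=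
  (h.2 p List.mem_cons_self).1

lemma replace_head {i : ι} {b c : P} {l : List (ι × P)}
    (h : IsAlternating φ A ((i, b) :: l)) (hc : c ∈ A i) (hc0 : φ c = 0) :
    IsAlternating φ A ((i, c) :: l) :=
  h.of_cons.cons hc hc0 h.ne_of_mem_head?

end IsAlternating

omit [Algebra ℂ P] [StarModule ℂ P] in
lemma star_prod_map_snd (l : List (ι × P)) :
    star (l.map Prod.snd).prod = ((l.map fun p => (p.1, star p.2)).reverse.map Prod.snd).prod := by
  induction l with
  | nil => simp only [List.map_nil, List.prod_nil, star_one, List.reverse_nil]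
  | cons p l ih =>
    simp only [List.map_cons, List.prod_cons, star_mul, ih, List.reverse_cons, List.map_append,
      List.prod_append, List.map_nil, List.prod_nil, mul_one]

/-- The span of the alternating products. -/
def alternatingSpan (φ : P →ₗ[ℂ] ℂ) (A : ι → StarSubalgebra ℂ P) : Submodule ℂ P :=
  Submodule.span ℂ ((fun l => (l.map Prod.snd).prod) '' {l | IsAlternating φ A l})

lemma IsAlternating.prod_mem_alternatingSpan {l : List (ι × P)} (h : IsAlternating φ A l) :
    (l.map Prod.snd).prod ∈ alternatingSpan φ A :=
  Submodule.subset_span ⟨l, h, rfl⟩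

namespace IsFreeState

lemma map_sub_smul_one (hφ : IsFreeState φ A) (x : P) : φ (x - φ x • (1 : P)) = 0 := by
  rw [map_sub, map_smul, hφ.map_one, smul_eq_mul, mul_one, sub_self]

lemma mul_prod_mem_alternatingSpan_of_ne (hφ : IsFreeState φ A) {i : ι} {a : P} (ha : a ∈ A i)
    {l : List (ι × P)} (hl : IsAlternating φ A l) (hi : ∀ q ∈ l.head?, i ≠ q.1) :
    a * (l.map Prod.snd).prod ∈ alternatingSpan φ A := by
  have hcentered := (hl.cons (sub_smul_one_mem ha _) (hφ.map_sub_smul_one a)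
    hi).prod_mem_alternatingSpan
  have hscalar := (alternatingSpan φ A).smul_mem (φ a) hl.prod_mem_alternatingSpan
  simpa only [List.map_cons, List.prod_cons, sub_mul, smul_mul_assoc, one_mul, sub_add_cancel]
    using add_mem hcentered hscalar

lemma mul_prod_mem_alternatingSpan (hφ : IsFreeState φ A) {i : ι} {a : P} (ha : a ∈ A i)
    {l : List (ι × P)} (hl : IsAlternating φ A l) :
    a * (l.map Prod.snd).prod ∈ alternatingSpan φ A := by
  rcases l with _ | ⟨⟨j, b⟩, l⟩
  · exact hφ.mul_prod_mem_alternatingSpan_of_ne ha hl (by simp)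
  · rcases eq_or_ne i j with rfl | hij
    · rw [List.map_cons, List.prod_cons, ← mul_assoc]
      exact hφ.mul_prod_mem_alternatingSpan_of_ne (mul_mem ha hl.mem_head) hl.of_cons
        hl.ne_of_mem_head?
    · exact hφ.mul_prod_mem_alternatingSpan_of_ne ha hl (by simpa using hij)

lemma mul_mem_alternatingSpan (hφ : IsFreeState φ A) {i : ι} {a x : P} (ha : a ∈ A i)
    (hx : x ∈ alternatingSpan φ A) : a * x ∈ alternatingSpan φ A := by
  suffices h : alternatingSpan φ A ≤ (alternatingSpan φ A).comap (LinearMap.mulLeft ℂ a) from h hx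
  refine Submodule.span_le.2 ?_
  rintro _ ⟨l, hl, rfl⟩
  exact hφ.mul_prod_mem_alternatingSpan ha hl

lemma alternatingSpan_eq_top (hφ : IsFreeState φ A) : alternatingSpan φ A = ⊤ := by
  refine Submodule.eq_top_iff'.2 fun x => ?_
  have hx : x ∈ Algebra.adjoin ℂ (⋃ i, (A i : Set P)) := hφ.generates ▸ Algebra.mem_top
  suffices h : ∀ y ∈ alternatingSpan φ A, x * y ∈ alternatingSpan φ A by
    simpa using h _ (IsAlternating.nil (φ := φ)).prod_mem_alternatingSpan
  induction hx using Algebra.adjoin_induction with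
  | mem x hx =>
    obtain ⟨i, hi⟩ := Set.mem_iUnion.1 hx
    exact fun y hy => hφ.mul_mem_alternatingSpan hi hy
  | algebraMap r =>
    intro y hy
    rw [← Algebra.smul_def]
    exact Submodule.smul_mem _ _ hy
  | add x y _ _ hx hy =>
    intro z hz
    rw [add_mul]
    exact add_mem (hx z hz) (hy z hz)
  | mul x y _ _ hx hy =>
    intro z hz
    rw [mul_assoc]
    exact hx _ (hy z hz)

lemma induction_on (hφ : IsFreeState φ A) {p : P → Prop} (zero : p 0)
    (add : ∀ x y, p x → p y → p (x + y)) (smul : ∀ (c : ℂ) x, p x → p (c • x))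
    (prod : ∀ l, IsAlternating φ A l → p (l.map Prod.snd).prod) (x : P) : p x := by
  have hx : x ∈ alternatingSpan φ A := hφ.alternatingSpan_eq_top ▸ Submodule.mem_top
  induction hx using Submodule.span_induction with
  | zero => exact zero
  | add x y _ _ hx hy => exact add x y hx hy
  | smul c x _ hx => exact smul c x hx
  | mem x hx =>
    obtain ⟨l, hl, rfl⟩ := hx
    exact prod l hl

lemma isAlternating_starReverse (hφ : IsFreeState φ A) {l : List (ι × P)}
    (h : IsAlternating φ A l) :
    IsAlternating φ A (l.map fun p => (p.1, star p.2)).reverse := by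
  constructor
  · rw [List.isChain_reverse, List.isChain_map]
    exact h.1.imp fun p q hpq => hpq.symm
  · intro q hq
    obtain ⟨p, hp, rfl⟩ := List.mem_map.1 (List.mem_reverse.1 hq)
    obtain ⟨hmem, hzero⟩ := h.2 p hp
    exact ⟨star_mem hmem, by rw [hφ.map_star _ _ hmem, hzero, star_zero]⟩

lemma apply_star (hφ : IsFreeState φ A) (x : P) : φ (star x) = star (φ x) := by
  induction x using hφ.induction_on with
  | zero => simp only [star_zero, map_zero]
  | add x y hx hy => simp only [star_add, map_add, hx, hy]
  | smul c x hx => simp only [star_smul, map_smul, hx]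
  | prod l hl =>
    rcases eq_or_ne l [] with rfl | hne
    · simp only [List.map_nil, List.prod_nil, star_one, hφ.map_one]
    · rw [star_prod_map_snd, hφ.map_prod l hl hne,
        hφ.map_prod _ (hφ.isAlternating_starReverse hl) (by simpa using hne), star_zero]

lemma map_mul_prod_eq_zero (hφ : IsFreeState φ A) {i : ι} {a : P} (ha : a ∈ A i) (ha0 : φ a = 0)
    {l : List (ι × P)} (hl : IsAlternating φ A l) (hne : ∀ b, l ≠ [(i, b)]) :
    φ (a * (l.map Prod.snd).prod) = 0 := by
  rcases l with _ | ⟨⟨j, b⟩, l⟩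
  · rwa [List.map_nil, List.prod_nil, mul_one]
  · rcases eq_or_ne i j with rfl | hij
    · have htail : l ≠ [] := fun h => hne b (by rw [h])
      have hcentered := hφ.map_prod _ (hl.replace_head
        (sub_smul_one_mem (mul_mem ha hl.mem_head) _) (hφ.map_sub_smul_one (a * b)))
        (List.cons_ne_nil _ _)
      rw [List.map_cons, List.prod_cons, sub_mul, smul_mul_assoc, one_mul, map_sub, map_smul,
        hφ.map_prod l hl.of_cons htail, smul_zero, sub_zero] at hcentered
      rw [List.map_cons, List.prod_cons, ← mul_assoc, hcentered]
    · exact hφ.map_prod _ (hl.cons ha ha0 (by simpa using hij)) (List.cons_ne_nil _ _)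

lemma map_prod_mul_eq_zero (hφ : IsFreeState φ A) {i : ι} {a : P} (ha : a ∈ A i) (ha0 : φ a = 0)
    {l : List (ι × P)} (hl : IsAlternating φ A l) (hne : ∀ b, l ≠ [(i, b)]) :
    φ ((l.map Prod.snd).prod * a) = 0 := by
  have hstar := hφ.map_mul_prod_eq_zero (star_mem ha)
    (by rw [hφ.map_star i a ha, ha0, star_zero]) (hφ.isAlternating_starReverse hl) fun b hb => by
      rw [List.reverse_eq_iff, List.reverse_singleton, List.map_eq_singleton_iff] at hb
      obtain ⟨⟨j, c⟩, rfl, hb⟩ := hb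
      exact hne c (congr_arg (fun k => [(k, c)]) (Prod.mk.inj hb).1)
  rwa [← star_prod_map_snd, ← star_mul, hφ.apply_star, star_eq_zero] at hstar

lemma apply_mul_comm_of_centered (hφ : IsFreeState φ A) {i : ι} {a : P} (ha : a ∈ A i)
    (ha0 : φ a = 0) (x : P) : φ (x * a) = φ (a * x) := by
  induction x using hφ.induction_on with
  | zero => rw [zero_mul, mul_zero]
  | add x y hx hy => rw [add_mul, mul_add, map_add, map_add, hx, hy]
  | smul c x hx => rw [smul_mul_assoc, mul_smul_comm, map_smul, map_smul, hx]
  | prod l hl =>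
    by_cases h : ∃ b, l = [(i, b)]
    · obtain ⟨b, rfl⟩ := h
      simpa using hφ.mul_comm i b hl.mem_head a ha
    · rw [hφ.map_prod_mul_eq_zero ha ha0 hl (not_exists.1 h),
        hφ.map_mul_prod_eq_zero ha ha0 hl (not_exists.1 h)]

lemma apply_mul_comm (hφ : IsFreeState φ A) (x y : P) : φ (x * y) = φ (y * x) := by
  have hy : y ∈ Algebra.adjoin ℂ (⋃ i, (A i : Set P)) := hφ.generates ▸ Algebra.mem_top
  induction hy using Algebra.adjoin_induction generalizing x with
  | algebraMap r => rw [Algebra.commutes]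
  | add y z _ _ hy hz => rw [mul_add, add_mul, map_add, map_add, hy, hz]
  | mul y z _ _ hy hz => rw [← mul_assoc, hz, ← mul_assoc, hy, mul_assoc]
  | mem a ha =>
    obtain ⟨i, hi⟩ := Set.mem_iUnion.1 ha
    have hcentered := hφ.apply_mul_comm_of_centered (sub_smul_one_mem hi (φ a))
      (hφ.map_sub_smul_one a) x
    rw [mul_sub, sub_mul, map_sub, map_sub, mul_smul_comm, smul_mul_assoc, mul_one, one_mul]
      at hcentered
    exact sub_left_injective hcentered

lemma posSemidef_of_mem (hφ : IsFreeState φ A) {α : Type*} {i : ι} (f : α → P)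
    (hf : ∀ a, f a ∈ A i) : (Matrix.of fun a b => φ (star (f a) * f b)).PosSemidef := by
  refine ⟨?_, fun c => ?_⟩
  · ext a b
    rw [Matrix.conjTranspose_apply, Matrix.of_apply, Matrix.of_apply,
      ← hφ.map_star i _ (mul_mem (star_mem (hf b)) (hf a)), star_mul, star_star]
  · have hnonneg := hφ.nonneg i (c.sum fun a r => r • f a)
      (sum_mem fun a _ => (A i).smul_mem (hf a) _)
    simp only [Finsupp.sum, star_sum, star_smul, Finset.sum_mul, Finset.mul_sum, map_sum,
      smul_mul_assoc, mul_smul_comm, map_smul, smul_eq_mul] at hnonneg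
    rw [Finset.sum_comm] at hnonneg
    simp only [Finsupp.sum, Matrix.of_apply]
    refine hnonneg.trans_eq (Finset.sum_congr rfl fun a _ => Finset.sum_congr rfl fun b _ => ?_)
    ring

lemma map_star_prod_mul_cons_of_ne (hφ : IsFreeState φ A) {q : ι × P} {l l' : List (ι × P)}
    (h : IsAlternating φ A l) (h' : IsAlternating φ A (q :: l')) (hne : ∀ p ∈ l.head?, p.1 ≠ q.1) :
    φ (star (l.map Prod.snd).prod * ((q :: l').map Prod.snd).prod) = 0 := by
  have hrev := hφ.isAlternating_starReverse h
  have hjoin : ∀ r ∈ (l.map fun p => (p.1, star p.2)).reverse.getLast?,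
      ∀ s ∈ (q :: l').head?, r.1 ≠ s.1 := fun r hr s hs => by
    rw [List.getLast?_reverse, List.head?_map, Option.mem_map] at hr
    obtain ⟨p, hp, rfl⟩ := hr
    exact Option.mem_some_iff.1 hs ▸ hne p hp
  have happend :
      IsAlternating φ A ((l.map fun p => (p.1, star p.2)).reverse ++ q :: l') :=
    ⟨List.isChain_append.2 ⟨hrev.1, h'.1, hjoin⟩, fun r hr =>
      (List.mem_append.1 hr).elim (hrev.2 r) (h'.2 r)⟩
  rw [star_prod_map_snd, ← List.prod_append, ← List.map_append]
  exact hφ.map_prod _ happend (by simp)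

lemma map_star_cons_mul_cons (hφ : IsFreeState φ A) {i : ι} {a b : P} {l l' : List (ι × P)}
    (h : IsAlternating φ A ((i, a) :: l)) (h' : IsAlternating φ A ((i, b) :: l')) :
    φ (star (((i, a) :: l).map Prod.snd).prod * (((i, b) :: l').map Prod.snd).prod) =
      φ (star a * b) * φ (star (l.map Prod.snd).prod * (l'.map Prod.snd).prod) := by
  have hmem : star a * b ∈ A i := mul_mem (star_mem h.mem_head) h'.mem_head
  have hcentered := hφ.map_star_prod_mul_cons_of_ne h.of_cons
    (h'.replace_head (sub_smul_one_mem hmem _) (hφ.map_sub_smul_one _))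
    fun p hp => (h.ne_of_mem_head? p hp).symm
  rw [List.map_cons, List.prod_cons, sub_mul, mul_sub, map_sub, smul_mul_assoc, one_mul,
    mul_smul_comm, map_smul, smul_eq_mul, sub_eq_zero] at hcentered
  rw [← hcentered]
  simp only [List.map_cons, List.prod_cons, star_mul, mul_assoc]

section Positivity

variable [DecidableEq ι]

/-- The first element of a word if its label is `i`, and `0` otherwise. -/
def headAt (i : ι) : List (ι × P) → P
  | [] => 0
  | p :: _ => if p.1 = i then p.2 else 0

lemma headAt_mem (i : ι) {l : List (ι × P)} (hl : IsAlternating φ A l) : headAt i l ∈ A i := by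
  rcases l with _ | ⟨⟨j, a⟩, l⟩
  · exact zero_mem _
  · rw [headAt]
    split_ifs with h
    · exact h ▸ hl.mem_head
    · exact zero_mem _

lemma map_star_prod_mul_prod [Fintype ι] (hφ : IsFreeState φ A) {l l' : List (ι × P)}
    (h : IsAlternating φ A l) (h' : IsAlternating φ A l') :
    φ (star (l.map Prod.snd).prod * (l'.map Prod.snd).prod) =
      (if l = [] then 1 else 0) * (if l' = [] then 1 else 0) +
        ∑ i, φ (star (headAt i l) * headAt i l') *
          φ (star (l.tail.map Prod.snd).prod * (l'.tail.map Prod.snd).prod) := by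
  rcases l with _ | ⟨⟨i, a⟩, l⟩ <;> rcases l' with _ | ⟨⟨j, b⟩, l'⟩
  · simp [headAt, hφ.map_one]
  · simpa [headAt] using hφ.map_prod _ h' (List.cons_ne_nil _ _)
  · rw [List.map_nil, List.prod_nil, mul_one, hφ.apply_star, hφ.map_prod _ h (List.cons_ne_nil _ _)]
    simp [headAt]
  · rcases eq_or_ne i j with rfl | hij
    · rw [hφ.map_star_cons_mul_cons h h']
      simp [headAt, apply_ite]
    · rw [hφ.map_star_prod_mul_cons_of_ne h h' (by simpa using hij)]
      simp [headAt, apply_ite, hij]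

end Positivity

lemma posSemidef_of_length_le [Finite ι] (hφ : IsFreeState φ A) {α : Type*} [Finite α] {N : ℕ}
    (f : α → List (ι × P)) (hf : ∀ a, IsAlternating φ A (f a)) (hN : ∀ a, (f a).length ≤ N) :
    (Matrix.of fun a b =>
      φ (star ((f a).map Prod.snd).prod * ((f b).map Prod.snd).prod)).PosSemidef := by
  classical
  have := Fintype.ofFinite ι
  induction N generalizing f with
  | zero =>
    have hnil (a : α) : f a = [] := List.length_eq_zero_iff.1 (Nat.le_zero.1 (hN a))
    convert Matrix.posSemidef_vecMulVec_star_self (1 : α → ℂ)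
    ext a b
    simp [hnil, hφ.map_one, Matrix.vecMulVec_apply]
  | succ N ih =>
    have htail := ih (fun a => (f a).tail) (fun a => (hf a).tail) fun a => by
      rw [List.length_tail]
      exact Nat.sub_le_of_le_add (hN a)
    convert (Matrix.posSemidef_vecMulVec_star_self fun a => if f a = [] then (1 : ℂ) else 0).add
      (Matrix.posSemidef_sum Finset.univ fun i _ =>
        (hφ.posSemidef_of_mem _ fun a => headAt_mem i (hf a)).hadamard htail)
    ext a b
    rw [Matrix.of_apply, hφ.map_star_prod_mul_prod (hf a) (hf b)]
    simp [Matrix.vecMulVec_apply, Matrix.sum_apply, apply_ite]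

lemma apply_star_mul_self_nonneg [Finite ι] (hφ : IsFreeState φ A) (x : P) :
    0 ≤ φ (star x * x) := by
  have hx : x ∈ alternatingSpan φ A := hφ.alternatingSpan_eq_top ▸ Submodule.mem_top
  obtain ⟨m, c, g, rfl⟩ := Submodule.mem_span_set'.1 hx
  choose l hl hg using fun k => (g k).2
  have hpos := (hφ.posSemidef_of_length_le l hl fun k =>
    Finset.le_sup (f := fun k => (l k).length) (Finset.mem_univ k)).dotProduct_mulVec_nonneg c
  simp only [← hg, star_sum, star_smul, Finset.sum_mul, Finset.mul_sum, map_sum, smul_mul_assoc,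
    mul_smul_comm, map_smul, smul_eq_mul]
  simp only [dotProduct, Matrix.mulVec, Matrix.of_apply, Pi.star_apply, Finset.mul_sum] at hpos
  rw [Finset.sum_comm]
  refine hpos.trans_eq (Finset.sum_congr rfl fun a _ => Finset.sum_congr rfl fun b _ => ?_)
  ring

end IsFreeState
end FreeState

section GroupAlgebra

open MonoidAlgebra

/-- The linear form on a monoid algebra that extends a function on the monoid. -/
noncomputable def linearForm {G : Type*} (f : G → ℂ) : MonoidAlgebra ℂ G →ₗ[ℂ] ℂ :=
  Finsupp.linearCombination ℂ f ∘ₗ (coeffLinearEquiv ℂ).toLinearMap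

@[simp]
lemma linearForm_single {G : Type*} (f : G → ℂ) (g : G) (c : ℂ) :
    linearForm f (single g c) = c * f g := by
  simp [linearForm]

lemma map_single_eq_mul {G : Type*} (φ : MonoidAlgebra ℂ G →ₗ[ℂ] ℂ) (g : G) (c : ℂ) :
    φ (single g c) = c * φ (single g 1) := by
  rw [← smul_eq_mul, ← map_smul, smul_single, smul_eq_mul, mul_one]

variable {G H : Type*} [Group G] [Group H]

/-- The involution of a group algebra, which inverts the elements of the group and conjugates the
coefficients. -/
noncomputable instance : InvolutiveStar (MonoidAlgebra ℂ G) where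
  star x := mapDomain (·⁻¹) (MonoidAlgebra.map (starRingEnd ℂ : ℂ →+ ℂ) x)
  star_involutive x := by
    induction x using MonoidAlgebra.induction_linear with
    | zero => simp
    | add x y hx hy => simp only [MonoidAlgebra.map_add, mapDomain_add, hx, hy]
    | single g c => simp

lemma star_single (g : G) (c : ℂ) : star (single g c) = single g⁻¹ (star c) := by
  change mapDomain (·⁻¹) (MonoidAlgebra.map (starRingEnd ℂ : ℂ →+ ℂ) (single g c)) = _
  rw [map_single, mapDomain_single]
  rfl

noncomputable instance : StarAddMonoid (MonoidAlgebra ℂ G) where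
  star_add x y := by
    change mapDomain (·⁻¹) (MonoidAlgebra.map (starRingEnd ℂ : ℂ →+ ℂ) (x + y)) = _
    rw [MonoidAlgebra.map_add, mapDomain_add]
    rfl

noncomputable instance : StarRing (MonoidAlgebra ℂ G) where
  star_add := star_add
  star_mul x y := by
    induction x using MonoidAlgebra.induction_linear with
    | zero => rw [zero_mul, star_zero, mul_zero]
    | add x z hx hz => rw [add_mul, star_add, star_add, mul_add, hx, hz]
    | single g c =>
      induction y using MonoidAlgebra.induction_linear with
      | zero => rw [mul_zero, star_zero, zero_mul]
      | add y z hy hz => rw [mul_add, star_add, star_add, add_mul, hy, hz]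
      | single h d =>
        rw [single_mul_single, star_single, star_single, star_single, single_mul_single,
          mul_inv_rev, star_mul]

instance : StarModule ℂ (MonoidAlgebra ℂ G) where
  star_smul r x := by
    induction x using MonoidAlgebra.induction_linear with
    | zero => rw [smul_zero, star_zero, smul_zero]
    | add x y hx hy => rw [smul_add, star_add, star_add, smul_add, hx, hy]
    | single g c =>
      rw [smul_single, star_single, star_single, smul_single, smul_eq_mul, smul_eq_mul, star_mul,
        mul_comm]

lemma single_mem_unitary (g : G) : single g (1 : ℂ) ∈ unitary (MonoidAlgebra ℂ G) := by
  rw [Unitary.mem_iff, star_single, single_mul_single, single_mul_single, star_one, one_mul,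
    inv_mul_cancel, mul_inv_cancel]
  exact ⟨rfl, rfl⟩

/-- The `*`-morphism of group algebras induced by a group morphism. -/
noncomputable def mapDomainStarAlgHom (f : H →* G) :
    MonoidAlgebra ℂ H →⋆ₐ[ℂ] MonoidAlgebra ℂ G where
  __ := mapDomainAlgHom ℂ ℂ f
  map_star' x := by
    change mapDomainAlgHom ℂ ℂ f (star x) = star (mapDomainAlgHom ℂ ℂ f x)
    induction x using MonoidAlgebra.induction_linear with
    | zero => simp only [star_zero, map_zero]
    | add x y hx hy => simp only [star_add, map_add, hx, hy]
    | single h c => simp [star_single]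

@[simp]
lemma mapDomainStarAlgHom_single (f : H →* G) (h : H) (c : ℂ) :
    mapDomainStarAlgHom f (single h c) = single (f h) c :=
  mapDomain_single

/-- The image of the group algebra of `H` in the group algebra of `G`. -/
noncomputable def groupSubalgebra (f : H →* G) : StarSubalgebra ℂ (MonoidAlgebra ℂ G) :=
  (mapDomainStarAlgHom f).range

lemma single_mem_groupSubalgebra (f : H →* G) (h : H) (c : ℂ) :
    single (f h) c ∈ groupSubalgebra f :=
  ⟨single h c, mapDomainStarAlgHom_single f h c⟩

/-- A central positive definite function on a group, with value `1` at the neutral element. -/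
structure IsTracialCharacter (χ : G → ℂ) : Prop where
  map_one : χ 1 = 1
  mul_comm : ∀ g h, χ (g * h) = χ (h * g)
  posSemidef : (Matrix.of fun g h => χ (g⁻¹ * h)).PosSemidef

namespace IsTracialCharacter

variable {χ : G → ℂ}

lemma map_inv (hχ : IsTracialCharacter χ) (g : G) : χ g⁻¹ = star (χ g) := by
  simpa using (hχ.posSemidef.1.apply g 1).symm

lemma linearForm_mul_comm (hχ : IsTracialCharacter χ) (x y : MonoidAlgebra ℂ G) :
    linearForm χ (x * y) = linearForm χ (y * x) := by
  induction x using MonoidAlgebra.induction_linear with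
  | zero => rw [zero_mul, mul_zero]
  | add x z hx hz => rw [add_mul, mul_add, map_add, map_add, hx, hz]
  | single g c =>
    induction y using MonoidAlgebra.induction_linear with
    | zero => rw [zero_mul, mul_zero]
    | add y z hy hz => rw [mul_add, add_mul, map_add, map_add, hy, hz]
    | single h d =>
      simp only [single_mul_single, linearForm_single, hχ.mul_comm g h, _root_.mul_comm c d]

lemma linearForm_star (hχ : IsTracialCharacter χ) (x : MonoidAlgebra ℂ G) :
    linearForm χ (star x) = star (linearForm χ x) := by
  induction x using MonoidAlgebra.induction_linear with
  | zero => simp only [star_zero, map_zero]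
  | add x y hx hy => simp only [star_add, map_add, hx, hy]
  | single g c => rw [star_single, linearForm_single, linearForm_single, hχ.map_inv, star_mul']

lemma linearForm_star_mul_self_nonneg (hχ : IsTracialCharacter χ) (x : MonoidAlgebra ℂ G) :
    0 ≤ linearForm χ (star x * x) := by
  refine (hχ.posSemidef.2 x.coeff).trans_eq ?_
  conv_rhs => rw [← sum_coeff_single x]
  simp only [Finsupp.sum, star_sum, Finset.sum_mul, Finset.mul_sum, map_sum, star_single,
    single_mul_single, linearForm_single, Matrix.of_apply]
  rw [Finset.sum_comm]
  exact Finset.sum_congr rfl fun _ _ => Finset.sum_congr rfl fun _ _ => by ring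

lemma prodMk {ψ : H → ℂ} (hχ : IsTracialCharacter χ) (hψ : IsTracialCharacter ψ) :
    IsTracialCharacter fun g : G × H => χ g.1 * ψ g.2 where
  map_one := by simp only [Prod.fst_one, Prod.snd_one, hχ.map_one, hψ.map_one, mul_one]
  mul_comm g h := by
    simp only [Prod.fst_mul, Prod.snd_mul, hχ.mul_comm g.1 h.1, hψ.mul_comm g.2 h.2]
  posSemidef := (hχ.posSemidef.submatrix Prod.fst).hadamard (hψ.posSemidef.submatrix Prod.snd)

lemma comp {χ : G → ℂ} (hχ : IsTracialCharacter χ) (f : H →* G) : IsTracialCharacter (χ ∘ f) where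
  map_one := by rw [Function.comp_apply, _root_.map_one, hχ.map_one]
  mul_comm g h := by simp only [Function.comp_apply, map_mul, hχ.mul_comm (f g)]
  posSemidef := by simpa [Matrix.submatrix] using hχ.posSemidef.submatrix f

end IsTracialCharacter

section Restriction

variable {χ : H → ℂ} {f : H →* G} {φ : MonoidAlgebra ℂ G →ₗ[ℂ] ℂ}

lemma map_mapDomainStarAlgHom (hφ : ∀ h, φ (single (f h) 1) = χ h) (x : MonoidAlgebra ℂ H) :
    φ (mapDomainStarAlgHom f x) = linearForm χ x := by
  induction x using MonoidAlgebra.induction_linear with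
  | zero => simp only [map_zero]
  | add x y hx hy => simp only [map_add, hx, hy]
  | single h c =>
    rw [mapDomainStarAlgHom_single, map_single_eq_mul, hφ, linearForm_single]

lemma IsTracialCharacter.map_mul_comm (hχ : IsTracialCharacter χ)
    (hφ : ∀ h, φ (single (f h) 1) = χ h) {x y : MonoidAlgebra ℂ G} (hx : x ∈ groupSubalgebra f)
    (hy : y ∈ groupSubalgebra f) : φ (x * y) = φ (y * x) := by
  obtain ⟨x, rfl⟩ := hx
  obtain ⟨y, rfl⟩ := hy
  change φ (mapDomainStarAlgHom f x * mapDomainStarAlgHom f y) =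
    φ (mapDomainStarAlgHom f y * mapDomainStarAlgHom f x)
  rw [← map_mul, ← map_mul, map_mapDomainStarAlgHom hφ, map_mapDomainStarAlgHom hφ,
    hχ.linearForm_mul_comm]

lemma IsTracialCharacter.map_star (hχ : IsTracialCharacter χ)
    (hφ : ∀ h, φ (single (f h) 1) = χ h) {x : MonoidAlgebra ℂ G} (hx : x ∈ groupSubalgebra f) :
    φ (star x) = star (φ x) := by
  obtain ⟨x, rfl⟩ := hx
  change φ (star (mapDomainStarAlgHom f x)) = star (φ (mapDomainStarAlgHom f x))
  rw [← StarHomClass.map_star, map_mapDomainStarAlgHom hφ, map_mapDomainStarAlgHom hφ,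
    hχ.linearForm_star]

lemma IsTracialCharacter.map_star_mul_self_nonneg (hχ : IsTracialCharacter χ)
    (hφ : ∀ h, φ (single (f h) 1) = χ h) {x : MonoidAlgebra ℂ G} (hx : x ∈ groupSubalgebra f) :
    0 ≤ φ (star x * x) := by
  obtain ⟨x, rfl⟩ := hx
  change 0 ≤ φ (star (mapDomainStarAlgHom f x) * mapDomainStarAlgHom f x)
  rw [← StarHomClass.map_star, ← map_mul, map_mapDomainStarAlgHom hφ]
  exact hχ.linearForm_star_mul_self_nonneg x

end Restriction
end GroupAlgebra

section FreeProduct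

open MonoidAlgebra hiding of
open Monoid Monoid.CoprodI

namespace FreeProduct

variable {ι : Type*} {G : ι → Type*} [∀ i, Group (G i)] (χ : ∀ i, G i → ℂ)

/-- The product of the centered letters of a reduced word. -/
noncomputable def centeredProd (w : Word G) : MonoidAlgebra ℂ (CoprodI G) :=
  (w.toList.map fun p => single (of p.2) (1 : ℂ) - χ p.1 p.2 • 1).prod

lemma centeredProd_empty : centeredProd χ Word.empty = 1 := rfl

lemma centeredProd_cons {i : ι} (g : G i) (w : Word G) (hw : w.fstIdx ≠ some i) (hg : g ≠ 1) :
    centeredProd χ (Word.cons g w hw hg) = (single (of g) 1 - χ i g • 1) * centeredProd χ w := by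
  simp [centeredProd]

lemma adjoin_groupSubalgebra_of :
    Algebra.adjoin ℂ (⋃ i, (groupSubalgebra (of : G i →* CoprodI G) :
      Set (MonoidAlgebra ℂ (CoprodI G)))) = ⊤ := by
  refine Algebra.eq_top_iff.2 fun x => ?_
  induction x using MonoidAlgebra.induction_linear with
  | zero => exact zero_mem _
  | add x y hx hy => exact add_mem hx hy
  | single γ c =>
    induction γ using CoprodI.induction_on generalizing c with
    | one => exact Subalgebra.algebraMap_mem _ c
    | of i g =>
      exact Algebra.subset_adjoin (Set.mem_iUnion.2 ⟨i, single_mem_groupSubalgebra _ g c⟩)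
    | mul x y hx hy =>
      rw [← one_mul c, ← single_mul_single]
      exact mul_mem (hx 1) (hy c)

open Classical in
/-- The operator which removes the first letter `g` of a reduced word if it is in `G i`, with the
weight `χ i g`, and which maps the words beginning with another letter to `0`. -/
noncomputable def annihilation (i : ι) : Module.End ℂ (Word G →₀ ℂ) :=
  Finsupp.linearCombination ℂ fun w =>
    if (Word.equivPair i w).head = 1 then 0
    else Finsupp.single (Word.equivPair i w).tail (χ i (Word.equivPair i w).head)

lemma annihilation_single_of_fstIdx_ne {i : ι} {w : Word G} (hw : w.fstIdx ≠ some i) (c : ℂ) :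
    annihilation χ i (Finsupp.single w c) = 0 := by
  classical
  rw [annihilation, Finsupp.linearCombination_single, Word.equivPair_eq_of_fstIdx_ne hw,
    if_pos rfl, smul_zero]

lemma annihilation_single_cons {i : ι} {g : G i} {w : Word G} (hw : w.fstIdx ≠ some i)
    (hg : g ≠ 1) :
    annihilation χ i (Finsupp.single (Word.cons g w hw hg) 1) = χ i g • Finsupp.single w 1 := by
  classical
  have hpair : Word.equivPair i (Word.cons g w hw hg) = ⟨g, w, hw⟩ := by
    rw [Word.cons_eq_smul, Word.equivPair_smul_same, Word.equivPair_eq_of_fstIdx_ne hw, mul_one]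
  simp [annihilation, hpair, hg]

lemma annihilation_mul_self (i : ι) : annihilation χ i * annihilation χ i = 0 := by
  classical
  refine Finsupp.lhom_ext' fun w => LinearMap.ext_ring ?_
  change annihilation χ i (annihilation χ i (Finsupp.single w 1)) = 0
  conv_lhs => rw [annihilation, Finsupp.linearCombination_single, one_smul, ← annihilation]
  split_ifs
  · exact map_zero _
  · exact annihilation_single_of_fstIdx_ne χ (Word.equivPair i w).fstIdx_ne _

/-- The unipotent operator `exp (a N)`, where `N` is the annihilation operator. -/
noncomputable def unipotent (i : ι) (a : ℂ) : Module.End ℂ (Word G →₀ ℂ) :=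
  1 + a • annihilation χ i

lemma unipotent_mul_unipotent (i : ι) (a b : ℂ) :
    unipotent χ i a * unipotent χ i b = unipotent χ i (a + b) := by
  simp only [unipotent, add_mul, mul_add, one_mul, mul_one, smul_mul_smul_comm,
    annihilation_mul_self, smul_zero, zero_add, add_smul, add_assoc, add_comm (b • _)]

lemma unipotent_zero (i : ι) : unipotent χ i 0 = 1 := by
  rw [unipotent, zero_smul, add_zero]

lemma unipotent_single_of_fstIdx_ne {i : ι} {w : Word G} (hw : w.fstIdx ≠ some i) (a : ℂ) :
    unipotent χ i a (Finsupp.single w 1) = Finsupp.single w 1 := by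
  rw [unipotent, LinearMap.add_apply, LinearMap.smul_apply,
    annihilation_single_of_fstIdx_ne χ hw, smul_zero, add_zero, Module.End.one_apply]

open Classical in
variable (G) in
/-- The action of the free product on the span of its reduced words by multiplication. -/
noncomputable def wordRep : CoprodI G →* Module.End ℂ (Word G →₀ ℂ) where
  toFun γ := Finsupp.lmapDomain ℂ ℂ (γ • ·)
  map_one' := by simp only [one_smul]; exact Finsupp.lmapDomain_id ℂ ℂ
  map_mul' γ δ := by simp only [mul_smul]; exact Finsupp.lmapDomain_comp ℂ ℂ (δ • ·) (γ • ·)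

lemma wordRep_of_single {i : ι} {g : G i} {w : Word G} (hw : w.fstIdx ≠ some i) (hg : g ≠ 1) :
    wordRep G (of g) (Finsupp.single w 1) = Finsupp.single (Word.cons g w hw hg) 1 := by
  classical
  rw [Word.cons_eq_smul]
  exact Finsupp.mapDomain_single

/-- The action of `G i` on the span of the reduced words which is conjugate, by the unipotent
operator `unipotent χ i 1`, to the action by multiplication. The conjugation makes `g - χ i g`, for
`g ≠ 1`, act on the words not beginning in `G i` by adding the letter `g`. -/
noncomputable def centeredAction (i : ι) : G i →* Module.End ℂ (Word G →₀ ℂ) where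
  toFun g := unipotent χ i 1 * wordRep G (of g) * unipotent χ i (-1)
  map_one' := by
    rw [map_one, map_one, mul_one, unipotent_mul_unipotent, add_neg_cancel, unipotent_zero]
  map_mul' g h := by
    have hcancel :
        unipotent χ i (-1) * (unipotent χ i 1 * (wordRep G (of h) * unipotent χ i (-1))) =
        wordRep G (of h) * unipotent χ i (-1) := by
      rw [← mul_assoc, unipotent_mul_unipotent, neg_add_cancel, unipotent_zero, one_mul]
    simp only [map_mul, mul_assoc, hcancel]

/-- The representation of the free product which extends the actions of the factors. -/
noncomputable def centeredRep :
    MonoidAlgebra ℂ (CoprodI G) →ₐ[ℂ] Module.End ℂ (Word G →₀ ℂ) :=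
  MonoidAlgebra.lift ℂ _ _ (CoprodI.lift (centeredAction χ))

lemma centeredRep_sub_smul_one_single {i : ι} {g : G i} {w : Word G} (hw : w.fstIdx ≠ some i)
    (hg : g ≠ 1) :
    centeredRep χ (single (of g) 1 - χ i g • 1) (Finsupp.single w 1) =
      Finsupp.single (Word.cons g w hw hg) 1 := by
  have hof : centeredRep χ (single (of g) 1) = centeredAction χ i g := by simp [centeredRep]
  rw [map_sub, map_smul, map_one, hof, LinearMap.sub_apply, sub_eq_iff_eq_add]
  change unipotent χ i 1 (wordRep G (of g) (unipotent χ i (-1) _)) = _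
  rw [unipotent_single_of_fstIdx_ne χ hw, wordRep_of_single hw hg, unipotent, one_smul,
    LinearMap.add_apply, annihilation_single_cons]
  rfl

lemma centeredRep_centeredProd (w : Word G) :
    centeredRep χ (centeredProd χ w) (Finsupp.single Word.empty 1) = Finsupp.single w 1 := by
  induction w using Word.consRecOn with
  | empty => rw [centeredProd_empty, map_one, Module.End.one_apply]
  | cons i g w hw hg ih =>
    rw [centeredProd_cons, map_mul, Module.End.mul_apply, ih, centeredRep_sub_smul_one_single]

/-- The free product of the linear forms on the group algebras which extend the functions `χ i`,
that is, the vacuum state of the representation `centeredRep χ`. -/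
noncomputable def freeProductForm : MonoidAlgebra ℂ (CoprodI G) →ₗ[ℂ] ℂ :=
  Finsupp.lapply Word.empty ∘ₗ LinearMap.applyₗ (Finsupp.single Word.empty 1) ∘ₗ
    (centeredRep χ).toLinearMap

lemma freeProductForm_centeredProd {w : Word G} (hw : w ≠ Word.empty) :
    freeProductForm χ (centeredProd χ w) = 0 := by
  change centeredRep χ (centeredProd χ w) (Finsupp.single Word.empty 1) Word.empty = 0
  rw [centeredRep_centeredProd, Finsupp.single_eq_of_ne hw.symm]

lemma freeProductForm_one : freeProductForm χ 1 = 1 := by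
  change centeredRep χ 1 (Finsupp.single Word.empty 1) Word.empty = 1
  rw [map_one, Module.End.one_apply, Finsupp.single_eq_same]

variable {χ}

lemma freeProductForm_single_of (hχ : ∀ i, χ i 1 = 1) {i : ι} (g : G i) :
    freeProductForm χ (single (of g) 1) = χ i g := by
  by_cases hg : g = 1
  · rw [hg, map_one, ← MonoidAlgebra.one_def, freeProductForm_one, hχ]
  · have hcentered := freeProductForm_centeredProd χ
      (w := Word.cons g Word.empty (by simp [Word.fstIdx]) hg)
      fun h => by simpa using congr_arg Word.toList h
    rwa [centeredProd_cons, centeredProd_empty, mul_one, map_sub, map_smul, freeProductForm_one,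
      smul_eq_mul, mul_one, sub_eq_zero] at hcentered

lemma sub_smul_one_mem_span (hχ : ∀ i, χ i 1 = 1) {i : ι} {x : MonoidAlgebra ℂ (CoprodI G)}
    (hx : x ∈ groupSubalgebra (of : G i →* CoprodI G)) :
    x - freeProductForm χ x • 1 ∈ Submodule.span ℂ
      {y | ∃ g : G i, g ≠ 1 ∧ y = single (of g) (1 : ℂ) - χ i g • 1} := by
  obtain ⟨x, rfl⟩ := hx
  change mapDomainStarAlgHom of x - freeProductForm χ (mapDomainStarAlgHom of x) • 1 ∈ _
  rw [map_mapDomainStarAlgHom (freeProductForm_single_of hχ)]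
  induction x using MonoidAlgebra.induction_linear with
  | zero => simp
  | add x y hx hy =>
    rw [map_add, map_add, add_smul, ← sub_add_sub_comm]
    exact add_mem hx hy
  | single g c =>
    rw [mapDomainStarAlgHom_single, linearForm_single, mul_smul, ← mul_one c, ← smul_eq_mul,
      ← smul_single, smul_eq_mul, mul_one, ← smul_sub]
    refine Submodule.smul_mem _ _ ?_
    by_cases hg : g = 1
    · rw [hg, hχ, one_smul, map_one, ← MonoidAlgebra.one_def, sub_self]
      exact zero_mem _
    · exact Submodule.subset_span ⟨g, hg, rfl⟩

lemma prod_mem_span_centeredProd (hχ : ∀ i, χ i 1 = 1) {l : List (ι × MonoidAlgebra ℂ (CoprodI G))}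
    (hl : IsAlternating (freeProductForm χ)
      (fun i => groupSubalgebra (of : G i →* CoprodI G)) l) :
    (l.map Prod.snd).prod ∈ Submodule.span ℂ
      {x | ∃ w : Word G, w.toList.map Sigma.fst = l.map Prod.fst ∧ x = centeredProd χ w} := by
  induction l with
  | nil => exact Submodule.subset_span ⟨Word.empty, rfl, rfl⟩
  | cons p l ih =>
    obtain ⟨i, x⟩ := p
    have hx := sub_smul_one_mem_span hχ hl.mem_head
    rw [(hl.2 _ List.mem_cons_self).2, zero_smul, sub_zero] at hx
    have hmul := Submodule.mul_mem_mul hx (ih hl.of_cons)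
    rw [Submodule.span_mul_span] at hmul
    refine Submodule.span_mono ?_ hmul
    rintro _ ⟨_, ⟨g, hg, rfl⟩, _, ⟨w, hw, rfl⟩, rfl⟩
    have hfst : w.fstIdx ≠ some i := fun h => by
      rw [Word.fstIdx, ← List.head?_map, hw, List.head?_map] at h
      obtain ⟨q, hq, hqi⟩ := Option.map_eq_some_iff.1 h
      exact hl.ne_of_mem_head? q hq hqi.symm
    exact ⟨Word.cons g w hfst hg, by simp [hw], (centeredProd_cons χ g w hfst hg).symm⟩

lemma freeProductForm_prod_eq_zero (hχ : ∀ i, χ i 1 = 1)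
    {l : List (ι × MonoidAlgebra ℂ (CoprodI G))}
    (hl : IsAlternating (freeProductForm χ) (fun i => groupSubalgebra (of : G i →* CoprodI G)) l)
    (hne : l ≠ []) : freeProductForm χ (l.map Prod.snd).prod = 0 := by
  refine (Submodule.span_le (p := LinearMap.ker (freeProductForm χ))).2 ?_
    (prod_mem_span_centeredProd hχ hl)
  rintro _ ⟨w, hw, rfl⟩
  refine freeProductForm_centeredProd χ fun hempty => hne ?_
  rw [hempty] at hw
  exact List.map_eq_nil_iff.1 hw.symm

theorem isFreeState_freeProductForm (hχ : ∀ i, IsTracialCharacter (χ i)) :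
    IsFreeState (freeProductForm χ) fun i => groupSubalgebra (of : G i →* CoprodI G) :=
  have hof (i : ι) := freeProductForm_single_of (fun i => (hχ i).map_one) (i := i)
  { map_one := freeProductForm_one χ
    map_prod := fun _ => freeProductForm_prod_eq_zero fun i => (hχ i).map_one
    generates := adjoin_groupSubalgebra_of
    mul_comm := fun i _ hx _ hy => (hχ i).map_mul_comm (hof i) hx hy
    map_star := fun i _ hx => (hχ i).map_star (hof i) hx
    nonneg := fun i _ hx => (hχ i).map_star_mul_self_nonneg (hof i) hx }

end FreeProduct
end FreeProduct

section LagrangeInversion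

open PowerSeries Finset

lemma coeff_subst_mul {R : Type*} [CommRing R] {g : R⟦X⟧} (hg : constantCoeff g = 0) (h u : R⟦X⟧)
    {n N : ℕ} (hn : n < N) :
    coeff n (h.subst g * u) = ∑ k ∈ range N, coeff k h * coeff n (g ^ k * u) := by
  have hs : HasSubst g := HasSubst.of_constantCoeff_zero' hg
  have hsubst : h.subst g = g ^ N * (mk fun i => coeff (i + N) h).subst g +
      ∑ k ∈ range N, coeff k h • g ^ k := by
    conv_lhs => rw [eq_X_pow_mul_shift_add_trunc N h]
    rw [subst_add hs, subst_mul hs, subst_pow hs, subst_X hs, subst_coe hs, trunc_apply,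
      range_eq_Ico, map_sum]
    simp [Polynomial.aeval_monomial, Algebra.smul_def]
  have hdvd : X ^ N ∣ g ^ N * (mk fun i => coeff (i + N) h).subst g * u :=
    ((pow_dvd_pow_of_dvd (X_dvd_iff.2 hg) N).mul_right _).mul_right _
  rw [hsubst, add_mul, map_add, X_pow_dvd_iff.1 hdvd n hn, zero_add, sum_mul, map_sum]
  simp only [smul_mul_assoc, coeff_smul, smul_eq_mul]

lemma derivative_mul_add_mul_derivative {R : Type*} [CommRing R] {f g : R⟦X⟧} (hgf : g * f = X) :
    d⁄dX R g * f + g * d⁄dX R f = 1 := by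
  have hderiv := congr_arg (d⁄dX R) hgf
  rw [Derivation.leibniz, derivative_X, smul_eq_mul, smul_eq_mul] at hderiv
  linear_combination hderiv

variable {K : Type*} [Field K] [CharZero K] {f g : K⟦X⟧}

lemma coeff_pow_mul_derivative (f : K⟦X⟧) (r : ℕ) :
    coeff r (f ^ r * d⁄dX K f) = coeff (r + 1) (f ^ (r + 1)) := by
  have hderiv : d⁄dX K (f ^ (r + 1)) = (r + 1 : K) • (f ^ r * d⁄dX K f) := by
    rw [derivative_pow, Nat.add_sub_cancel, mul_assoc, ← nsmul_eq_mul, ← Nat.cast_smul_eq_nsmul K,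
      Nat.cast_succ]
  have hcoeff := coeff_derivative (f ^ (r + 1)) r
  rw [hderiv, coeff_smul, smul_eq_mul, mul_comm] at hcoeff
  exact mul_right_cancel₀ r.cast_add_one_ne_zero hcoeff

lemma coeff_pow_mul_derivative_mul_pow (hgf : g * f = X) (hg : constantCoeff g = 0) {k n : ℕ}
    (hk : k ≤ n) :
    coeff n (g ^ k * (d⁄dX K g * f ^ (n + 1))) = if k = n then 1 else 0 := by
  have hderiv := derivative_mul_add_mul_derivative hgf
  obtain ⟨r, rfl⟩ := Nat.exists_eq_add_of_le' hk
  cases r with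
  | zero =>
    have hterm : g ^ k * (d⁄dX K g * f ^ (k + 1)) = X ^ k * (1 - g * d⁄dX K f) := by
      rw [← hgf, mul_pow]
      linear_combination g ^ k * f ^ k * hderiv
    rw [zero_add, hterm, coeff_X_pow_mul', if_pos le_rfl, if_pos rfl, Nat.sub_self,
      coeff_zero_eq_constantCoeff_apply, map_sub, map_mul, hg, zero_mul, map_one, sub_zero]
  | succ r =>
    have hterm : g ^ k * (d⁄dX K g * f ^ (r + 1 + k + 1)) =
        X ^ k * (f ^ (r + 1) - X * (f ^ r * d⁄dX K f)) := by
      rw [← hgf, mul_pow]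
      linear_combination g ^ k * f ^ (k + r + 1) * hderiv
    rw [hterm, coeff_X_pow_mul, map_sub, coeff_succ_X_mul, coeff_pow_mul_derivative, sub_self,
      if_neg (by omega)]

/-- Lagrange inversion: if `g = X / f` is the compositional inverse of `ψ`, the coefficient of
`X ^ n` in `f ^ (n + 1) = (ψ' ∘ g) * (g' * f ^ (n + 1))` only involves that of `ψ'`. -/
theorem exists_eq_X_mul_subst (hf : constantCoeff f ≠ 0) :
    ∃ ψ : K⟦X⟧, constantCoeff ψ = 0 ∧ ψ = X * f.subst ψ ∧
      ∀ n : ℕ, (n + 1 : K) * coeff (n + 1) ψ = coeff n (f ^ (n + 1)) := by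
  obtain ⟨g, hg⟩ : ∃ g, g = X * f⁻¹ := ⟨_, rfl⟩
  have hgf : g * f = X := by rw [hg, mul_assoc, PowerSeries.inv_mul_cancel f hf, mul_one]
  have hg0 : constantCoeff g = 0 := by simp [hg]
  have hg1 : IsUnit (coeff 1 g) := by
    rw [hg, ← zero_add 1, coeff_succ_X_mul, coeff_zero_eq_constantCoeff_apply, constantCoeff_inv]
    exact (isUnit_iff_ne_zero.2 hf).inv
  obtain ⟨ψ, hψ⟩ : ∃ ψ, ψ = g.substInvOfIsUnit hg1 := ⟨_, rfl⟩
  have hψ0 : constantCoeff ψ = 0 := hψ ▸ constantCoeff_substInvOfIsUnit g hg1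
  have hψs : HasSubst ψ := HasSubst.of_constantCoeff_zero' hψ0
  have hgψ : g.subst ψ = X := hψ ▸ subst_substInvOfIsUnit_right g hg0 hg1
  have hψg : ψ.subst g = X := hψ ▸ subst_substInvOfIsUnit_left g hg0 hg1
  refine ⟨ψ, hψ0, ?_, fun n => ?_⟩
  · rw [← hgψ, ← subst_mul hψs, hgf, subst_X hψs]
  · have hchain : (d⁄dX K ψ).subst g * d⁄dX K g = 1 := by
      rw [← derivative_subst (HasSubst.of_constantCoeff_zero' hg0), hψg, derivative_X]
    rw [← one_mul (f ^ (n + 1)), ← hchain, mul_assoc, coeff_subst_mul hg0 _ _ n.lt_succ_self,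
      sum_congr rfl fun k hk => by
        rw [coeff_pow_mul_derivative_mul_pow hgf hg0 (mem_range_succ_iff.1 hk)],
      sum_eq_single n (fun k _ hk => by rw [if_neg hk, mul_zero])
        (fun hn => absurd (self_mem_range_succ n) hn),
      if_pos rfl, mul_one, coeff_derivative, mul_comm]

/-- The Taylor series of `z ↦ exp (-s (1 / 2 + z))`. -/
noncomputable def expNegSeries (s : ℝ) : ℝ⟦X⟧ := C (Real.exp (-(s / 2))) * rescale (-s) (exp ℝ)

/-- The series `f` such that the generating series `ψ` of the moments of the free unitary Brownian
motion at time `s` solves `ψ = X * f(ψ)`. -/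
noncomputable def fubmSeries (s : ℝ) : ℝ⟦X⟧ := expNegSeries s * (1 + X)

lemma coeff_expNegSeries (s : ℝ) (n : ℕ) :
    coeff n (expNegSeries s) = Real.exp (-(s / 2)) * ((-s) ^ n / n.factorial) := by
  rw [expNegSeries, coeff_C_mul, coeff_rescale, coeff_exp]
  simp [div_eq_mul_inv]

lemma constantCoeff_fubmSeries (s : ℝ) : constantCoeff (fubmSeries s) = Real.exp (-(s / 2)) := by
  rw [fubmSeries, map_mul, ← coeff_zero_eq_constantCoeff_apply, coeff_expNegSeries]
  simp

lemma fubmSeries_pow (s : ℝ) (n : ℕ) :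
    fubmSeries s ^ n = C (Real.exp (-(n * s / 2))) *
      (rescale (-s * n) (exp ℝ) * ((1 + Polynomial.X) ^ n : Polynomial ℝ)) := by
  rw [fubmSeries, expNegSeries, mul_pow, mul_pow, ← map_pow, ← map_pow, exp_pow_eq_rescale_exp,
    rescale_rescale, ← Real.exp_nat_mul, mul_assoc, mul_comm (n : ℝ) (-s)]
  simp only [Polynomial.coe_pow, Polynomial.coe_add, Polynomial.coe_one, Polynomial.coe_X]
  rw [show (n : ℝ) * -(s / 2) = -(n * s / 2) by ring]

lemma coeff_fubmSeries_pow {t : ℝ≥0∞} (ht : t ≠ ⊤) (n : ℕ) :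
    coeff n (fubmSeries t.toReal ^ (n + 1)) = (n + 1 : ℝ) * fubmMoment t (n + 1) := by
  rw [fubmSeries_pow, coeff_C_mul, coeff_mul, Nat.sum_antidiagonal_eq_sum_range_succ_mk, fubmMoment,
    if_neg n.succ_ne_zero, if_neg ht, mul_left_comm, mul_sum _ _ (n + 1 : ℝ)]
  refine congr_arg₂ _ rfl (sum_congr rfl fun j hj => ?_)
  rw [mem_range] at hj
  rw [coeff_rescale, coeff_exp, Polynomial.coeff_coe, Polynomial.coeff_one_add_X_pow,
    zpow_sub_one₀ (by positivity), zpow_natCast,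
    Nat.choose_symm_of_eq_add (show n + 1 = (n - j) + (j + 1) by omega), mul_pow]
  push_cast
  field_simp

lemma exists_momentSeries {t : ℝ≥0∞} (ht : t ≠ ⊤) :
    ∃ ψ : ℝ⟦X⟧, constantCoeff ψ = 0 ∧ ψ = X * (fubmSeries t.toReal).subst ψ ∧
      ∀ n : ℕ, coeff (n + 1) ψ = fubmMoment t (n + 1) := by
  obtain ⟨ψ, hψ0, hψ, hcoeff⟩ := exists_eq_X_mul_subst (f := fubmSeries t.toReal) <| by
    rw [constantCoeff_fubmSeries]
    exact (Real.exp_pos _).ne'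
  refine ⟨ψ, hψ0, hψ, fun n => mul_left_cancel₀ (n.cast_add_one_ne_zero (R := ℝ)) ?_⟩
  rw [hcoeff, coeff_fubmSeries_pow ht]

end LagrangeInversion

section Contraction

open PowerSeries Finset

/-- The Euclidean scalar product of the truncations of two power series at order `N`. -/
noncomputable def truncInner (N : ℕ) (a b : ℝ⟦X⟧) : ℝ := ∑ n ∈ range N, coeff n a * coeff n b

lemma truncInner_succ (N : ℕ) (a b : ℝ⟦X⟧) :
    truncInner (N + 1) a b = truncInner N a b + coeff N a * coeff N b :=
  sum_range_succ _ _

lemma truncInner_X_mul (N : ℕ) (a b : ℝ⟦X⟧) :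
    truncInner (N + 1) (X * a) (X * b) = truncInner N a b := by
  simp [truncInner, sum_range_succ', coeff_succ_X_mul]

lemma truncInner_self_le_succ (N : ℕ) (a : ℝ⟦X⟧) :
    truncInner N a a ≤ truncInner (N + 1) a a := by
  rw [truncInner_succ]
  exact le_add_of_nonneg_right (mul_self_nonneg _)

lemma truncInner_add_sub (N : ℕ) (a b : ℝ⟦X⟧) :
    truncInner N (a + b) (a - b) = truncInner N a a - truncInner N b b := by
  rw [truncInner, truncInner, truncInner, ← sum_sub_distrib]
  exact sum_congr rfl fun n _ => by rw [map_add, map_sub]; ring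

lemma expNegSeries_zero : expNegSeries 0 = 1 := by
  ext n
  rw [coeff_expNegSeries, coeff_one]
  cases n <;> simp

lemma hasDerivAt_coeff_expNegSeries (n : ℕ) (s : ℝ) :
    HasDerivAt (fun s => coeff n (expNegSeries s))
      (-(1 / 2) * coeff n ((1 + 2 * X) * expNegSeries s)) s := by
  simp only [coeff_expNegSeries]
  have hexp : HasDerivAt (fun s : ℝ => Real.exp (-(s / 2))) (Real.exp (-(s / 2)) * -(1 / 2)) s :=
    ((hasDerivAt_id s).div_const 2).neg.exp
  rw [add_mul, one_mul, mul_assoc, two_mul, map_add, map_add]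
  cases n with
  | zero =>
    simp only [pow_zero]
    refine (hexp.mul_const _).congr_deriv ?_
    rw [coeff_expNegSeries, coeff_zero_X_mul]
    ring
  | succ n =>
    have hpow : HasDerivAt (fun s : ℝ => (-s) ^ (n + 1) / ((n + 1).factorial : ℝ))
        (-((-s) ^ n / n.factorial)) s := by
      refine ((((hasDerivAt_id s).neg).pow (n + 1)).div_const _).congr_deriv ?_
      rw [Nat.factorial_succ]
      push_cast
      field_simp
      simp
    refine (hexp.mul hpow).congr_deriv ?_
    simp only [coeff_expNegSeries, coeff_succ_X_mul]
    ring

lemma hasDerivAt_coeff_expNegSeries_subst_mul {ψ : ℝ⟦X⟧} (hψ : constantCoeff ψ = 0) (ξ : ℝ⟦X⟧)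
    (n : ℕ) (s : ℝ) :
    HasDerivAt (fun s => coeff n ((expNegSeries s).subst ψ * ξ))
      (-(1 / 2) * coeff n ((1 + 2 * ψ) * ((expNegSeries s).subst ψ * ξ))) s := by
  have hsubst : (1 + 2 * ψ) * (expNegSeries s).subst ψ =
      ((1 + 2 * X) * expNegSeries s).subst ψ := by
    rw [← coe_substAlgHom (HasSubst.of_constantCoeff_zero' hψ), map_mul, map_add, map_mul, map_one,
      map_ofNat, substAlgHom_X]
  simp only [← mul_assoc, hsubst, coeff_subst_mul hψ _ _ n.lt_succ_self]
  rw [mul_sum]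
  exact HasDerivAt.fun_sum fun k _ =>
    ((hasDerivAt_coeff_expNegSeries k s).mul_const _).congr_deriv (mul_assoc _ _ _)

/-- The semigroup `s ↦ exp (-s (1 / 2 + ψ))` is contracting because its generator is dissipative. -/
lemma truncInner_expNegSeries_subst_mul_le {N : ℕ} {ψ : ℝ⟦X⟧} (hψ : constantCoeff ψ = 0)
    (haccr : ∀ ξ, 0 ≤ truncInner N ((1 + 2 * ψ) * ξ) ξ) {s : ℝ} (hs : 0 ≤ s) (ξ : ℝ⟦X⟧) :
    truncInner N ((expNegSeries s).subst ψ * ξ) ((expNegSeries s).subst ψ * ξ) ≤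
      truncInner N ξ ξ := by
  obtain ⟨η, hη⟩ : ∃ η : ℝ → ℝ⟦X⟧, ∀ s, η s = (expNegSeries s).subst ψ * ξ := ⟨_, fun _ => rfl⟩
  have hderiv (s : ℝ) : HasDerivAt (fun s => truncInner N (η s) (η s))
      (-truncInner N ((1 + 2 * ψ) * η s) (η s)) s := by
    have hcoeff (n : ℕ) : HasDerivAt (fun s => coeff n (η s))
        (-(1 / 2) * coeff n ((1 + 2 * ψ) * η s)) s := by
      simpa only [hη] using hasDerivAt_coeff_expNegSeries_subst_mul hψ ξ n s
    refine (HasDerivAt.fun_sum fun n _ => (hcoeff n).mul (hcoeff n)).congr_deriv ?_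
    rw [truncInner, ← sum_neg_distrib]
    exact sum_congr rfl fun n _ => by ring
  have hanti : Antitone fun s => truncInner N (η s) (η s) :=
    antitone_of_hasDerivAt_nonpos hderiv fun s => neg_nonpos.2 (haccr (η s))
  have hzero : η 0 = ξ := by
    rw [hη, expNegSeries_zero, ← coe_substAlgHom (HasSubst.of_constantCoeff_zero' hψ), map_one,
      one_mul]
  have hle := hanti hs
  simp only [hzero] at hle
  rwa [hη] at hle

/-- With `η = (1 + ψ) ξ` and `κ = ψ ξ`, the functional equation of `ψ` expresses `κ` as the image
of `η` by the contraction of the previous lemma and a shift, so that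
`⟨(1 + 2 ψ) ξ, ξ⟩ = ⟨η + κ, η - κ⟩ = ‖η‖ ^ 2 - ‖κ‖ ^ 2` is nonnegative. The shift allows the
induction on the order of truncation. -/
lemma truncInner_nonneg_of_eq_X_mul_subst {ψ : ℝ⟦X⟧} (hψ : constantCoeff ψ = 0) {s : ℝ}
    (hs : 0 ≤ s) (heq : ψ = X * (fubmSeries s).subst ψ) (N : ℕ) (ξ : ℝ⟦X⟧) :
    0 ≤ truncInner N ((1 + 2 * ψ) * ξ) ξ := by
  induction N generalizing ξ with
  | zero => exact sum_range_zero _ |>.ge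
  | succ N ih =>
    obtain ⟨η, hη⟩ : ∃ η, η = (1 + ψ) * ξ := ⟨_, rfl⟩
    have hκ : ψ * ξ = X * ((expNegSeries s).subst ψ * η) := by
      conv_lhs => rw [heq]
      rw [fubmSeries, ← coe_substAlgHom (HasSubst.of_constantCoeff_zero' hψ), map_mul, map_add,
        map_one, substAlgHom_X, hη]
      ring
    have hle : truncInner (N + 1) (ψ * ξ) (ψ * ξ) ≤ truncInner (N + 1) η η := by
      rw [hκ, truncInner_X_mul]
      exact (truncInner_expNegSeries_subst_mul_le hψ ih hs η).trans (truncInner_self_le_succ N η)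
    have hadd : (1 + 2 * ψ) * ξ = η + ψ * ξ := by rw [hη]; ring
    have hsub : ξ = η - ψ * ξ := by rw [hη]; ring
    calc 0 ≤ truncInner (N + 1) η η - truncInner (N + 1) (ψ * ξ) (ψ * ξ) := sub_nonneg.2 hle
      _ = truncInner (N + 1) ((1 + 2 * ψ) * ξ) ξ := by
        rw [← truncInner_add_sub, ← hadd, ← hsub]

lemma sum_toeplitz_eq_truncInner {m : ℕ → ℝ} (hm : m 0 = 1) {ψ : ℝ⟦X⟧}
    (hψ : constantCoeff ψ = 0) (hcoeff : ∀ n, coeff (n + 1) ψ = m (n + 1)) (ξ : ℝ⟦X⟧) (N : ℕ) :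
    ∑ i ∈ range N, ∑ j ∈ range N, coeff i ξ * m (Nat.dist i j) * coeff j ξ =
      truncInner N ((1 + 2 * ψ) * ξ) ξ := by
  induction N with
  | zero => simp [truncInner]
  | succ N ih =>
    have hcol : coeff N (ψ * ξ) = ∑ i ∈ range N, coeff i ξ * m (Nat.dist i N) := by
      rw [mul_comm, coeff_mul, Nat.sum_antidiagonal_eq_sum_range_succ_mk, sum_range_succ,
        Nat.sub_self, coeff_zero_eq_constantCoeff_apply, hψ, mul_zero, add_zero]
      refine sum_congr rfl fun i hi => ?_
      have hi := mem_range.1 hi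
      rw [Nat.dist_eq_sub_of_le hi.le, ← Nat.sub_add_cancel (Nat.sub_pos_of_lt hi), hcoeff]
    have hrow : ∑ j ∈ range N, coeff N ξ * m (Nat.dist N j) * coeff j ξ =
        coeff N (ψ * ξ) * coeff N ξ := by
      rw [hcol, sum_mul]
      exact sum_congr rfl fun j _ => by rw [Nat.dist_comm]; ring
    simp only [sum_range_succ, sum_add_distrib]
    rw [ih, hrow, ← sum_mul, ← hcol, truncInner_succ, add_mul, one_mul, mul_assoc, two_mul, map_add,
      map_add, Nat.dist_self, hm]
    ring

end Contraction

section PositiveDefinite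

open Finset Matrix

lemma posSemidef_map_ofReal {n : Type*} {A : Matrix n n ℝ} (hA : A.PosSemidef) :
    (A.map Complex.ofReal).PosSemidef := by
  have hsymm (i j : n) : A j i = A i j := by simpa using hA.1.apply i j
  refine ⟨?_, fun c => Complex.nonneg_iff.2 ⟨?_, ?_⟩⟩
  · ext i j
    simp [hsymm i j]
  · refine (add_nonneg (hA.2 (c.mapRange Complex.re rfl))
      (hA.2 (c.mapRange Complex.im rfl))).trans_eq ?_
    simp only [Finsupp.sum_mapRange_index, mul_zero, implies_true]
    rw [Finsupp.sum_mapRange_index (by simp [Finsupp.sum]),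
      Finsupp.sum_mapRange_index (by simp [Finsupp.sum])]
    simp only [Finsupp.sum, Complex.re_sum, ← sum_add_distrib]
    refine sum_congr rfl fun i _ => sum_congr rfl fun j _ => ?_
    simp
  · have hswap : ∑ i ∈ c.support, ∑ j ∈ c.support, (c i).im * A i j * (c j).re =
        ∑ i ∈ c.support, ∑ j ∈ c.support, (c i).re * A i j * (c j).im := by
      rw [sum_comm]
      exact sum_congr rfl fun i _ => sum_congr rfl fun j _ => by rw [hsymm]; ring
    rw [← sub_eq_zero] at hswap
    rw [← neg_zero, ← hswap]
    simp only [Finsupp.sum, Complex.im_sum, ← sum_sub_distrib, ← sum_neg_distrib]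
    refine sum_congr rfl fun i _ => sum_congr rfl fun j _ => ?_
    simp
    ring

lemma posSemidef_toeplitz_int {m : ℕ → ℝ} (hm : (of fun i j : ℕ => m (Nat.dist i j)).PosSemidef) :
    (of fun i j : ℤ => m (j - i).natAbs).PosSemidef := by
  refine ⟨?_, fun c => ?_⟩
  · ext i j
    simp [← Int.natAbs_neg (i - j)]
  · obtain ⟨a, ha⟩ : ∃ a : ℕ, ∀ i ∈ c.support, -(a : ℤ) ≤ i := by
      refine ⟨c.support.sup Int.natAbs, fun i hi => ?_⟩
      have := le_sup (f := Int.natAbs) hi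
      omega
    refine ((hm.submatrix fun i : ℤ => (i + a).toNat).2 c).trans_eq <|
      sum_congr rfl fun i hi => sum_congr rfl fun j hj => ?_
    have hdist : Nat.dist (i + a).toNat (j + a).toNat = (j - i).natAbs := by
      have := ha i hi
      have := ha j hj
      rw [Nat.dist]
      omega
    simp only [submatrix_apply, of_apply, hdist]

lemma posSemidef_fubmMoment_dist {t : ℝ≥0∞} (ht : t ≠ ⊤) :
    (of fun i j : ℕ => fubmMoment t (Nat.dist i j)).PosSemidef := by
  obtain ⟨ψ, hψ, heq, hcoeff⟩ := exists_momentSeries ht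
  refine ⟨?_, fun c => ?_⟩
  · ext i j
    simp [Nat.dist_comm]
  · obtain ⟨N, hN⟩ : ∃ N, c.support ⊆ range N := c.support.exists_nat_subset_range
    have hsum := sum_toeplitz_eq_truncInner (m := fubmMoment t) (by simp [fubmMoment]) hψ hcoeff
      (PowerSeries.mk c) N
    refine (truncInner_nonneg_of_eq_X_mul_subst hψ ENNReal.toReal_nonneg heq N
      (PowerSeries.mk c)).trans_eq ?_
    rw [← hsum, Finsupp.sum_of_support_subset _ hN _ (by simp)]
    refine sum_congr rfl fun i _ => ?_
    rw [Finsupp.sum_of_support_subset _ hN _ (by simp)]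
    simp

lemma isTracialCharacter_delta (G : Type*) [Group G] [DecidableEq G] :
    IsTracialCharacter fun g : G => if g = 1 then (1 : ℂ) else 0 where
  map_one := if_pos rfl
  mul_comm g h := by
    simp only [mul_eq_one_iff_eq_inv, mul_eq_one_iff_inv_eq (a := h), eq_comm]
  posSemidef := by
    convert PosSemidef.one (R := ℂ) (n := G) using 1
    ext g h
    simp only [of_apply, inv_mul_eq_one, one_apply]

lemma isTracialCharacter_fubmMoment (t : ℝ≥0∞) :
    IsTracialCharacter fun k : Multiplicative ℤ => (fubmMoment t k.toAdd.natAbs : ℂ) := by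
  by_cases ht : t = ⊤
  · convert isTracialCharacter_delta (Multiplicative ℤ) using 2 with k
    simp [fubmMoment, ht, apply_ite]
  · refine ⟨by simp [fubmMoment], fun g h => by rw [mul_comm], ?_⟩
    convert (posSemidef_map_ofReal (posSemidef_toeplitz_int
      (posSemidef_fubmMoment_dist ht))).submatrix Multiplicative.toAdd using 1
    ext g h
    simp [toAdd_mul, toAdd_inv, sub_eq_neg_add]

end PositiveDefinite

section Model

open MonoidAlgebra hiding of
open Monoid.CoprodI

namespace NCProbSpace

lemma Free.mono {M : NCProbSpace.{u}} {ι : Type*} {A B : ι → StarSubalgebra ℂ M} (h : M.Free B)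
    (hAB : ∀ i, A i ≤ B i) : M.Free A :=
  fun n hn i hi a ha => h n hn i hi a fun k => hAB _ (ha k)

lemma independent_pair {M : NCProbSpace.{u}} {A B : StarSubalgebra ℂ M}
    (hcomm : ∀ x ∈ A, ∀ y ∈ B, x * y = y * x)
    (hmul : ∀ x ∈ A, ∀ y ∈ B, M.φ (x * y) = M.φ x * M.φ y) : M.Independent ![A, B] := by
  refine ⟨fun i j hij x hx y hy => ?_, fun n hn i hi a ha ha0 => ?_⟩
  · fin_cases i <;> fin_cases j
    exacts [absurd rfl hij, hcomm x hx y hy, (hcomm y hy x hx).symm, absurd rfl hij]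
  · have hn2 : n ≤ 2 := by simpa using Fintype.card_le_of_injective i hi
    interval_cases n
    · simpa using ha0 0
    · have hmul_pair : ∀ k l : Fin 2, k ≠ l → ∀ x ∈ ![A, B] k, ∀ y ∈ ![A, B] l,
          M.φ (x * y) = M.φ x * M.φ y := by
        intro k l hkl x hx y hy
        fin_cases k <;> fin_cases l
        · exact absurd rfl hkl
        · exact hmul x hx y hy
        · rw [M.φ_mul_comm, hmul y hy x hx, mul_comm]
        · exact absurd rfl hkl
      have h01 := hmul_pair (i 0) (i 1) (hi.ne (by decide)) _ (ha 0) _ (ha 1)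
      simpa [ha0] using h01

lemma φ_conj (M : NCProbSpace.{u}) (v : unitary (M : Type u)) (x : M) :
    M.φ (Unitary.conjStarAlgAut ℂ M v x) = M.φ x := by
  rw [Unitary.conjStarAlgAut_apply, M.φ_mul_comm, ← mul_assoc, Unitary.coe_star_mul_self, one_mul]

theorem tFree_map_conj {M : NCProbSpace.{u}} {t : ℝ≥0∞} {A B : StarSubalgebra ℂ M}
    {v : unitary (M : Type u)} (hindep : M.Independent ![A, B]) (hv : M.IsFreeUnitaryBM t v)
    (hfree : M.Free ![A ⊔ B, StarAlgebra.adjoin ℂ {(v : M)}]) :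
    M.TFree t A (B.map (Unitary.conjStarAlgAut ℂ M v : M →⋆ₐ[ℂ] M)) := by
  let conj := Unitary.conjStarAlgAut ℂ M v
  let j := (conj.symm : M →⋆ₐ[ℂ] M).comp (B.map (conj : M →⋆ₐ[ℂ] M)).subtype
  have hj (b) : v * j b * star (v : M) = b := conj.apply_symm_apply b
  have hA : A.subtype.range = A := by
    ext x
    exact ⟨fun ⟨a, ha⟩ => ha ▸ a.2, fun hx => ⟨⟨x, hx⟩, rfl⟩⟩
  have hB : j.range = B := by
    ext x
    constructor
    · rintro ⟨⟨_, b, hb, rfl⟩, rfl⟩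
      exact (conj.symm_apply_apply b).symm ▸ hb
    · exact fun hx => ⟨⟨conj x, x, hx, rfl⟩, conj.symm_apply_apply x⟩
  refine ⟨M, A.subtype, j, v, ⟨fun _ => rfl, fun b => ?_, ?_, hv, ?_⟩, fun n a b => ?_⟩
  · rw [← M.φ_conj v, Unitary.conjStarAlgAut_apply, hj]
  · rwa [hA, hB]
  · rwa [hA, hB]
  · simp only [hj, StarSubalgebra.subtype_apply]

end NCProbSpace

namespace IsFreeState

variable {P : Type u} {ι : Type*} [Ring P] [StarRing P] [Algebra ℂ P] [StarModule ℂ P] [Finite ι]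
  {φ : P →ₗ[ℂ] ℂ} {A : ι → StarSubalgebra ℂ P}

/-- The non-commutative probability space defined by a free state. -/
abbrev ncProbSpace (h : IsFreeState φ A) : NCProbSpace.{u} where
  carrier := P
  φ := φ
  φ_one := h.map_one
  φ_mul_comm := h.apply_mul_comm
  φ_star := h.apply_star
  φ_nonneg x := by simpa only [star_star] using h.apply_star_mul_self_nonneg (star x)

lemma free (h : IsFreeState φ A) : h.ncProbSpace.Free A := by
  intro n hn i hi a ha ha0
  have halt : IsAlternating φ A (List.ofFn fun k => (i k, a k)) := by
    refine ⟨List.isChain_ofFn.2 fun k hk => hi _ _ rfl, fun p hp => ?_⟩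
    obtain ⟨k, rfl⟩ := (List.mem_ofFn' _ _).1 hp
    exact ⟨ha k, ha0 k⟩
  simpa [List.map_ofFn, Function.comp_def] using
    h.map_prod _ halt (List.ofFn_eq_nil_iff.not.2 (by omega))

end IsFreeState

section TensorProduct

variable {G H K : Type*} [Group G] [Group H] [Group K] {f : H × K →* G}

lemma groupSubalgebra_comp_le (f : H →* G) (f' : K →* H) :
    groupSubalgebra (f.comp f') ≤ groupSubalgebra f := by
  rintro _ ⟨x, rfl⟩
  refine ⟨mapDomainStarAlgHom f' x, ?_⟩
  induction x using MonoidAlgebra.induction_linear with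
  | zero => simp only [map_zero]
  | add x y hx hy => simp only [map_add, hx, hy]
  | single k c => simp

lemma mul_comm_of_mem_groupSubalgebra_prod {x y : MonoidAlgebra ℂ G}
    (hx : x ∈ groupSubalgebra (f.comp (MonoidHom.inl H K)))
    (hy : y ∈ groupSubalgebra (f.comp (MonoidHom.inr H K))) : x * y = y * x := by
  obtain ⟨x, rfl⟩ := hx
  obtain ⟨y, rfl⟩ := hy
  change mapDomainStarAlgHom _ x * mapDomainStarAlgHom _ y =
    mapDomainStarAlgHom _ y * mapDomainStarAlgHom _ x
  induction x using MonoidAlgebra.induction_linear with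
  | zero => simp only [map_zero, zero_mul, mul_zero]
  | add x z hx hz => simp only [map_add, add_mul, mul_add, hx, hz]
  | single h c =>
    induction y using MonoidAlgebra.induction_linear with
    | zero => simp only [map_zero, zero_mul, mul_zero]
    | add y z hy hz => simp only [map_add, add_mul, mul_add, hy, hz]
    | single k d => simp [single_mul_single, ← map_mul, mul_comm c]

lemma map_mul_of_mem_groupSubalgebra_prod {φ : MonoidAlgebra ℂ G →ₗ[ℂ] ℂ} {χ : H → ℂ} {ψ : K → ℂ}
    (hχ : χ 1 = 1) (hψ : ψ 1 = 1) (hφ : ∀ g, φ (single (f g) 1) = χ g.1 * ψ g.2)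
    {x y : MonoidAlgebra ℂ G} (hx : x ∈ groupSubalgebra (f.comp (MonoidHom.inl H K)))
    (hy : y ∈ groupSubalgebra (f.comp (MonoidHom.inr H K))) : φ (x * y) = φ x * φ y := by
  obtain ⟨x, rfl⟩ := hx
  obtain ⟨y, rfl⟩ := hy
  change φ (mapDomainStarAlgHom _ x * mapDomainStarAlgHom _ y) =
    φ (mapDomainStarAlgHom _ x) * φ (mapDomainStarAlgHom _ y)
  induction x using MonoidAlgebra.induction_linear with
  | zero => simp only [map_zero, zero_mul]
  | add x z hx hz => simp only [map_add, add_mul, hx, hz]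
  | single h c =>
    induction y using MonoidAlgebra.induction_linear with
    | zero => simp only [map_zero, mul_zero]
    | add y z hy hz => simp only [map_add, mul_add, hy, hz]
    | single k d =>
      simp only [mapDomainStarAlgHom_single, single_mul_single, MonoidHom.comp_apply, ← map_mul,
        map_single_eq_mul φ _ c, map_single_eq_mul φ _ d, map_single_eq_mul φ _ (c * d), hφ,
        MonoidHom.inl_apply, MonoidHom.inr_apply, Prod.mk_mul_mk, one_mul, mul_one, hχ, hψ]
      ring

end TensorProduct

namespace TFreeProduct

/-- The groups whose free product carries the `t`-free product of the group algebras of `H` and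
`K`: the group `H × K`, and the group `ℤ` generated by the free unitary Brownian motion. -/
def Factor (H K : Type u) : Fin 2 → Type u
  | 0 => H × K
  | 1 => ULift (Multiplicative ℤ)

variable {H K : Type u} [Group H] [Group K] {χ : H → ℂ} {ψ : K → ℂ}

instance : ∀ i, Group (Factor H K i)
  | 0 => inferInstanceAs (Group (H × K))
  | 1 => inferInstanceAs (Group (ULift (Multiplicative ℤ)))

/-- The characters of the factors of the `t`-free product: the product of the characters of `H`
and `K`, and the moments of the free unitary Brownian motion at time `t`. -/
noncomputable def character (t : ℝ≥0∞) (χ : H → ℂ) (ψ : K → ℂ) : ∀ i, Factor H K i → ℂ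
  | 0 => fun g : H × K => χ g.1 * ψ g.2
  | 1 => fun k : ULift (Multiplicative ℤ) => (fubmMoment t k.down.toAdd.natAbs : ℂ)

lemma isTracialCharacter_character (t : ℝ≥0∞) (hχ : IsTracialCharacter χ)
    (hψ : IsTracialCharacter ψ) : ∀ i, IsTracialCharacter (character t χ ψ i)
  | 0 => hχ.prodMk hψ
  | 1 => IsTracialCharacter.comp (isTracialCharacter_fubmMoment t)
      (MulEquiv.ulift : ULift.{u} (Multiplicative ℤ) ≃* _).toMonoidHom

/-- The inclusion of `H × K` in the free product. -/
def ofProd : H × K →* Monoid.CoprodI (Factor H K) := (of : Factor H K 0 →* _)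

/-- The inclusion of `ℤ` in the free product. -/
def ofInt : Multiplicative ℤ →* Monoid.CoprodI (Factor H K) :=
  (of : Factor H K 1 →* _).comp MulEquiv.ulift.symm.toMonoidHom

lemma freeProductForm_single_factor {t : ℝ≥0∞} (hχ : IsTracialCharacter χ)
    (hψ : IsTracialCharacter ψ) (i : Fin 2) (g : Factor H K i) :
    FreeProduct.freeProductForm (character t χ ψ) (single (of g) 1) = character t χ ψ i g :=
  FreeProduct.freeProductForm_single_of
    (fun i => (isTracialCharacter_character t hχ hψ i).map_one) g

lemma freeProductForm_single_ofProd (t : ℝ≥0∞) (hχ : IsTracialCharacter χ)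
    (hψ : IsTracialCharacter ψ) (g : H × K) :
    FreeProduct.freeProductForm (character t χ ψ) (single (ofProd g) 1) = χ g.1 * ψ g.2 :=
  freeProductForm_single_factor hχ hψ 0 g

lemma freeProductForm_single_ofInt (t : ℝ≥0∞) (hχ : IsTracialCharacter χ)
    (hψ : IsTracialCharacter ψ) (k : Multiplicative ℤ) :
    FreeProduct.freeProductForm (character t χ ψ) (single (ofInt k) 1) =
      fubmMoment t k.toAdd.natAbs :=
  freeProductForm_single_factor hχ hψ 1 (ULift.up k)

lemma groupSubalgebra_ofProd_comp_le {G : Type*} [Group G] (f : G →* H × K) :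
    groupSubalgebra (ofProd.comp f) ≤ groupSubalgebra (of : Factor H K 0 →* _) :=
  groupSubalgebra_comp_le (of : Factor H K 0 →* _) f

lemma single_ofInt_mem_groupSubalgebra (k : Multiplicative ℤ) :
    single (ofInt k) 1 ∈ groupSubalgebra (of : Factor H K 1 →* _) :=
  single_mem_groupSubalgebra (of : Factor H K 1 →* _) (ULift.up k) 1

lemma le_groupSubalgebra_of (i : Fin 2) :
    ![groupSubalgebra (ofProd.comp (MonoidHom.inl H K)) ⊔
        groupSubalgebra (ofProd.comp (MonoidHom.inr H K)),
      StarAlgebra.adjoin ℂ {single (ofInt (Multiplicative.ofAdd 1)) 1}] i ≤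
      groupSubalgebra (of : Factor H K i →* _) := by
  revert i
  exact Fin.forall_fin_two.2
    ⟨sup_le (groupSubalgebra_ofProd_comp_le _) (groupSubalgebra_ofProd_comp_le _),
      StarAlgebra.adjoin_le (Set.singleton_subset_iff.2 (single_ofInt_mem_groupSubalgebra _))⟩

end TFreeProduct

open TFreeProduct in
theorem exists_tFree_of_isTracialCharacter (t : ℝ≥0∞) {H K : Type u} [Group H] [Group K]
    {χ : H → ℂ} {ψ : K → ℂ} (hχ : IsTracialCharacter χ) (hψ : IsTracialCharacter ψ) :
    ∃ (M : NCProbSpace.{u}) (A B : StarSubalgebra ℂ M), M.TFree t A B ∧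
      (∀ h, ∃ a ∈ A, a ∈ unitary (M : Type u) ∧ ∀ k : ℕ, M.φ (a ^ k) = χ (h ^ k)) ∧
      ∀ h, ∃ b ∈ B, b ∈ unitary (M : Type u) ∧ ∀ k : ℕ, M.φ (b ^ k) = ψ (h ^ k) := by
  have hstate := FreeProduct.isFreeState_freeProductForm (isTracialCharacter_character t hχ hψ)
  let M := hstate.ncProbSpace
  have hprod := freeProductForm_single_ofProd t hχ hψ
  have hprod_pow (g : H × K) (k : ℕ) :
      M.φ (single (ofProd g) (1 : ℂ) ^ k) = χ (g.1 ^ k) * ψ (g.2 ^ k) := by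
    rw [single_pow, one_pow, ← map_pow, hprod, Prod.pow_fst, Prod.pow_snd]
  let A : StarSubalgebra ℂ M := groupSubalgebra (ofProd.comp (MonoidHom.inl H K))
  let B : StarSubalgebra ℂ M := groupSubalgebra (ofProd.comp (MonoidHom.inr H K))
  let v : unitary (M : Type u) :=
    ⟨single (ofInt (Multiplicative.ofAdd 1)) 1, single_mem_unitary _⟩
  have hindep : M.Independent ![A, B] := NCProbSpace.independent_pair
    (fun _ hx _ hy => mul_comm_of_mem_groupSubalgebra_prod hx hy)
    (fun _ hx _ hy => map_mul_of_mem_groupSubalgebra_prod hχ.map_one hψ.map_one hprod hx hy)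
  have hv : M.IsFreeUnitaryBM t v := ⟨v.2, fun k => by
    rw [single_pow, one_pow, ← map_pow, freeProductForm_single_ofInt t hχ hψ]
    simp⟩
  have hfree : M.Free ![A ⊔ B, StarAlgebra.adjoin ℂ {(v : M)}] :=
    hstate.free.mono le_groupSubalgebra_of
  refine ⟨M, A, _, NCProbSpace.tFree_map_conj hindep hv hfree, fun h => ?_, fun h => ?_⟩
  · refine ⟨_, single_mem_groupSubalgebra _ h 1, single_mem_unitary _, fun k => ?_⟩
    exact (hprod_pow (h, 1) k).trans (by simp [hψ.map_one])
  · refine ⟨_, ⟨_, single_mem_groupSubalgebra _ h 1, rfl⟩,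
      Unitary.map_mem (Unitary.conjStarAlgAut ℂ M v) (single_mem_unitary _), fun k => ?_⟩
    refine (congr_arg M.φ (map_pow (Unitary.conjStarAlgAut ℂ M v) _ k).symm).trans
      ((M.φ_conj v _).trans ((hprod_pow (1, h) k).trans ?_))
    simp [hχ.map_one]

theorem exists_tFree_unitary (t : ℝ≥0∞) (p q : ℕ) :
    ∃ (M : NCProbSpace.{u}) (A B : StarSubalgebra ℂ M), M.TFree t A B ∧
      (∃ a ∈ A, a ∈ unitary (M : Type u) ∧ ∀ k, M.φ (a ^ k) = if p ∣ k then 1 else 0) ∧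
      ∃ b ∈ B, b ∈ unitary (M : Type u) ∧ ∀ k, M.φ (b ^ k) = if q ∣ k then 1 else 0 := by
  obtain ⟨M, A, B, hAB, hA, hB⟩ := exists_tFree_of_isTracialCharacter.{u} t
    (isTracialCharacter_delta (ULift (Multiplicative (ZMod p))))
    (isTracialCharacter_delta (ULift (Multiplicative (ZMod q))))
  have hdvd (n k : ℕ) : (ULift.up.{u} (Multiplicative.ofAdd (1 : ZMod n))) ^ k = 1 ↔ n ∣ k := by
    rw [← ULift.down_inj, ULift.pow_down, ← ofAdd_nsmul, ULift.one_down, ofAdd_eq_one, nsmul_one,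
      ZMod.natCast_eq_zero_iff]
  have hA := hA (ULift.up (Multiplicative.ofAdd 1))
  have hB := hB (ULift.up (Multiplicative.ofAdd 1))
  simp only [hdvd] at hA hB
  exact ⟨M, A, B, hAB, hA, hB⟩

end Model

section Uniqueness

/-- The `k`-th moment of a unitary element of order `p` whose powers other than `1` are centered;
`p = 0` stands for infinite order. -/
def orderMoment (p k : ℕ) : ℂ := if p ∣ k then 1 else 0

/-- The equations on a class function `F` which express that its cumulant form is additive on the
pairs `a + s`, `b + s'`, where `a` and `b` are `t`-free unitary elements of orders `p` and `q` and
`x = exp (-t)`. -/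
def AdditiveOnUnitaries (x : ℂ) (n : ℕ) (F : List ℕ → ℂ) : Prop :=
  ∀ p q : ℕ, p ≠ 1 → q ≠ 1 → ∀ s s' : ℂ,
    momentSum n F (shiftMoment (s + s') (NCProbSpace.mixMoment x (orderMoment p) (orderMoment q))) =
      momentSum n F (shiftMoment s (orderMoment p)) + momentSum n F (shiftMoment s' (orderMoment q))

section ShiftMoment

variable (s : ℂ) (g : ℕ → ℂ)

lemma shiftMoment_one : shiftMoment s g 1 = g 0 * s + g 1 := by
  simp [shiftMoment, Finset.sum_range_succ]

lemma shiftMoment_two : shiftMoment s g 2 = g 0 * s ^ 2 + 2 * g 1 * s + g 2 := by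
  norm_num [shiftMoment, Finset.sum_range_succ, Nat.choose]
  ring

lemma shiftMoment_three :
    shiftMoment s g 3 = g 0 * s ^ 3 + 3 * g 1 * s ^ 2 + 3 * g 2 * s + g 3 := by
  norm_num [shiftMoment, Finset.sum_range_succ, Nat.choose]
  ring

lemma shiftMoment_four :
    shiftMoment s g 4 = g 0 * s ^ 4 + 4 * g 1 * s ^ 3 + 6 * g 2 * s ^ 2 + 4 * g 3 * s + g 4 := by
  norm_num [shiftMoment, Finset.sum_range_succ, Nat.choose]
  ring

lemma shiftMoment_five :
    shiftMoment s g 5 = g 0 * s ^ 5 + 5 * g 1 * s ^ 4 + 10 * g 2 * s ^ 3 + 10 * g 3 * s ^ 2 +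
      5 * g 4 * s + g 5 := by
  norm_num [shiftMoment, Finset.sum_range_succ, Nat.choose]
  ring

end ShiftMoment

namespace AdditiveOnUnitaries

-- `hadd p q` below is the equation for the orders `p` and `q`: as the moments of order not
-- divisible by `p` vanish, few coefficients enter it and they are determined one after the other.

variable {x : ℂ} {F : List ℕ → ℂ}

lemma eq_zero_two (h : AdditiveOnUnitaries x 2 F) (hF : F [2] = 0) : F [1, 1] = 0 := by
  have hadd00 := h 0 0 (by decide) (by decide) 1 1
  simp only [momentSum_two, shiftMoment_one, hF, NCProbSpace.mixMoment, orderMoment,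
    Nat.reduceDvd, reduceIte] at hadd00
  linear_combination (1 / 2) * hadd00

lemma eq_zero_three (h : AdditiveOnUnitaries x 3 F) (hF : F [3] = 0) :
    F [2, 1] = 0 ∧ F [1, 1, 1] = 0 := by
  have hadd20 := h 2 0 (by decide) (by decide) 0 1
  have hadd00 := h 0 0 (by decide) (by decide) 1 1
  simp only [momentSum_three, shiftMoment_one, shiftMoment_two, hF, NCProbSpace.mixMoment,
    orderMoment, Nat.reduceDvd, reduceIte] at hadd20 hadd00
  have hF21 : F [2, 1] = 0 := by linear_combination (1 / 3) * hadd20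
  exact ⟨hF21, by linear_combination (1 / 6) * hadd00 - 3 * hF21⟩

lemma eq_zero_four (h : AdditiveOnUnitaries x 4 F) (hF : F [4] = 0) :
    F [3, 1] = 0 ∧ F [2, 2] = 0 ∧ F [2, 1, 1] = 0 ∧ F [1, 1, 1, 1] = 0 := by
  have hadd30 := h 3 0 (by decide) (by decide) 0 1
  have hadd22 := h 2 2 (by decide) (by decide) 0 0
  have hadd20 := h 2 0 (by decide) (by decide) 0 1
  have hadd00 := h 0 0 (by decide) (by decide) 1 1
  simp only [momentSum_four, shiftMoment_one, shiftMoment_two, shiftMoment_three, hF,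
    NCProbSpace.mixMoment, orderMoment, Nat.reduceDvd, reduceIte]
    at hadd30 hadd22 hadd20 hadd00
  have hF31 : F [3, 1] = 0 := by linear_combination (1 / 8) * hadd30
  have hF22 : F [2, 2] = 0 := by linear_combination (1 / 6) * hadd22
  simp only [hF31, hF22] at hadd20 hadd00
  have hF211 : F [2, 1, 1] = 0 := by linear_combination (1 / 6) * hadd20
  rw [hF211] at hadd00
  exact ⟨hF31, hF22, hF211, by linear_combination (1 / 14) * hadd00⟩

lemma eq_zero_five (h : AdditiveOnUnitaries x 5 F) (hF : F [5] = 0) :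
    F [4, 1] = 0 ∧ F [3, 2] = 0 ∧ F [3, 1, 1] = 0 ∧ F [2, 2, 1] = 0 ∧ F [2, 1, 1, 1] = 0 ∧
      F [1, 1, 1, 1, 1] = 0 := by
  have hadd40 := h 4 0 (by decide) (by decide) 0 1
  have hadd32 := h 3 2 (by decide) (by decide) 0 0
  have hadd30 := h 3 0 (by decide) (by decide) 0 1
  have hadd20 := h 2 0 (by decide) (by decide) 0 1
  have hadd20' := h 2 0 (by decide) (by decide) 0 2
  have hadd00 := h 0 0 (by decide) (by decide) 1 1
  simp only [momentSum_five, shiftMoment_one, shiftMoment_two, shiftMoment_three, shiftMoment_four,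
    hF, NCProbSpace.mixMoment, orderMoment, Nat.reduceDvd, reduceIte]
    at hadd40 hadd32 hadd30 hadd20 hadd20' hadd00
  have hF41 : F [4, 1] = 0 := by linear_combination (1 / 30) * hadd40
  have hF32 : F [3, 2] = 0 := by linear_combination (1 / 20) * hadd32
  simp only [hF41, hF32] at hadd30 hadd20 hadd20' hadd00
  have hF311 : F [3, 1, 1] = 0 := by linear_combination (1 / 20) * hadd30
  rw [hF311] at hadd20 hadd20' hadd00
  have hF221 : F [2, 2, 1] = 0 := by linear_combination (8 / 90) * hadd20 - (1 / 90) * hadd20'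
  rw [hF221] at hadd20 hadd00
  have hF2111 : F [2, 1, 1, 1] = 0 := by linear_combination (1 / 10) * hadd20
  rw [hF2111] at hadd00
  exact ⟨hF41, hF32, hF311, hF221, hF2111, by linear_combination (1 / 30) * hadd00⟩

lemma eq_zero_six (h : AdditiveOnUnitaries x 6 F) (hF : F [6] = 0) :
    F [5, 1] = 0 ∧ F [4, 2] = 0 ∧ F [4, 1, 1] = 0 ∧ F [3, 3] = 0 ∧ F [3, 2, 1] = 0 ∧
      F [3, 1, 1, 1] = 0 ∧ F [2, 2, 2] = 0 ∧ F [2, 2, 1, 1] = 0 ∧ F [2, 1, 1, 1, 1] = 0 ∧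
      F [1, 1, 1, 1, 1, 1] = 0 := by
  have hadd50 := h 5 0 (by decide) (by decide) 0 1
  have hadd42 := h 4 2 (by decide) (by decide) 0 0
  have hadd40 := h 4 0 (by decide) (by decide) 0 1
  have hadd33 := h 3 3 (by decide) (by decide) 0 0
  have hadd32 := h 3 2 (by decide) (by decide) 0 1
  have hadd30 := h 3 0 (by decide) (by decide) 0 1
  have hadd22 := h 2 2 (by decide) (by decide) 0 0
  have hadd20 := h 2 0 (by decide) (by decide) 0 1
  have hadd20' := h 2 0 (by decide) (by decide) 0 2
  have hadd00 := h 0 0 (by decide) (by decide) 1 1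
  simp only [momentSum_six, shiftMoment_one, shiftMoment_two, shiftMoment_three, shiftMoment_four,
    shiftMoment_five, hF, NCProbSpace.mixMoment, orderMoment, Nat.reduceDvd, reduceIte]
    at hadd50 hadd42 hadd40 hadd33 hadd32 hadd30 hadd22 hadd20 hadd20' hadd00
  have hF51 : F [5, 1] = 0 := by linear_combination (1 / 144) * hadd50
  have hF42 : F [4, 2] = 0 := by linear_combination (1 / 90) * hadd42
  have hF33 : F [3, 3] = 0 := by linear_combination (1 / 80) * hadd33
  simp only [hF51, hF42, hF33] at hadd40 hadd22 hadd32 hadd30 hadd20 hadd20' hadd00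
  have hF411 : F [4, 1, 1] = 0 := by linear_combination (1 / 90) * hadd40
  have hF222 : F [2, 2, 2] = 0 := by linear_combination (1 / 90) * hadd22
  simp only [hF411, hF222] at hadd32 hadd30 hadd20 hadd20' hadd00
  have hF321 : F [3, 2, 1] = 0 := by linear_combination (1 / 120) * (hadd32 - hadd30)
  rw [hF321] at hadd30 hadd20 hadd20' hadd00
  have hF3111 : F [3, 1, 1, 1] = 0 := by linear_combination (1 / 40) * hadd30
  rw [hF3111] at hadd20 hadd20' hadd00
  have hF2211 : F [2, 2, 1, 1] = 0 := by
    linear_combination (16 / 540) * hadd20 - (1 / 540) * hadd20'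
  rw [hF2211] at hadd20 hadd00
  have hF21111 : F [2, 1, 1, 1, 1] = 0 := by linear_combination (1 / 15) * hadd20
  rw [hF21111] at hadd00
  exact ⟨hF51, hF42, hF411, hF33, hF321, hF3111, hF222, hF2211, hF21111,
    by linear_combination (1 / 62) * hadd00⟩

lemma comp_cycleShape_eq_zero {n : ℕ} (hn : n ∈ Finset.Icc 2 6) (h : AdditiveOnUnitaries x n F)
    (hF : F [n] = 0) (σ : Equiv.Perm (Fin n)) : F (cycleShape σ) = 0 := by
  -- A vanishing sum of squared moduli reduces the claim to one shape at a time.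
  suffices hsum : ∑ σ : Equiv.Perm (Fin n), star (F (cycleShape σ)) * F (cycleShape σ) = 0 by
    rw [Finset.sum_eq_zero_iff_of_nonneg fun σ _ => star_mul_self_nonneg _] at hsum
    exact CStarRing.star_mul_self_eq_zero_iff _ |>.1 (hsum σ (Finset.mem_univ σ))
  obtain ⟨hn₂, hn₆⟩ := Finset.mem_Icc.1 hn
  interval_cases n
  · rw [sum_comp_cycleShape_two fun l => star (F l) * F l]
    simp [hF, h.eq_zero_two hF]
  · rw [sum_comp_cycleShape_three fun l => star (F l) * F l]
    simp [hF, h.eq_zero_three hF]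
  · rw [sum_comp_cycleShape_four fun l => star (F l) * F l]
    simp [hF, h.eq_zero_four hF]
  · rw [sum_comp_cycleShape_five fun l => star (F l) * F l]
    simp [hF, h.eq_zero_five hF]
  · rw [sum_comp_cycleShape_six fun l => star (F l) * F l]
    simp [hF, h.eq_zero_six hF]

end AdditiveOnUnitaries

namespace NCProbSpace

variable {M : NCProbSpace.{u}} {A B : StarSubalgebra ℂ M}

lemma TFree.notMem_of_mem_unitary {t : ℝ≥0∞} (h : M.TFree t A B) {y : M}
    (hy : y ∈ unitary (M : Type u)) (hφy : M.φ y = 0) {s : ℂ} (hA : y + s • (1 : M) ∈ A) :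
    y + s • (1 : M) ∉ B := fun hB => by
  have hyA : y ∈ A := by simpa using sub_smul_one_mem hA s
  have hyB : y ∈ B := by simpa using sub_smul_one_mem hB s
  have hφ := h.φ_mul hyA (star_mem hyB)
  rw [hφy, zero_mul, Unitary.mul_star_self_of_mem hy, M.φ_one] at hφ
  exact one_ne_zero hφ

lemma cumulantForm_add {n : ℕ} {c : Equiv.Perm (Fin n) → ℂ} (hn : n ≠ 0)
    (h : ∀ m : Fin n → M, (∀ i, m i ∈ A ∨ m i ∈ B) → (¬ ∀ i, m i ∈ A) → (¬ ∀ i, m i ∈ B) →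
      ∑ σ, c σ * M.permForm σ m = 0)
    {a b : M} (haA : a ∈ A) (haB : a ∉ B) (hbB : b ∈ B) (hbA : b ∉ A) :
    M.cumulantForm c (fun _ => a + b) =
      M.cumulantForm c (fun _ => a) + M.cumulantForm c (fun _ => b) := by
  have : NeZero n := ⟨hn⟩
  have hmixed : ∀ S : Finset (Fin n), S ∉ ({Finset.univ, ∅} : Finset _) →
      M.cumulantForm c (S.piecewise (fun _ => a) fun _ => b) = 0 := fun S hS => by
    simp only [Finset.mem_insert, Finset.mem_singleton, not_or] at hS
    obtain ⟨i, hi⟩ := Finset.nonempty_iff_ne_empty.2 hS.2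
    obtain ⟨j, hj⟩ : ∃ j, j ∉ S := by simpa [Finset.eq_univ_iff_forall] using hS.1
    rw [M.cumulantForm_apply]
    refine h _ (fun k => ?_) (fun hA => hbA ?_) fun hB => haB ?_
    · by_cases hk : k ∈ S <;> simp [hk, haA, hbB]
    · simpa [hj] using hA j
    · simpa [hi] using hB i
  change M.cumulantForm c ((fun _ => a) + fun _ => b) = _
  rw [MultilinearMap.map_add_univ, ← Finset.sum_subset (Finset.subset_univ {Finset.univ, ∅})
    fun S _ hS => hmixed S hS, Finset.sum_pair Finset.univ_nonempty.ne_empty,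
    Finset.piecewise_univ, Finset.piecewise_empty]

end NCProbSpace

variable {n : ℕ}

lemma additiveOnUnitaries_of_vanishing (t : ℝ≥0∞) (hn : n ∈ Finset.Icc 2 6) {F : List ℕ → ℂ}
    (h : ∀ (M : NCProbSpace.{u}) (A B : StarSubalgebra ℂ M), M.TFree t A B →
      ∀ m : Fin n → M, (∀ i, m i ∈ A ∨ m i ∈ B) → (¬ ∀ i, m i ∈ A) → (¬ ∀ i, m i ∈ B) →
        ∑ σ, F (cycleShape σ) * M.permForm σ m = 0) : AdditiveOnUnitaries (expNeg t) n F := by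
  intro p q hp hq s s'
  obtain ⟨M, A, B, hAB, ⟨a, haA, hau, ha⟩, b, hbB, hbu, hb⟩ := exists_tFree_unitary.{u} t p q
  have hφa : M.φ a = 0 := by simpa [hp] using ha 1
  have hφb : M.φ b = 0 := by simpa [hq] using hb 1
  have haA' := add_mem haA (A.smul_mem (one_mem A) s)
  have hbB' := add_mem hbB (B.smul_mem (one_mem B) s')
  have hadd := NCProbSpace.cumulantForm_add (by grind) (h M A B hAB) haA'
    (hAB.notMem_of_mem_unitary hau hφa haA') hbB'
    (fun hbA' => hAB.notMem_of_mem_unitary hbu hφb hbA' hbB')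
  simp only [NCProbSpace.cumulantForm_const] at hadd
  rw [momentSum_congr _ fun k hk => hAB.φ_add_add_smul_one_pow haA hbB hφa hφb s s'
    (hk.trans (Finset.mem_Icc.1 hn).2)] at hadd
  simp only [NCProbSpace.φ_add_smul_one_pow, ha, hb] at hadd
  exact hadd

lemma IsTFreeCumulant.smul {t : ℝ≥0∞} {c : Equiv.Perm (Fin n) → ℂ}
    (h : IsTFreeCumulant.{u} t n c) {z : ℂ} (hz : z ≠ 0) : IsTFreeCumulant.{u} t n (z • c) := by
  simp only [IsTFreeCumulant, Pi.smul_apply, smul_eq_mul, mul_assoc, ← Finset.mul_sum]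
  refine ⟨mul_ne_zero hz h.1, fun M A B hAB m hm hA hB => ?_⟩
  rw [h.2 M A B hAB m hm hA hB, mul_zero]

theorem IsTFreeCumulant.eq_smul {t : ℝ≥0∞} (hn : n ∈ Finset.Icc 2 6)
    {c : Equiv.Perm (Fin n) → ℂ} (h : IsTFreeCumulant.{u} t n c) (hc : IsConjInvariant c) :
    ∃ z : ℂ, z ≠ 0 ∧ c = z • fun σ => (tFreeCoeff (expNeg t) (cycleShape σ) : ℂ) := by
  obtain ⟨F, rfl⟩ := exists_eq_comp_cycleShape hc
  refine ⟨F [n], fun hF => h.1 ?_, ?_⟩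
  · rw [Finset.sum_congr rfl fun σ _ => Function.comp_apply,
      sum_cycleType_eq_singleton (Finset.mem_Icc.1 hn).1, hF, mul_zero]
  have hdiff : AdditiveOnUnitaries (expNeg t) n
      fun l => F l - F [n] * (tFreeCoeff (expNeg t) l : ℂ) :=
    additiveOnUnitaries_of_vanishing.{u} t hn fun M A B hAB m hm hA hB => by
      simp only [sub_mul, Finset.sum_sub_distrib, mul_assoc, ← Finset.mul_sum]
      exact (congr_arg₂ (· - F [n] * ·) (h.2 M A B hAB m hm hA hB)
        ((isTFreeCumulant_tFreeCoeff.{u} t hn).2 M A B hAB m hm hA hB)).trans (by simp)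
  funext σ
  exact sub_eq_zero.1
    (hdiff.comp_cycleShape_eq_zero hn (by simp [tFreeCoeff_singleton _ hn]) σ)

end Uniqueness

theorem mainTheorem2 (t : ℝ≥0∞) (n : ℕ) (hn : n ∈ Finset.Icc 2 6) :
    ∃ c : Equiv.Perm (Fin n) → ℂ,
      IsTFreeCumulant.{u} t n c ∧ IsConjInvariant c ∧
      (∀ σ, c σ = (tFreeCoeff (expNeg t) (cycleShape σ) : ℂ)) ∧
      ∀ c' : Equiv.Perm (Fin n) → ℂ,
        (IsTFreeCumulant.{u} t n c' ∧ IsConjInvariant c') ↔ ∃ z : ℂ, z ≠ 0 ∧ c' = z • c := by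
  have h := isTFreeCumulant_tFreeCoeff.{u} t hn
  have hc : IsConjInvariant fun σ : Equiv.Perm (Fin n) =>
      (tFreeCoeff (expNeg t) (cycleShape σ) : ℂ) :=
    isConjInvariant_comp_cycleShape fun l => (tFreeCoeff (expNeg t) l : ℂ)
  refine ⟨_, h, hc, fun _ => rfl, fun c' => ⟨fun h' => h'.1.eq_smul hn h'.2, ?_⟩⟩
  rintro ⟨z, hz, rfl⟩
  exact ⟨h.smul hz, fun σ ρ => congr_arg (z • ·) (hc σ ρ)⟩
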